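/- Let $n\ge 1$ be an integer and let $s\in\mathbb R$ satisfy $s-\frac n2\in(0,1)\cup(1,2)$. Let $P_\ell$ be the orthogonal projection of the real space $L^2(\mathbb S^n)$ onto the spherical harmonics of degree $\ell$, and let $H^s(\mathbb S^n)$ be the real Sobolev space with norm $$\|u\|_{H^s}^2=\|u\|_{L^2}^2+\sum_{\ell\ge 0}(\ell(\ell+n-1))^s\|P_\ell u\|_{L^2}^2 .$$ For $u,v\in H^s(\mathbb S^n)$ put $$a_{2s}[u,v]=\sum_{\ell\ge0}\frac{\Gamma(\ell+\frac n2+s)}{\Gamma(\ell+\frac n2-s)}\,(P_\ell u,P_\ell v)_{L^2},\qquad a_{2s}[u]=a_{2s}[u,u].$$ Let $$\mathcal M=\Big\{\omega\mapsto c\,(1-\zeta\cdot\omega)^{\frac{2s-n}{2}}\;:\;c>0,\ \zeta\in\mathbb R^{n+1},\ |\zeta|<1\Big\}\subset H^s(\mathbb S^n),$$ and for $h\in\mathcal M$ let $T_h\mathcal M\subset H^s(\mathbb S^n)$ be the tangent space, i.e. the set of velocities $\gamma'(0)$ of curves $\gamma$ in $\mathcal M$ with $\gamma(0)=h$ that are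 differentiable at $0$ in $H^s(\mathbb S^n)$, and $$(T_h\mathcal M)^\perp=\{\rho\in H^s(\mathbb S^n): a_{2s}[\rho,\varphi]=0\ \text{ for all }\varphi\in T_h\mathcal M\}.$$ For $u\in H^s(\mathbb S^n)$ let $$\mathsf d(u)=\inf\{a_{2s}[\rho]\;:\;u=h+\rho,\ h\in\mathcal M,\ \rho\in(T_h\mathcal M)^\perp\}\in[-\infty,\infty].$$ Then there are neighborhoods $U,V$ of the constant function $1$ in $H^s(\mathbb S^n)$ such that for every $u\in U$ there is a unique $h\in V\cap\mathcal M$ with $u-h\in(T_h\mathcal M)^\perp$. Moreover, for this $h$, $\mathsf d(u)=a_{2s}[u-h]$. -/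

import Mathlib

open MeasureTheory Filter Topology

noncomputable section

namespace ReverseSobolev

/-- The unit sphere `S^n` in `ℝ^(n+1)`. -/
abbrev Sph (n : ℕ) : Type := Metric.sphere (0 : EuclideanSpace ℝ (Fin (n + 1))) 1

/-- The (non-normalized) surface measure on `S^n`. -/
def surf (n : ℕ) : Measure (Sph n) :=
  (volume : Measure (EuclideanSpace ℝ (Fin (n + 1)))).toSphere

instance (n : ℕ) : IsFiniteMeasure (surf n) := by unfold surf; infer_instance

/-- The real Hilbert space `L²(S^n)`. -/
abbrev L2 (n : ℕ) : Type := Lp ℝ 2 (surf n)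

/-- The `i`-th coordinate function on `S^n`. -/
def coord (n : ℕ) (i : Fin (n + 1)) : C(Sph n, ℝ) where
  toFun ω := (ω : EuclideanSpace ℝ (Fin (n + 1))) i
  continuous_toFun := by fun_prop

/-- Restriction of a polynomial on `ℝ^(n+1)` to `S^n`, as an element of `L²(S^n)`. -/
def restrictPoly (n : ℕ) : MvPolynomial (Fin (n + 1)) ℝ →ₗ[ℝ] L2 n :=
  (ContinuousMap.toLp 2 (surf n) ℝ : C(Sph n, ℝ) →L[ℝ] L2 n).toLinearMap ∘ₗ
    (MvPolynomial.aeval (coord n)).toLinearMap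

/-- The Laplacian on polynomials in `n + 1` variables. -/
def polyLaplacian (n : ℕ) :
    MvPolynomial (Fin (n + 1)) ℝ →ₗ[ℝ] MvPolynomial (Fin (n + 1)) ℝ :=
  ∑ i, (MvPolynomial.pderiv i).toLinearMap ∘ₗ (MvPolynomial.pderiv i).toLinearMap

/-- Harmonic homogeneous polynomials of degree `ℓ` in `n + 1` variables. -/
def harmonicPoly (n ℓ : ℕ) : Submodule ℝ (MvPolynomial (Fin (n + 1)) ℝ) :=
  MvPolynomial.homogeneousSubmodule (Fin (n + 1)) ℝ ℓ ⊓ LinearMap.ker (polyLaplacian n)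

/-- The space `E_ℓ ⊆ L²(S^n)` of spherical harmonics of degree `ℓ`. -/
def sphHarm (n ℓ : ℕ) : Submodule ℝ (L2 n) :=
  (harmonicPoly n ℓ).map (restrictPoly n)

instance (n ℓ : ℕ) : FiniteDimensional ℝ (sphHarm n ℓ) := by
  have h1 : FiniteDimensional ℝ (MvPolynomial.homogeneousSubmodule (Fin (n + 1)) ℝ ℓ) :=
    Module.Finite.iff_fg.mpr (MvPolynomial.homogeneousSubmodule_fg _ _ ℓ)
  have h2 : FiniteDimensional ℝ (harmonicPoly n ℓ) :=
    Submodule.finiteDimensional_of_le inf_le_left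
  unfold sphHarm
  infer_instance

/-- `P_ℓ`, the `L²`-orthogonal projection onto spherical harmonics of degree `ℓ`. -/
def proj (n ℓ : ℕ) : L2 n →L[ℝ] L2 n := (sphHarm n ℓ).starProjection

/-- The eigenvalue `ℓ (ℓ + n - 1)` of `-Δ` on spherical harmonics of degree `ℓ`. -/
def lapEig (n ℓ : ℕ) : ℝ := (ℓ : ℝ) * ((ℓ : ℝ) + (n : ℝ) - 1)

lemma lapEig_nonneg (n ℓ : ℕ) : 0 ≤ lapEig n ℓ := by
  unfold lapEig
  rcases Nat.eq_zero_or_pos ℓ with rfl | h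
  · simp
  · have h1 : (1 : ℝ) ≤ ℓ := by exact_mod_cast h
    have h2 : (0 : ℝ) ≤ n := n.cast_nonneg
    exact mul_nonneg (by linarith) (by linarith)

/-- The coefficient sequence of `(-Δ)^(s/2) u`. -/
def fracCoeff (n : ℕ) (s : ℝ) (u : L2 n) (ℓ : ℕ) : L2 n :=
  (lapEig n ℓ ^ (s / 2)) • proj n ℓ u

/-- `H^s(S^n)` as a subspace of `L²(S^n)`: those `u` with `(-Δ)^(s/2) u ∈ L²`. -/
def sobolevSubmodule (n : ℕ) (s : ℝ) : Submodule ℝ (L2 n) where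
  carrier := {u | Memℓp (fracCoeff n s u) 2}
  zero_mem' := by
    have : fracCoeff n s 0 = 0 := by ext1 ℓ; simp [fracCoeff]
    simp only [Set.mem_ofPred_eq, this]
    exact zero_memℓp
  add_mem' {u v} hu hv := by
    have : fracCoeff n s (u + v) = fracCoeff n s u + fracCoeff n s v := by
      ext1 ℓ; simp [fracCoeff]
    simp only [Set.mem_ofPred_eq, this]
    exact hu.add hv
  smul_mem' c u hu := by
    have : fracCoeff n s (c • u) = c • fracCoeff n s u := by
      ext1 ℓ; simp [fracCoeff, smul_comm c]
    simp only [Set.mem_ofPred_eq, this]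
    exact hu.const_smul c

/-- The Sobolev space `H^s(S^n)`; a type of its own, since its norm is not that of `L²`. -/
def Sob (n : ℕ) (s : ℝ) : Type := sobolevSubmodule n s

instance (n : ℕ) (s : ℝ) : AddCommGroup (Sob n s) :=
  inferInstanceAs (AddCommGroup (sobolevSubmodule n s))

instance (n : ℕ) (s : ℝ) : Module ℝ (Sob n s) :=
  inferInstanceAs (Module ℝ (sobolevSubmodule n s))

/-- The inclusion `H^s(S^n) → L²(S^n)`. -/
def Sob.toL2 {n : ℕ} {s : ℝ} : Sob n s →ₗ[ℝ] L2 n := (sobolevSubmodule n s).subtype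

/-- `(-Δ)^(s/2)` on `H^s(S^n)`, as the square summable sequence of its components. -/
def Sob.frac {n : ℕ} {s : ℝ} : Sob n s →ₗ[ℝ] lp (fun _ : ℕ => L2 n) 2 where
  toFun u := ⟨fracCoeff n s u.toL2, u.2⟩
  map_add' u v := by
    refine Subtype.ext (funext fun ℓ => ?_)
    change fracCoeff n s (u + v).toL2 ℓ = fracCoeff n s u.toL2 ℓ + fracCoeff n s v.toL2 ℓ
    simp [fracCoeff]
  map_smul' c u := by
    refine Subtype.ext (funext fun ℓ => ?_)
    change fracCoeff n s (c • u).toL2 ℓ = c • fracCoeff n s u.toL2 ℓ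
    simp [fracCoeff, smul_comm c]

/-- `u ↦ (u, (-Δ)^(s/2) u)`, whose graph norm is the `H^s` norm. -/
def Sob.graph {n : ℕ} {s : ℝ} :
    Sob n s →ₗ[ℝ] WithLp 2 (L2 n × lp (fun _ : ℕ => L2 n) 2) :=
  (WithLp.linearEquiv 2 ℝ (L2 n × lp (fun _ : ℕ => L2 n) 2)).symm.toLinearMap ∘ₗ
    (Sob.toL2.prod Sob.frac)

lemma Sob.graph_injective {n : ℕ} {s : ℝ} : Function.Injective (Sob.graph (n := n) (s := s)) := by
  intro u v h
  have h' : Sob.toL2 u = Sob.toL2 v := congrArg (fun x => x.fst) h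
  exact Subtype.ext h'

instance (n : ℕ) (s : ℝ) : NormedAddCommGroup (Sob n s) :=
  NormedAddCommGroup.induced (Sob n s) _ Sob.graph Sob.graph_injective

instance (n : ℕ) (s : ℝ) : NormedSpace ℝ (Sob n s) :=
  NormedSpace.induced ℝ (Sob n s) _ Sob.graph

/-- The norm of `H^s`: `‖u‖² = ‖u‖²_{L²} + ∑_ℓ (ℓ(ℓ+n-1))^s ‖P_ℓ u‖²_{L²}`. -/
lemma Sob.norm_sq_eq {n : ℕ} {s : ℝ} (u : Sob n s) :
    ‖u‖ ^ 2 = ‖u.toL2‖ ^ 2 + ∑' ℓ, lapEig n ℓ ^ s * ‖proj n ℓ u.toL2‖ ^ 2 := by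
  have h0 : ‖u‖ = ‖Sob.graph u‖ := rfl
  have h1 : ‖Sob.graph u‖ ^ 2 = ‖u.toL2‖ ^ 2 + ‖Sob.frac u‖ ^ 2 :=
    WithLp.prod_norm_sq_eq_of_L2 _
  have h2 := lp.norm_rpow_eq_tsum (p := 2) (by norm_num) (Sob.frac u)
  simp only [ENNReal.toReal_ofNat, Real.rpow_two] at h2
  rw [h0, h1, h2]
  congr 1
  refine tsum_congr fun ℓ => ?_
  change ‖(lapEig n ℓ ^ (s / 2)) • proj n ℓ u.toL2‖ ^ 2 = _
  rw [norm_smul, mul_pow, Real.norm_eq_abs, sq_abs, ← Real.rpow_two,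
    ← Real.rpow_mul (lapEig_nonneg n ℓ)]
  norm_num

/-- `α_{2s}(ℓ) = Γ(ℓ + n/2 + s) / Γ(ℓ + n/2 - s)`. -/
def alpha (n : ℕ) (s : ℝ) (ℓ : ℕ) : ℝ :=
  Real.Gamma (ℓ + n / 2 + s) / Real.Gamma (ℓ + n / 2 - s)

/-- The bilinear form `a_{2s}[u, v] = ∑_ℓ α_{2s}(ℓ) (P_ℓ u, P_ℓ v)` on `H^s(S^n)`. -/
def aForm {n : ℕ} {s : ℝ} (u v : Sob n s) : ℝ :=
  ∑' ℓ, alpha n s ℓ * inner ℝ (proj n ℓ u.toL2) (proj n ℓ v.toL2)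

/-- The quadratic form `a_{2s}[u] = ∑_ℓ α_{2s}(ℓ) ‖P_ℓ u‖²` on `H^s(S^n)`. -/
def aQuad {n : ℕ} {s : ℝ} (u : Sob n s) : ℝ :=
  ∑' ℓ, alpha n s ℓ * ‖proj n ℓ u.toL2‖ ^ 2

/-- The functions `ω ↦ c (1 - ζ·ω)^((2s-n)/2)` with `c > 0`, `|ζ| < 1`, in `H^s(S^n)`. -/
def optimizers (n : ℕ) (s : ℝ) : Set (Sob n s) :=
  {h | ∃ c : ℝ, 0 < c ∧ ∃ ζ : EuclideanSpace ℝ (Fin (n + 1)), ‖ζ‖ < 1 ∧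
    ∀ᵐ ω ∂(surf n), h.toL2 ω =
      c * (1 - inner ℝ ζ (ω : EuclideanSpace ℝ (Fin (n + 1)))) ^ ((2 * s - n) / 2)}

/-- The tangent space at `h` of the manifold of optimizers: the velocities at time `0` of
curves in the manifold through `h`, differentiable at `0` as curves in `H^s(S^n)`. -/
def tangent {n : ℕ} {s : ℝ} (h : Sob n s) : Set (Sob n s) :=
  {η | ∃ γ : ℝ → Sob n s, (∀ᶠ t in 𝓝 0, γ t ∈ optimizers n s) ∧ γ 0 = h ∧ HasDerivAt γ η 0}

/-- The orthogonal complement of the tangent space at `h` with respect to `a_{2s}`. -/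
def tangentPerp {n : ℕ} {s : ℝ} (h : Sob n s) : Set (Sob n s) :=
  {ρ | ∀ φ ∈ tangent h, aForm ρ φ = 0}

/-- The modified distance of `u` to the optimizers, an infimum in `[-∞, ∞]`. -/
def modDist {n : ℕ} {s : ℝ} (u : Sob n s) : EReal :=
  sInf {x | ∃ h ∈ optimizers n s, ∃ ρ ∈ tangentPerp h, u = h + ρ ∧ x = ((aQuad ρ : ℝ) : EReal)}

end ReverseSobolev

end

open ReverseSobolev

noncomputable section

namespace ReverseSobolev

/-! Write σ = s − n/2 and let φ_ζ = (1 − ζ·ω)^σ. Near the parameters (c, ζ) = (1, 0) the theorem is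
an application of the implicit function theorem (`exists_projection`) to the equation a[u − h, ·] =
0 on T_hM. The form need not be positive, but it is nondegenerate on the tangent space at 1, which
is spanned by the harmonics of degree 0 and 1, because α(0) and α(1) do not vanish
(`injective_pullback_param`).

The formula for `modDist` needs more: no optimizer far from 1 may give an orthogonal decomposition
of u. As the form is possibly indefinite and M is not compact, neither coercivity nor minimization
gives this; it comes from conformal invariance (`exists_moment_le_norm_sub`). The infinitesimal
conformal operator L in direction e, of weight σ, is antisymmetric for a (`aBil_lieOp`), by the
recursion for α. For ζ = re the function w = Lφ_ζ is a combination of φ_ζ and its radial derivative,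
hence tangent to M. If u − cφ_ζ is orthogonal to the tangent space, then a[u, w] = c a[φ_ζ, Lφ_ζ] =
0, so a[1, w] = −a[u − 1, w] = O(‖u − 1‖ ‖w‖). Antisymmetry also gives a[1, w] = −a[L1, φ_ζ], a
nonzero multiple of the integral of (e·ω)φ_ζ.

Two facts conclude. The functions w are bounded in H^s up to |ζ| = 1 (`exists_norm_bubbleLie_le`):
they are bounded in L², a[w, w] does not grow in absolute value along rays, and Gårding's inequality
combines the two. The first moment of φ_ζ is bounded away from 0 for δ ≤ |ζ| ≤ 1
(`exists_moment_le`). So ζ tends to 0 as u tends to 1, and then c tends to 1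
(`eventually_forall_param_mem`).

The same localization shows that points of M near 1 have parameters near (1, 0). Hence velocities of
arbitrary curves in M lie in the range of the derivative of the parametrization
(`eventually_velocity_mem_range`), and near 1 the tangent space by curves is the one the implicit
function theorem sees. -/

/-- The ambient Euclidean space `ℝ^(n+1)`. -/
abbrev Amb (n : ℕ) : Type := EuclideanSpace ℝ (Fin (n + 1))

/-- The value at a point of `ℝ^(n+1)` of a polynomial. -/
def polyVal {n : ℕ} (p : MvPolynomial (Fin (n + 1)) ℝ) (x : Amb n) : ℝ :=
  MvPolynomial.eval (fun i => x i) p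

/-! ### Gaussian integrals of polynomials -/

section Gaussian

variable {n : ℕ}

lemma hasLineDerivAt_polyVal (p : MvPolynomial (Fin (n + 1)) ℝ) (x : Amb n) (i : Fin (n + 1)) :
    HasLineDerivAt ℝ (polyVal p) (polyVal (MvPolynomial.pderiv i p) x) x
      (EuclideanSpace.single i 1) := by
  unfold HasLineDerivAt polyVal
  induction p using MvPolynomial.induction_on with
  | C a => simpa using hasDerivAt_const (0 : ℝ) a
  | add p q hp hq => simpa using hp.fun_add hq
  | mul_X p j hp =>
    have hX : HasDerivAt (fun t : ℝ => x j + t * (if j = i then 1 else 0))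
        (if j = i then 1 else 0) 0 := by
      simpa using ((hasDerivAt_id (0 : ℝ)).mul_const (if j = i then (1 : ℝ) else 0)).const_add (x j)
    have := hp.fun_mul hX
    have h0 : ∀ t : ℝ, (x + t • EuclideanSpace.single i (1 : ℝ)) j =
        x j + t * (if j = i then 1 else 0) := fun t => by simp
    simp only [Derivation.leibniz, MvPolynomial.pderiv_X, smul_eq_mul, map_add, map_mul,
      MvPolynomial.eval_X, h0]
    refine this.congr_deriv ?_
    simp only [zero_mul, zero_smul, add_zero, Pi.single_apply]
    by_cases h : j = i
    · subst h; simp; ring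
    · simp [h]; ring

/-- Linear growth is absorbed by an arbitrarily small part of the Gaussian exponent; one variable at
a time, this makes all polynomials integrable. -/
lemma le_mul_exp_sq {b : ℝ} (hb : 0 < b) (t : ℝ) :
    t ≤ (1 + 1 / b) * Real.exp (b * t ^ 2) := by
  have h1 := Real.add_one_le_exp (b * t ^ 2)
  have h2 : t ≤ 1 + t ^ 2 := by nlinarith [sq_nonneg (t - 1)]
  have h3 : t ^ 2 = (1 / b) * (b * t ^ 2) := by field_simp
  have h4 : 0 ≤ b * t ^ 2 := by positivity
  have h5 : (1 / b) * (b * t ^ 2) ≤ (1 / b) * Real.exp (b * t ^ 2) :=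
    mul_le_mul_of_nonneg_left (by linarith) (by positivity)
  have h6 : 1 ≤ Real.exp (b * t ^ 2) := Real.one_le_exp h4
  linarith

lemma integrable_exp_neg_mul_norm_sq {b : ℝ} (hb : 0 < b) :
    Integrable (fun x : Amb n => Real.exp (-b * ‖x‖ ^ 2)) := by
  have := (GaussianFourier.integrable_cexp_neg_mul_sq_norm_add (V := Amb n) (b := b)
    (by simpa using hb) 0 0).re
  convert this using 2 with x
  simp [← Complex.ofReal_pow, ← Complex.ofReal_mul, ← Complex.ofReal_neg, ← Complex.ofReal_exp]

/-- A factor of at most linear growth does not destroy integrability against all Gaussians. -/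
lemma integrable_mul_gaussian {f g : Amb n → ℝ} (hg : Continuous g) (hgb : ∀ x, |g x| ≤ ‖x‖)
    (hf : ∀ b > 0, Integrable (fun x => f x * Real.exp (-b * ‖x‖ ^ 2))) {b : ℝ} (hb : 0 < b) :
    Integrable (fun x => f x * g x * Real.exp (-b * ‖x‖ ^ 2)) := by
  -- The Gaussian is split into two halves: one keeps `f` integrable, the other bounds `g`.
  have h := hf (b / 2) (by positivity)
  have h2 := h.mul_bdd (c := 1 + 1 / (b / 2)) (g := fun x => g x * Real.exp (-(b / 2) * ‖x‖ ^ 2))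
    (by fun_prop) (Eventually.of_forall fun x => by
      have h1 := (hgb x).trans (le_mul_exp_sq (b := b / 2) (by positivity) ‖x‖)
      rw [norm_mul, Real.norm_eq_abs, Real.norm_eq_abs, Real.abs_exp, neg_mul, Real.exp_neg,
        ← div_eq_mul_inv, div_le_iff₀ (Real.exp_pos _)]
      exact h1)
  refine h2.congr (Eventually.of_forall fun x => ?_)
  have : Real.exp (-b * ‖x‖ ^ 2) =
      Real.exp (-(b / 2) * ‖x‖ ^ 2) * Real.exp (-(b / 2) * ‖x‖ ^ 2) := by
    rw [← Real.exp_add]; ring_nf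
  simp only [this]; ring

lemma integrable_polyVal_gaussian (p : MvPolynomial (Fin (n + 1)) ℝ) {b : ℝ} (hb : 0 < b) :
    Integrable (fun x : Amb n => polyVal p x * Real.exp (-b * ‖x‖ ^ 2)) := by
  induction p using MvPolynomial.induction_on generalizing b with
  | C a => simpa [polyVal] using (integrable_exp_neg_mul_norm_sq hb).const_mul a
  | add p q hp hq =>
    refine ((hp hb).add (hq hb)).congr (Eventually.of_forall fun x => ?_)
    simp [polyVal, add_mul]
  | mul_X p j hp =>
    have := integrable_mul_gaussian (g := fun x : Amb n => x j) (by fun_prop)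
      (fun x => by simpa using PiLp.norm_apply_le x j) (fun b hb => hp hb) hb
    simpa [polyVal] using this

lemma integrable_norm_pow_gaussian (d : ℕ) {b : ℝ} (hb : 0 < b) :
    Integrable (fun x : Amb n => ‖x‖ ^ d * Real.exp (-b * ‖x‖ ^ 2)) := by
  induction d generalizing b with
  | zero => simpa using integrable_exp_neg_mul_norm_sq hb
  | succ d hd =>
    simpa [pow_succ] using integrable_mul_gaussian (g := fun x : Amb n => ‖x‖) (by fun_prop)
      (fun x => by simp) (fun b hb => hd hb) hb

lemma hasLineDerivAt_gaussian (x : Amb n) (i : Fin (n + 1)) :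
    HasLineDerivAt ℝ (fun x : Amb n => Real.exp (-(1 / 2) * ‖x‖ ^ 2))
      (-(x i) * Real.exp (-(1 / 2) * ‖x‖ ^ 2)) x (EuclideanSpace.single i 1) := by
  have h : HasFDerivAt (fun x : Amb n => -(1 / 2) * ‖x‖ ^ 2) ((-(1 / 2) : ℝ) • (2 • innerSL ℝ x)) x := by
    simpa using (hasStrictFDerivAt_norm_sq x).hasFDerivAt.const_mul (-(1 / 2) : ℝ)
  have := (h.exp).hasLineDerivAt (EuclideanSpace.single i 1)
  have heq : (Real.exp (-(1 / 2) * ‖x‖ ^ 2) • (-(1 / 2) : ℝ) • 2 • innerSL ℝ x)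
      (EuclideanSpace.single i (1 : ℝ)) = -(x i) * Real.exp (-(1 / 2) * ‖x‖ ^ 2) := by
    have hin : inner ℝ x (EuclideanSpace.single i (1 : ℝ)) = x i := by
      rw [real_inner_comm, EuclideanSpace.inner_single_left]; simp
    simp [mul_comm, hin]
  rw [heq] at this
  exact this

/-- Gaussian integration by parts for polynomials. -/
lemma integral_pderiv_gaussian (p : MvPolynomial (Fin (n + 1)) ℝ) (i : Fin (n + 1)) :
    ∫ x : Amb n, polyVal (MvPolynomial.pderiv i p) x * Real.exp (-(1 / 2) * ‖x‖ ^ 2) =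
      ∫ x : Amb n, polyVal (MvPolynomial.X i * p) x * Real.exp (-(1 / 2) * ‖x‖ ^ 2) := by
  have hb : (0 : ℝ) < 1 / 2 := by norm_num
  have h := integral_bilinear_hasLineDerivAt_right_eq_neg_left_of_integrable
    (μ := (volume : Measure (Amb n))) (v := EuclideanSpace.single i (1 : ℝ))
    (B := ContinuousLinearMap.mul ℝ ℝ)
    (f := polyVal p) (f' := polyVal (MvPolynomial.pderiv i p))
    (g := fun x : Amb n => Real.exp (-(1 / 2) * ‖x‖ ^ 2))
    (g' := fun x : Amb n => -(x i) * Real.exp (-(1 / 2) * ‖x‖ ^ 2))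
    (integrable_polyVal_gaussian _ hb)
    (by
      refine (integrable_polyVal_gaussian (-(MvPolynomial.X i * p)) hb).congr
        (Eventually.of_forall fun x => ?_)
      simp [polyVal]; ring)
    (integrable_polyVal_gaussian _ hb)
    (fun x _ => hasLineDerivAt_polyVal p x i) (fun x _ => hasLineDerivAt_gaussian x i)
  simp only [ContinuousLinearMap.mul_apply'] at h
  rw [eq_neg_iff_add_eq_zero, add_comm, ← eq_neg_iff_add_eq_zero, ← integral_neg] at h
  rw [h]
  refine integral_congr_ae (Eventually.of_forall fun x => ?_)
  simp [polyVal]; ring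

end Gaussian

/-! ### Polar coordinates: from Gaussian integrals to the sphere -/

section Polar

variable {n : ℕ}

/-- Polar coordinates for a homogeneous function times a radial one. -/
lemma integral_homogeneous_mul_radial {f : Amb n → ℝ} {d : ℕ} (g : ℝ → ℝ)
    (hf : ∀ (r : ℝ) (x : Amb n), 0 < r → f (r • x) = r ^ d * f x) :
    ∫ x, f x * g ‖x‖ = (∫ ω : Sph n, f ω ∂(surf n)) *
      ∫ r : Set.Ioi (0 : ℝ), (r : ℝ) ^ d * g r ∂(.volumeIoiPow n) := by
  have h0 : Module.finrank ℝ (Amb n) - 1 = n := by simp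
  have hmp := (volume : Measure (Amb n)).measurePreserving_homeomorphUnitSphereProd
  rw [h0] at hmp
  calc
    ∫ x, f x * g ‖x‖ = ∫ x : ({(0 : Amb n)}ᶜ : Set (Amb n)), f x.1 * g ‖x.1‖
        ∂(volume.comap Subtype.val) := by
      rw [integral_subtype_comap (measurableSet_singleton _).compl fun x : Amb n => f x * g ‖x‖,
        restrict_compl_singleton]
    _ = ∫ y : Sph n × Set.Ioi (0 : ℝ), f (y.1 : Amb n) * ((y.2 : ℝ) ^ d * g y.2)
        ∂((surf n).prod (.volumeIoiPow n)) := by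
      unfold surf
      rw [← hmp.integral_comp (Homeomorph.measurableEmbedding _)]
      refine integral_congr_ae (Eventually.of_forall fun x => ?_)
      have hx : (x : Amb n) ≠ 0 := x.2
      have hpos : 0 < ‖(x : Amb n)‖ := norm_pos_iff.mpr hx
      have : f x = ‖(x : Amb n)‖ ^ d * f (‖(x : Amb n)‖⁻¹ • (x : Amb n)) := by
        rw [← hf _ _ hpos, smul_smul, mul_inv_cancel₀ hpos.ne', one_smul]
      simp only [homeomorphUnitSphereProd_apply_snd_coe, homeomorphUnitSphereProd_apply_fst_coe]
      rw [this]; ring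
    _ = _ := integral_prod_mul (fun ω : Sph n => f ω)
        (fun r : Set.Ioi (0 : ℝ) => (r : ℝ) ^ d * g r)

/-- The polar formula for |x|^d has this moment as a factor, while its left side is visibly
positive; the moment need not be computed. -/
lemma radial_moment_ne_zero (d : ℕ) :
    ∫ r : Set.Ioi (0 : ℝ), (r : ℝ) ^ d * Real.exp (-(1 / 2) * (r : ℝ) ^ 2)
      ∂(.volumeIoiPow n) ≠ 0 := by
  have h := integral_homogeneous_mul_radial (n := n) (f := fun x => ‖x‖ ^ d) (d := d)
    (fun r => Real.exp (-(1 / 2) * r ^ 2))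
    (fun r x hr => by rw [norm_smul, Real.norm_of_nonneg hr.le, mul_pow])
  intro h0
  rw [h0, mul_zero] at h
  have hpos : 0 < ∫ x : Amb n, ‖x‖ ^ d * Real.exp (-(1 / 2) * ‖x‖ ^ 2) := by
    refine integral_pos_of_integrable_nonneg_nonzero (x := EuclideanSpace.single 0 1)
      (by fun_prop) (integrable_norm_pow_gaussian d (by norm_num)) (fun x => by positivity) ?_
    simp
  linarith

/-- A homogeneous polynomial integrates to zero over the sphere if it does against the
Gaussian. -/
lemma integral_sphere_eq_zero_of_gaussian {p : MvPolynomial (Fin (n + 1)) ℝ} {d : ℕ}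
    (hp : p.IsHomogeneous d)
    (h : ∫ x : Amb n, polyVal p x * Real.exp (-(1 / 2) * ‖x‖ ^ 2) = 0) :
    ∫ ω : Sph n, polyVal p ω ∂(surf n) = 0 := by
  rw [integral_homogeneous_mul_radial (d := d) (fun r => Real.exp (-(1 / 2) * r ^ 2))] at h
  · exact (mul_eq_zero.mp h).resolve_right (radial_moment_ne_zero d)
  · intro r x _
    simp only [polyVal, MvPolynomial.eval_eq', Finset.mul_sum]
    refine Finset.sum_congr rfl fun e he => ?_
    have hd : ∑ i, e i = d := by
      rw [← hp (MvPolynomial.mem_support_iff.mp he), Finsupp.weight_apply,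
        Finsupp.sum_fintype _ _ (by simp)]
      simp
    simp only [PiLp.smul_apply, smul_eq_mul, mul_pow, Finset.prod_mul_distrib]
    rw [Finset.prod_pow_eq_pow_sum, hd]
    ring

end Polar

/-! ### Orthogonality of spherical harmonics -/

section Orthogonality

variable {n : ℕ}

open MvPolynomial in
/-- Spherical harmonics of different degrees are orthogonal. -/
lemma integral_mul_harmonic_eq_zero {k m : ℕ} (hkm : k ≠ m) {p q : MvPolynomial (Fin (n + 1)) ℝ}
    (hp : p ∈ harmonicPoly n k) (hq : q ∈ harmonicPoly n m) :
    ∫ ω : Sph n, polyVal (p * q) ω ∂(surf n) = 0 := by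
  obtain ⟨hp1, hp2⟩ := hp
  obtain ⟨hq1, hq2⟩ := hq
  replace hp1 : p.IsHomogeneous k := hp1
  replace hq1 : q.IsHomogeneous m := hq1
  have hLp : ∑ i, pderiv i (pderiv i p) = 0 := by simpa [polyLaplacian] using hp2
  have hLq : ∑ i, pderiv i (pderiv i q) = 0 := by simpa [polyLaplacian] using hq2
  refine integral_sphere_eq_zero_of_gaussian (hp1.mul hq1) ?_
  have hb : (0 : ℝ) < 1 / 2 := by norm_num
  set I : MvPolynomial (Fin (n + 1)) ℝ → ℝ :=
    fun p => ∫ x : Amb n, polyVal p x * Real.exp (-(1 / 2) * ‖x‖ ^ 2) with hI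
  have hadd : ∀ p q, I (p + q) = I p + I q := fun p q => by
    simp only [hI]
    rw [← integral_add (integrable_polyVal_gaussian p hb) (integrable_polyVal_gaussian q hb)]
    refine integral_congr_ae (Eventually.of_forall fun x => ?_)
    simp [polyVal, add_mul]
  have hsmul : ∀ (c : ℝ) p, I (c • p) = c * I p := fun c p => by
    simp only [hI]
    rw [← integral_const_mul]
    refine integral_congr_ae (Eventually.of_forall fun x => ?_)
    simp [polyVal, mul_assoc]
  let J : MvPolynomial (Fin (n + 1)) ℝ →ₗ[ℝ] ℝ :=
    { toFun := I, map_add' := hadd, map_smul' := fun c p => hsmul c p }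
  have hparts : ∀ i p, J (pderiv i p) = J (X i * p) := fun i p => integral_pderiv_gaussian p i
  -- Integration by parts for the field q∇p − p∇q: its divergence vanishes by harmonicity, and its
  -- scalar product with x is (k − m)pq by Euler's identity.
  have key : J (∑ i, pderiv i (pderiv i p * q - p * pderiv i q)) =
      J (∑ i, X i * (pderiv i p * q - p * pderiv i q)) := by
    simp only [map_sum, hparts]
  have h1 : ∑ i, pderiv i (pderiv i p * q - p * pderiv i q) = 0 := by
    have : ∀ i, pderiv i (pderiv i p * q - p * pderiv i q) =
        pderiv i (pderiv i p) * q - p * pderiv i (pderiv i q) := fun i => by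
      simp only [map_sub, Derivation.leibniz, smul_eq_mul]; ring
    simp only [this, Finset.sum_sub_distrib, ← Finset.sum_mul, ← Finset.mul_sum, hLp, hLq]
    simp
  have h2 : ∑ i, X i * (pderiv i p * q - p * pderiv i q) = ((k : ℝ) - m) • (p * q) := by
    have : ∀ i, X i * (pderiv i p * q - p * pderiv i q) =
        X i * pderiv i p * q - p * (X i * pderiv i q) := fun i => by ring
    simp only [this, Finset.sum_sub_distrib, ← Finset.sum_mul, ← Finset.mul_sum,
      hp1.sum_X_mul_pderiv, hq1.sum_X_mul_pderiv, sub_smul, Nat.cast_smul_eq_nsmul]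
    simp [nsmul_eq_mul]; ring
  rw [h1, h2, map_zero, map_smul, smul_eq_mul] at key
  have hne : (k : ℝ) - m ≠ 0 := sub_ne_zero.mpr (by exact_mod_cast hkm)
  exact (mul_eq_zero.mp key.symm).resolve_left hne

end Orthogonality

/-! ### Harmonic polynomials: multiplication by linear forms -/

section HarmonicPolynomials

open MvPolynomial

variable {n : ℕ}

/-- The linear form `x ↦ ζ · x`, as a polynomial. -/
def linForm (n : ℕ) : Amb n →ₗ[ℝ] MvPolynomial (Fin (n + 1)) ℝ where
  toFun ζ := ∑ i, ζ i • X i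
  map_add' ζ η := by simp [add_smul, Finset.sum_add_distrib]
  map_smul' c ζ := by simp [mul_smul, Finset.smul_sum]

/-- The derivation `ζ · ∇` on polynomials. -/
def dirDeriv (ζ : Amb n) : Derivation ℝ (MvPolynomial (Fin (n + 1)) ℝ)
    (MvPolynomial (Fin (n + 1)) ℝ) :=
  ∑ i, ζ i • pderiv i

/-- The Euler derivation `x · ∇` on polynomials. -/
def eulerDeriv (n : ℕ) : Derivation ℝ (MvPolynomial (Fin (n + 1)) ℝ)
    (MvPolynomial (Fin (n + 1)) ℝ) :=
  ∑ i, (X i : MvPolynomial (Fin (n + 1)) ℝ) • pderiv i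

/-- The polynomial `|x|²`. -/
def normSqPoly (n : ℕ) : MvPolynomial (Fin (n + 1)) ℝ := ∑ i, X i ^ 2

lemma linForm_apply (ζ : Amb n) : linForm n ζ = ∑ i, ζ i • X i := rfl

lemma dirDeriv_apply (ζ : Amb n) (p : MvPolynomial (Fin (n + 1)) ℝ) :
    dirDeriv ζ p = ∑ i, ζ i • pderiv i p := by
  change Derivation.coeFnAddMonoidHom (∑ i, ζ i • pderiv i) p = _
  rw [map_sum, Finset.sum_apply]
  rfl

lemma eulerDeriv_apply (p : MvPolynomial (Fin (n + 1)) ℝ) :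
    eulerDeriv n p = ∑ i, X i * pderiv i p := by
  change Derivation.coeFnAddMonoidHom
    (∑ i, (X i : MvPolynomial (Fin (n + 1)) ℝ) • pderiv i) p = _
  rw [map_sum, Finset.sum_apply]
  rfl

lemma polyLaplacian_apply (p : MvPolynomial (Fin (n + 1)) ℝ) :
    polyLaplacian n p = ∑ i, pderiv i (pderiv i p) := by
  simp [polyLaplacian]

lemma eulerDeriv_of_isHomogeneous {p : MvPolynomial (Fin (n + 1)) ℝ} {k : ℕ}
    (hp : p.IsHomogeneous k) : eulerDeriv n p = (k : ℝ) • p := by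
  rw [eulerDeriv_apply, hp.sum_X_mul_pderiv, Nat.cast_smul_eq_nsmul]

lemma pderiv_linForm (ζ : Amb n) (i : Fin (n + 1)) : pderiv i (linForm n ζ) = C (ζ i) := by
  simp [linForm_apply, pderiv_X, Pi.single_apply, smul_eq_C_mul]

lemma dirDeriv_linForm (ζ η : Amb n) : dirDeriv ζ (linForm n η) = C (inner ℝ ζ η) := by
  simp [dirDeriv_apply, pderiv_linForm, PiLp.inner_apply, smul_eq_C_mul, mul_comm]

lemma eulerDeriv_linForm (ζ : Amb n) : eulerDeriv n (linForm n ζ) = linForm n ζ := by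
  simp only [eulerDeriv_apply, pderiv_linForm]
  simp [linForm_apply, smul_eq_C_mul, mul_comm]

lemma pderiv_normSqPoly (i : Fin (n + 1)) : pderiv i (normSqPoly n) = 2 * X i := by
  simp [normSqPoly, pderiv_X, Pi.single_apply, Derivation.leibniz_pow, mul_ite]

lemma dirDeriv_normSqPoly (ζ : Amb n) : dirDeriv ζ (normSqPoly n) = 2 * linForm n ζ := by
  simp [dirDeriv_apply, pderiv_normSqPoly, linForm_apply, Finset.mul_sum]

lemma eulerDeriv_normSqPoly : eulerDeriv n (normSqPoly n) = 2 * normSqPoly n := by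
  simp only [eulerDeriv_apply, pderiv_normSqPoly]
  rw [normSqPoly, Finset.mul_sum]
  exact Finset.sum_congr rfl fun i _ => by ring

lemma polyLaplacian_linForm_mul (ζ : Amb n) (p : MvPolynomial (Fin (n + 1)) ℝ) :
    polyLaplacian n (linForm n ζ * p) =
      2 * dirDeriv ζ p + linForm n ζ * polyLaplacian n p := by
  simp only [polyLaplacian_apply, dirDeriv_apply, Finset.mul_sum, ← Finset.sum_add_distrib]
  refine Finset.sum_congr rfl fun i _ => ?_
  simp only [Derivation.leibniz, pderiv_linForm, smul_eq_mul, map_add, pderiv_C, smul_eq_C_mul]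
  ring

lemma polyLaplacian_normSqPoly_mul (p : MvPolynomial (Fin (n + 1)) ℝ) :
    polyLaplacian n (normSqPoly n * p) =
      (2 * ((n : ℝ) + 1)) • p + 4 * eulerDeriv n p + normSqPoly n * polyLaplacian n p := by
  have h1 : (2 * ((n : ℝ) + 1)) • p = ∑ _i : Fin (n + 1), 2 * p := by
    simp [smul_eq_C_mul, map_ofNat C 2]; ring
  simp only [polyLaplacian_apply, eulerDeriv_apply, Finset.mul_sum, h1, ← Finset.sum_add_distrib]
  refine Finset.sum_congr rfl fun i _ => ?_
  have h2 : pderiv i (2 : MvPolynomial (Fin (n + 1)) ℝ) = 0 := by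
    rw [← map_ofNat C 2, pderiv_C]
  simp only [Derivation.leibniz, pderiv_normSqPoly, smul_eq_mul, map_add, h2, pderiv_X_self]
  ring

lemma isHomogeneous_linForm (ζ : Amb n) : (linForm n ζ).IsHomogeneous 1 := by
  rw [linForm_apply]
  refine IsHomogeneous.sum _ _ _ fun i _ => ?_
  simpa [smul_eq_C_mul] using (isHomogeneous_C _ (ζ i)).mul (isHomogeneous_X ℝ i)

lemma isHomogeneous_normSqPoly : (normSqPoly n).IsHomogeneous 2 :=
  IsHomogeneous.sum _ _ _ fun i _ => by simpa using (isHomogeneous_X ℝ i).pow 2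

lemma isHomogeneous_dirDeriv (ζ : Amb n) {p : MvPolynomial (Fin (n + 1)) ℝ} {k : ℕ}
    (hp : p.IsHomogeneous k) : (dirDeriv ζ p).IsHomogeneous (k - 1) := by
  rw [dirDeriv_apply]
  refine IsHomogeneous.sum _ _ _ fun i _ => ?_
  simpa [smul_eq_C_mul] using (isHomogeneous_C _ (ζ i)).mul (hp.pderiv (i := i))

lemma pderiv_comm (i j : Fin (n + 1)) (p : MvPolynomial (Fin (n + 1)) ℝ) :
    pderiv i (pderiv j p) = pderiv j (pderiv i p) := by
  -- A commutator of derivations is a derivation, so it suffices to test it on the variables.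
  have h : ⁅pderiv (R := ℝ) i, pderiv (R := ℝ) j⁆ = 0 := by
    refine derivation_ext fun k => ?_
    simp [Derivation.commutator_apply, pderiv_X, Pi.single_apply, apply_ite]
  have := congrArg (fun D => D p) h
  simpa [Derivation.commutator_apply, sub_eq_zero] using this

lemma dirDeriv_mem_ker (ζ : Amb n) {p : MvPolynomial (Fin (n + 1)) ℝ}
    (hp : polyLaplacian n p = 0) : polyLaplacian n (dirDeriv ζ p) = 0 := by
  have h := hp
  rw [polyLaplacian_apply] at h ⊢
  have : ∀ i, pderiv i (pderiv i (dirDeriv ζ p)) = dirDeriv ζ (pderiv i (pderiv i p)) := by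
    intro i
    simp only [dirDeriv_apply, map_sum, Derivation.map_smul]
    refine Finset.sum_congr rfl fun j _ => ?_
    rw [pderiv_comm i j, pderiv_comm i j]
  simp only [this, ← map_sum, h, map_zero]

/-- The component of `(ζ · x) p` of degree `ℓ - 1`, for a harmonic `p` of degree `ℓ`. -/
def lower (ζ : Amb n) (ℓ : ℕ) (p : MvPolynomial (Fin (n + 1)) ℝ) :
    MvPolynomial (Fin (n + 1)) ℝ :=
  (2 * (ℓ : ℝ) + n - 1)⁻¹ • dirDeriv ζ p

/-- The component of `(ζ · x) p` of degree `ℓ + 1`, for a harmonic `p` of degree `ℓ`. -/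
def raise (ζ : Amb n) (ℓ : ℕ) (p : MvPolynomial (Fin (n + 1)) ℝ) :
    MvPolynomial (Fin (n + 1)) ℝ :=
  linForm n ζ * p - normSqPoly n * lower ζ ℓ p

lemma dirDeriv_of_mem_zero (ζ : Amb n) {p : MvPolynomial (Fin (n + 1)) ℝ}
    (hp : p ∈ harmonicPoly n 0) : dirDeriv ζ p = 0 := by
  have h := (totalDegree_eq_zero_iff_eq_C).mp
    (Nat.le_zero.mp (IsHomogeneous.totalDegree_le hp.1))
  rw [h, dirDeriv_apply]
  simp

lemma lower_of_mem_zero (ζ : Amb n) (k : ℕ) {p : MvPolynomial (Fin (n + 1)) ℝ}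
    (hp : p ∈ harmonicPoly n 0) : lower ζ k p = 0 := by
  rw [lower, dirDeriv_of_mem_zero ζ hp, smul_zero]

lemma lower_mem (ζ : Amb n) {ℓ : ℕ} {p : MvPolynomial (Fin (n + 1)) ℝ}
    (hp : p ∈ harmonicPoly n (ℓ + 1)) : lower ζ (ℓ + 1) p ∈ harmonicPoly n ℓ :=
  Submodule.smul_mem _ _ ⟨isHomogeneous_dirDeriv ζ hp.1, dirDeriv_mem_ker ζ hp.2⟩

lemma smul_lower (hn : 1 ≤ n) (ζ : Amb n) {ℓ : ℕ} {p : MvPolynomial (Fin (n + 1)) ℝ}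
    (hp : p ∈ harmonicPoly n ℓ) : (2 * (ℓ : ℝ) + n - 1) • lower ζ ℓ p = dirDeriv ζ p := by
  rcases ℓ with _ | ℓ
  -- For n = 1 and degree 0 the factor 2ℓ + n − 1 is 0 and its inverse has the default value 0; this
  -- is harmless because derivatives of constants vanish.
  · rw [lower_of_mem_zero ζ _ hp, dirDeriv_of_mem_zero ζ hp, smul_zero]
  · rw [lower, smul_smul, mul_inv_cancel₀, one_smul]
    have : (1 : ℝ) ≤ n := by exact_mod_cast hn
    push_cast
    have : (0 : ℝ) ≤ ℓ := ℓ.cast_nonneg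
    apply ne_of_gt
    linarith

/-- For harmonic p the Laplacian of (ζ·x)p is 2∂_ζ p, and for q harmonic of degree ℓ − 1 that of
|x|²q is 2(2ℓ + n − 1)q. The constant in `lower` makes the two cancel. -/
lemma raise_mem (hn : 1 ≤ n) (ζ : Amb n) {ℓ : ℕ} {p : MvPolynomial (Fin (n + 1)) ℝ}
    (hp : p ∈ harmonicPoly n ℓ) : raise ζ ℓ p ∈ harmonicPoly n (ℓ + 1) := by
  have hE : (lower ζ ℓ p).IsHomogeneous (ℓ - 1) :=
    Submodule.smul_mem (homogeneousSubmodule _ _ _) _ (isHomogeneous_dirDeriv ζ hp.1)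
  have hlow : normSqPoly n * lower ζ ℓ p ∈ homogeneousSubmodule _ ℝ (ℓ + 1) := by
    rcases ℓ with _ | ℓ
    · rw [lower_of_mem_zero ζ _ hp, mul_zero]
      exact Submodule.zero_mem _
    · have := isHomogeneous_normSqPoly.mul hE
      rwa [show 2 + (ℓ + 1 - 1) = ℓ + 1 + 1 by omega] at this
  refine ⟨Submodule.sub_mem _ ?_ hlow, ?_⟩
  · have := (isHomogeneous_linForm ζ).mul hp.1
    rwa [add_comm 1 ℓ] at this
  · have hker : polyLaplacian n (lower ζ ℓ p) = 0 := by
      rw [lower, map_smul, dirDeriv_mem_ker ζ hp.2, smul_zero]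
    have hp2 : polyLaplacian n p = 0 := hp.2
    change polyLaplacian n (raise ζ ℓ p) = 0
    rw [raise, map_sub, polyLaplacian_linForm_mul, polyLaplacian_normSqPoly_mul,
      hker, hp2, ← smul_lower hn ζ hp, eulerDeriv_of_isHomogeneous hE]
    rcases ℓ with _ | ℓ
    · simp [lower_of_mem_zero ζ _ hp]
    · simp only [smul_eq_C_mul]
      simp only [map_sub, map_add, map_mul, map_ofNat C 2, Nat.add_sub_cancel, Nat.cast_add,
        Nat.cast_one, C_1, mul_zero, add_zero]
      ring

lemma linForm_mul_eq (ζ : Amb n) (ℓ : ℕ) (p : MvPolynomial (Fin (n + 1)) ℝ) :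
    linForm n ζ * p = raise ζ ℓ p + normSqPoly n * lower ζ ℓ p := by
  simp [raise]

/-- The ideal of the sphere. -/
def sphereIdeal (n : ℕ) : Submodule ℝ (MvPolynomial (Fin (n + 1)) ℝ) :=
  (Ideal.span {normSqPoly n - 1}).restrictScalars ℝ

lemma mem_sphereIdeal {p : MvPolynomial (Fin (n + 1)) ℝ} :
    p ∈ sphereIdeal n ↔ ∃ q, p = q * (normSqPoly n - 1) := by
  simp [sphereIdeal, Ideal.mem_span_singleton', eq_comm]

/-- Polynomials that coincide on the sphere with a sum of harmonics of degree at most `k`. -/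
def harmUpTo (n k : ℕ) : Submodule ℝ (MvPolynomial (Fin (n + 1)) ℝ) :=
  (⨆ ℓ ∈ Set.Iic k, harmonicPoly n ℓ) ⊔ sphereIdeal n

lemma harmonicPoly_le_harmUpTo {ℓ k : ℕ} (h : ℓ ≤ k) : harmonicPoly n ℓ ≤ harmUpTo n k :=
  le_sup_of_le_left (le_iSup₂_of_le ℓ h le_rfl)

lemma harmUpTo_mono {k m : ℕ} (h : k ≤ m) : harmUpTo n k ≤ harmUpTo n m :=
  sup_le (iSup₂_le fun _ hℓ => harmonicPoly_le_harmUpTo (le_trans hℓ h)) le_sup_right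

/-- A submodule containing the harmonics of degree at most `k` and the ideal of the sphere
contains `harmUpTo n k`. -/
lemma harmUpTo_le {k : ℕ} {S : Submodule ℝ (MvPolynomial (Fin (n + 1)) ℝ)}
    (h1 : ∀ ℓ ≤ k, ∀ p ∈ harmonicPoly n ℓ, p ∈ S) (h2 : ∀ p ∈ sphereIdeal n, p ∈ S) :
    harmUpTo n k ≤ S :=
  sup_le (iSup₂_le fun ℓ hℓ p hp => h1 ℓ hℓ p hp) h2

/-- Modulo |x|² − 1, multiplication by a linear form sends degree ℓ to degrees ℓ + 1 and ℓ − 1. -/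
lemma linForm_mul_mem_harmUpTo (hn : 1 ≤ n) (ζ : Amb n) {k : ℕ}
    {p : MvPolynomial (Fin (n + 1)) ℝ} (hp : p ∈ harmUpTo n k) :
    linForm n ζ * p ∈ harmUpTo n (k + 1) := by
  have : harmUpTo n k ≤ (harmUpTo n (k + 1)).comap (LinearMap.mulLeft ℝ (linForm n ζ)) := by
    refine harmUpTo_le (fun ℓ hℓ p hp => ?_) (fun p hp => ?_)
    · have heq : linForm n ζ * p =
          raise ζ ℓ p + lower ζ ℓ p + lower ζ ℓ p * (normSqPoly n - 1) := by
        rw [linForm_mul_eq ζ ℓ]; ring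
      change linForm n ζ * p ∈ harmUpTo n (k + 1)
      rw [heq]
      refine Submodule.add_mem _ (Submodule.add_mem _ ?_ ?_) ?_
      · exact harmonicPoly_le_harmUpTo (by omega) (raise_mem hn ζ hp)
      · rcases ℓ with _ | ℓ
        · rw [lower_of_mem_zero ζ _ hp]; exact Submodule.zero_mem _
        · exact harmonicPoly_le_harmUpTo (by omega) (lower_mem ζ hp)
      · exact Submodule.mem_sup_right (mem_sphereIdeal.mpr ⟨_, rfl⟩)
    · obtain ⟨q, rfl⟩ := mem_sphereIdeal.mp hp
      exact Submodule.mem_sup_right (mem_sphereIdeal.mpr ⟨linForm n ζ * q, by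
        simp [mul_assoc]⟩)
  exact this hp

lemma C_mem_harmonicPoly (a : ℝ) : C a ∈ harmonicPoly n 0 :=
  ⟨isHomogeneous_C _ a, by simp [polyLaplacian_apply]⟩

lemma linForm_mem_harmonicPoly (ζ : Amb n) : linForm n ζ ∈ harmonicPoly n 1 :=
  ⟨isHomogeneous_linForm ζ, by simp [polyLaplacian_apply, pderiv_linForm]⟩

lemma exists_mem_harmUpTo (hn : 1 ≤ n) (p : MvPolynomial (Fin (n + 1)) ℝ) :
    ∃ k, p ∈ harmUpTo n k := by
  induction p using MvPolynomial.induction_on with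
  | C a => exact ⟨0, harmonicPoly_le_harmUpTo le_rfl (C_mem_harmonicPoly a)⟩
  | add p q hp hq =>
    obtain ⟨k, hk⟩ := hp
    obtain ⟨m, hm⟩ := hq
    exact ⟨max k m, Submodule.add_mem _ (harmUpTo_mono (le_max_left _ _) hk)
      (harmUpTo_mono (le_max_right _ _) hm)⟩
  | mul_X p i hp =>
    obtain ⟨k, hk⟩ := hp
    refine ⟨k + 1, ?_⟩
    have h : linForm n (EuclideanSpace.single i 1) = X i := by
      simp [linForm_apply, ite_smul]
    have := linForm_mul_mem_harmUpTo hn (EuclideanSpace.single i 1) hk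
    rwa [h, mul_comm] at this

lemma prod_linForm_mem_harmUpTo (hn : 1 ≤ n) {k : ℕ} (v : Fin k → Amb n) :
    ∏ i, linForm n (v i) ∈ harmUpTo n k := by
  induction k with
  | zero => simpa using harmonicPoly_le_harmUpTo (n := n) le_rfl (C_mem_harmonicPoly 1)
  | succ k ih =>
    rw [Fin.prod_univ_succ]
    exact linForm_mul_mem_harmUpTo hn _ (ih _)

/-- The infinitesimal conformal transformation in direction `ζ`, of weight `σ`. -/
def lieOp (ζ : Amb n) (σ : ℝ) :
    MvPolynomial (Fin (n + 1)) ℝ →ₗ[ℝ] MvPolynomial (Fin (n + 1)) ℝ :=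
  (dirDeriv ζ).toLinearMap - LinearMap.mulLeft ℝ (linForm n ζ) ∘ₗ (eulerDeriv n).toLinearMap +
    σ • LinearMap.mulLeft ℝ (linForm n ζ)

lemma lieOp_apply (ζ : Amb n) (σ : ℝ) (p : MvPolynomial (Fin (n + 1)) ℝ) :
    lieOp ζ σ p = dirDeriv ζ p - linForm n ζ * eulerDeriv n p + σ • (linForm n ζ * p) := rfl

/-- The vector field ζ − (ζ·x)x is tangent to the sphere: it maps |x|² − 1 to −2(ζ·x)(|x|² − 1). So
`lieOp` descends to functions on the sphere. -/
lemma lieOp_mem_sphereIdeal (ζ : Amb n) (σ : ℝ) {p : MvPolynomial (Fin (n + 1)) ℝ}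
    (hp : p ∈ sphereIdeal n) : lieOp ζ σ p ∈ sphereIdeal n := by
  obtain ⟨q, rfl⟩ := mem_sphereIdeal.mp hp
  refine mem_sphereIdeal.mpr ⟨lieOp ζ σ q - 2 * linForm n ζ * q, ?_⟩
  simp only [lieOp_apply, Derivation.leibniz, smul_eq_mul, map_sub, dirDeriv_normSqPoly,
    eulerDeriv_normSqPoly, Derivation.map_one_eq_zero, smul_eq_C_mul]
  ring

/-- The raising and lowering parts carry different factors; weighted with `alpha` they will balance.
-/
lemma lieOp_of_mem_harmonicPoly (hn : 1 ≤ n) (ζ : Amb n) (σ : ℝ) {ℓ : ℕ}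
    {p : MvPolynomial (Fin (n + 1)) ℝ} (hp : p ∈ harmonicPoly n ℓ) :
    lieOp ζ σ p = (σ - ℓ) • raise ζ ℓ p + (ℓ + n - 1 + σ) • lower ζ ℓ p +
      ((σ - ℓ) • lower ζ ℓ p) * (normSqPoly n - 1) := by
  rw [lieOp_apply, ← smul_lower hn ζ hp, eulerDeriv_of_isHomogeneous hp.1, mul_smul_comm,
    linForm_mul_eq ζ ℓ]
  simp only [smul_eq_C_mul, map_sub, map_add, map_mul, map_ofNat C 2]
  ring

lemma lieOp_linForm_pow {e : Amb n} (he : ‖e‖ = 1) (σ : ℝ) (k : ℕ) :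
    lieOp e σ (linForm n e ^ k) =
      (k : ℝ) • linForm n e ^ (k - 1) + (σ - k) • linForm n e ^ (k + 1) := by
  have h1 : inner ℝ e e = 1 := by rw [real_inner_self_eq_norm_sq, he]; norm_num
  rw [lieOp_apply, Derivation.leibniz_pow, Derivation.leibniz_pow, dirDeriv_linForm,
    eulerDeriv_linForm, h1]
  rcases k with _ | k
  · simp
  · simp only [smul_eq_C_mul, nsmul_eq_mul, smul_eq_mul, map_sub, map_natCast, Nat.add_sub_cancel,
      C_1]
    ring

end HarmonicPolynomials

/-! ### The eigenvalues `alpha` -/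

section Alpha

lemma Gamma_add_nat_add_one {x : ℝ} (hx : ∀ j : ℕ, x ≠ -j) (m : ℕ) :
    Real.Gamma (x + m + 1) = (∏ j ∈ Finset.range (m + 1), (x + j)) * Real.Gamma x := by
  have hne : ∀ j : ℕ, x + j ≠ 0 := fun j h => hx j (by linarith)
  induction m with
  | zero => simpa using Real.Gamma_add_one (by simpa using hne 0)
  | succ m ih =>
    rw [Finset.prod_range_succ, mul_right_comm, ← ih, Real.Gamma_add_one (hne _)]
    push_cast
    rw [add_assoc x m 1]
    ring

/-- The expression is Γ(x) divided by Euler's approximant `Real.GammaSeq x m`. -/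
lemma tendsto_Gamma_div_pow {x : ℝ} (hx : ∀ j : ℕ, x ≠ -j) :
    Tendsto (fun m : ℕ => Real.Gamma (x + m + 1) / ((m : ℝ) ^ x * m.factorial)) atTop (𝓝 1) := by
  have hG : Real.Gamma x ≠ 0 := Real.Gamma_ne_zero hx
  have h := (tendsto_const_nhds (x := Real.Gamma x)).div (Real.GammaSeq_tendsto_Gamma x) hG
  rw [div_self hG] at h
  refine h.congr fun m => ?_
  simp only [Pi.div_apply]
  rw [Real.GammaSeq, Gamma_add_nat_add_one hx m, div_div_eq_mul_div, mul_comm]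

variable {n : ℕ} {s : ℝ}

/-- As s − n/2 is not an integer, the denominator of `alpha` avoids the poles of Γ. -/
lemma add_natCast_sub_ne_zero (hs : s - (n : ℝ) / 2 ∈ Set.Ioo (0 : ℝ) 1 ∪ Set.Ioo (1 : ℝ) 2) (j : ℕ) :
    (j : ℝ) + n / 2 - s ≠ 0 := by
  intro h
  have hj : s - (n : ℝ) / 2 = j := by linarith
  rw [hj] at hs
  rcases hs with ⟨h1, h2⟩ | ⟨h1, h2⟩
  · norm_cast at h1 h2; omega
  · norm_cast at h1 h2; omega

lemma order_pos (hs : s - (n : ℝ) / 2 ∈ Set.Ioo (0 : ℝ) 1 ∪ Set.Ioo (1 : ℝ) 2) :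
    0 < s - (n : ℝ) / 2 := by
  rcases hs with ⟨h1, h2⟩ | ⟨h1, h2⟩ <;> linarith

lemma order_lt_two (hs : s - (n : ℝ) / 2 ∈ Set.Ioo (0 : ℝ) 1 ∪ Set.Ioo (1 : ℝ) 2) :
    s - (n : ℝ) / 2 < 2 := by
  rcases hs with ⟨h1, h2⟩ | ⟨h1, h2⟩ <;> linarith

lemma s_pos (hs : s - (n : ℝ) / 2 ∈ Set.Ioo (0 : ℝ) 1 ∪ Set.Ioo (1 : ℝ) 2) : 0 < s := by
  have := order_pos hs
  have h : (0 : ℝ) ≤ n := n.cast_nonneg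
  linarith

/-- This recursion is exactly what makes the form conformally invariant; see `aBil_lieOp_succ`. -/
lemma alpha_succ (hs : s - (n : ℝ) / 2 ∈ Set.Ioo (0 : ℝ) 1 ∪ Set.Ioo (1 : ℝ) 2) (ℓ : ℕ) :
    alpha n s (ℓ + 1) * (ℓ + n / 2 - s) = alpha n s ℓ * (ℓ + n / 2 + s) := by
  have h1 := add_natCast_sub_ne_zero hs ℓ
  have hspos := s_pos hs
  have h2 : (ℓ : ℝ) + n / 2 + s ≠ 0 := by positivity
  unfold alpha
  rw [show ((ℓ + 1 : ℕ) : ℝ) + n / 2 + s = (ℓ + n / 2 + s) + 1 by push_cast; ring,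
    show ((ℓ + 1 : ℕ) : ℝ) + n / 2 - s = (ℓ + n / 2 - s) + 1 by push_cast; ring,
    Real.Gamma_add_one h1, Real.Gamma_add_one h2]
  generalize (ℓ : ℝ) + n / 2 - s = y at h1
  by_cases hG : Real.Gamma y = 0
  · simp [hG]
  · field_simp

lemma alpha_ne_zero (hs : s - (n : ℝ) / 2 ∈ Set.Ioo (0 : ℝ) 1 ∪ Set.Ioo (1 : ℝ) 2) (ℓ : ℕ) :
    alpha n s ℓ ≠ 0 := by
  have hspos := s_pos hs
  refine div_ne_zero (Real.Gamma_pos_of_pos (by positivity)).ne' (Real.Gamma_ne_zero fun m h => ?_)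
  refine add_natCast_sub_ne_zero hs (ℓ + m) ?_
  push_cast
  linarith

/-- Both Gamma arguments are positive once ℓ ≥ 2 > s − n/2, so only the modes 0 and 1 can be
negative. -/
lemma alpha_pos (hs : s - (n : ℝ) / 2 ∈ Set.Ioo (0 : ℝ) 1 ∪ Set.Ioo (1 : ℝ) 2) {ℓ : ℕ}
    (hℓ : 2 ≤ ℓ) : 0 < alpha n s ℓ := by
  have hspos := s_pos hs
  have h2 : (2 : ℝ) ≤ ℓ := by exact_mod_cast hℓ
  have := order_lt_two hs
  exact div_pos (Real.Gamma_pos_of_pos (by positivity)) (Real.Gamma_pos_of_pos (by linarith))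

lemma lapEig_pos (hn : 1 ≤ n) {ℓ : ℕ} (hℓ : 1 ≤ ℓ) : 0 < lapEig n ℓ := by
  have h1 : (1 : ℝ) ≤ ℓ := by exact_mod_cast hℓ
  have h2 : (1 : ℝ) ≤ n := by exact_mod_cast hn
  unfold lapEig
  exact mul_pos (by linarith) (by linarith)

lemma tendsto_alpha_div (hs : s - (n : ℝ) / 2 ∈ Set.Ioo (0 : ℝ) 1 ∪ Set.Ioo (1 : ℝ) 2) :
    Tendsto (fun ℓ => alpha n s ℓ / lapEig n ℓ ^ s) atTop (𝓝 1) := by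
  -- With ℓ = m + 1 the Gamma arguments take the form x + m + 1 of Euler's limit, and the factorials
  -- cancel.
  rw [← tendsto_add_atTop_iff_nat 1]
  have hspos := s_pos hs
  have hx : ∀ j : ℕ, (n : ℝ) / 2 + s ≠ -j := fun j h => by
    have h0 : (0 : ℝ) ≤ j := j.cast_nonneg
    have h1 : (0 : ℝ) ≤ (n : ℝ) / 2 := by positivity
    linarith
  have hy : ∀ j : ℕ, (n : ℝ) / 2 - s ≠ -j := fun j h =>
    add_natCast_sub_ne_zero hs j (by linarith)
  have h1 := (tendsto_Gamma_div_pow hx).div (tendsto_Gamma_div_pow hy) one_ne_zero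
  have hlap : Tendsto (fun m : ℕ => lapEig n (m + 1) / (m : ℝ) ^ 2) atTop (𝓝 1) := by
    have hinv : Tendsto (fun m : ℕ => ((m : ℝ))⁻¹) atTop (𝓝 0) :=
      tendsto_inv_atTop_zero.comp tendsto_natCast_atTop_atTop
    have : Tendsto (fun m : ℕ => (1 + (m : ℝ)⁻¹) * (1 + n * (m : ℝ)⁻¹)) atTop
        (𝓝 ((1 + 0) * (1 + n * 0))) :=
      (hinv.const_add 1).mul ((hinv.const_mul (n : ℝ)).const_add 1)
    simp only [add_zero, mul_zero, mul_one] at this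
    refine this.congr' ?_
    filter_upwards [eventually_gt_atTop 0] with m hm
    have : (m : ℝ) ≠ 0 := by exact_mod_cast hm.ne'
    unfold lapEig
    push_cast
    field_simp
    ring
  have h2 := hlap.rpow_const (p := s) (Or.inl one_ne_zero)
  rw [Real.one_rpow] at h2
  have h3 := h1.div h2 one_ne_zero
  simp only [div_one] at h3
  refine h3.congr' ?_
  filter_upwards [eventually_gt_atTop 0] with m hm
  have hm0 : (0 : ℝ) < m := by exact_mod_cast hm
  simp only [Pi.div_apply]
  rw [Real.div_rpow (lapEig_nonneg n _) (by positivity), ← Real.rpow_natCast (m : ℝ) 2,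
    ← Real.rpow_mul hm0.le]
  unfold alpha
  rw [show ((m + 1 : ℕ) : ℝ) + n / 2 + s = n / 2 + s + m + 1 by push_cast; ring,
    show ((m + 1 : ℕ) : ℝ) + n / 2 - s = n / 2 - s + m + 1 by push_cast; ring]
  have hpow : (m : ℝ) ^ ((n : ℝ) / 2 + s) = (m : ℝ) ^ ((n : ℝ) / 2 - s) * (m : ℝ) ^ (((2 : ℕ) : ℝ) * s) := by
    rw [← Real.rpow_add hm0]; congr 1; push_cast; ring
  rw [hpow]
  have e1 : (m : ℝ) ^ ((n : ℝ) / 2 - s) ≠ 0 := (Real.rpow_pos_of_pos hm0 _).ne'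
  have e2 : (m : ℝ) ^ (((2 : ℕ) : ℝ) * s) ≠ 0 := (Real.rpow_pos_of_pos hm0 _).ne'
  have e3 : (m.factorial : ℝ) ≠ 0 := by positivity
  set A := (m : ℝ) ^ ((n : ℝ) / 2 - s)
  set B := (m : ℝ) ^ (((2 : ℕ) : ℝ) * s)
  by_cases hG : Real.Gamma ((n : ℝ) / 2 - s + m + 1) = 0
  · simp [hG]
  by_cases hL : lapEig n (m + 1) ^ s = 0
  · simp [hL]
  field_simp

lemma exists_alpha_le (hn : 1 ≤ n)
    (hs : s - (n : ℝ) / 2 ∈ Set.Ioo (0 : ℝ) 1 ∪ Set.Ioo (1 : ℝ) 2) :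
    ∃ C : ℝ, 0 < C ∧ ∀ ℓ, 1 ≤ ℓ → |alpha n s ℓ| ≤ C * lapEig n ℓ ^ s := by
  obtain ⟨C, hC⟩ := (Metric.isBounded_range_of_tendsto _ (tendsto_alpha_div hs)).exists_norm_le
  refine ⟨max C 1, by positivity, fun ℓ hℓ => ?_⟩
  have h := hC _ ⟨ℓ, rfl⟩
  have hp : 0 < lapEig n ℓ ^ s := Real.rpow_pos_of_pos (lapEig_pos hn hℓ) s
  rw [Real.norm_eq_abs, abs_div, abs_of_pos hp, div_le_iff₀ hp] at h
  exact h.trans (mul_le_mul_of_nonneg_right (le_max_left _ _) hp.le)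

lemma exists_lapEig_le (hn : 1 ≤ n)
    (hs : s - (n : ℝ) / 2 ∈ Set.Ioo (0 : ℝ) 1 ∪ Set.Ioo (1 : ℝ) 2) :
    ∃ C : ℝ, 0 < C ∧ ∀ ℓ, 2 ≤ ℓ → lapEig n ℓ ^ s ≤ C * alpha n s ℓ := by
  have ht := (tendsto_alpha_div hs).inv₀ one_ne_zero
  obtain ⟨C, hC⟩ := (Metric.isBounded_range_of_tendsto _ ht).exists_norm_le
  refine ⟨max C 1, by positivity, fun ℓ hℓ => ?_⟩
  have h : ‖(alpha n s ℓ / lapEig n ℓ ^ s)⁻¹‖ ≤ C := hC _ ⟨ℓ, rfl⟩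
  have hp : 0 < lapEig n ℓ ^ s := Real.rpow_pos_of_pos (lapEig_pos hn (by omega)) s
  have ha := alpha_pos hs hℓ
  rw [inv_div, Real.norm_eq_abs, abs_div, abs_of_pos hp, abs_of_pos ha, div_le_iff₀ ha] at h
  exact h.trans (mul_le_mul_of_nonneg_right (le_max_left _ _) ha.le)

end Alpha

/-! ### Polynomials in `L²` of the sphere -/

section RestrictPoly

variable {n : ℕ}

/-- Restriction of a polynomial to the sphere as a continuous function. -/
def polyCont (n : ℕ) : MvPolynomial (Fin (n + 1)) ℝ →ₐ[ℝ] C(Sph n, ℝ) :=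
  MvPolynomial.aeval (coord n)

lemma polyCont_apply (p : MvPolynomial (Fin (n + 1)) ℝ) (ω : Sph n) :
    polyCont n p ω = polyVal p (ω : Amb n) := by
  unfold polyCont polyVal
  induction p using MvPolynomial.induction_on with
  | C a => simp
  | add p q hp hq => simp [hp, hq]
  | mul_X p i hp => simp [hp, coord]

lemma restrictPoly_apply (p : MvPolynomial (Fin (n + 1)) ℝ) :
    restrictPoly n p = ContinuousMap.toLp 2 (surf n) ℝ (polyCont n p) := rfl

lemma inner_toLp (f g : C(Sph n, ℝ)) :
    inner ℝ (ContinuousMap.toLp 2 (surf n) ℝ f) (ContinuousMap.toLp 2 (surf n) ℝ g) =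
      ∫ ω, f ω * g ω ∂(surf n) := by
  rw [ContinuousMap.inner_toLp]
  simp [mul_comm]

lemma inner_restrictPoly (p q : MvPolynomial (Fin (n + 1)) ℝ) :
    inner ℝ (restrictPoly n p) (restrictPoly n q) =
      ∫ ω : Sph n, polyVal (p * q) ω ∂(surf n) := by
  rw [restrictPoly_apply, restrictPoly_apply, inner_toLp]
  simp [polyCont_apply, polyVal]

lemma polyVal_linForm (ζ x : Amb n) : polyVal (linForm n ζ) x = inner ℝ ζ x := by
  simp [polyVal, linForm_apply, PiLp.inner_apply, mul_comm]

lemma polyCont_linForm (ζ : Amb n) (ω : Sph n) :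
    polyCont n (linForm n ζ) ω = inner ℝ ζ (ω : Amb n) := by
  rw [polyCont_apply, polyVal_linForm]

lemma polyCont_normSqPoly : polyCont n (normSqPoly n) = 1 := by
  ext ω
  have h : ‖(ω : Amb n)‖ = 1 := by simp
  have h2 := EuclideanSpace.real_norm_sq_eq (ω : Amb n)
  rw [polyCont_apply]
  simp only [polyVal, normSqPoly, map_sum, map_pow, MvPolynomial.eval_X, ContinuousMap.one_apply]
  rw [← h2, h]; norm_num

lemma restrictPoly_eq_zero {p : MvPolynomial (Fin (n + 1)) ℝ} (hp : p ∈ sphereIdeal n) :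
    restrictPoly n p = 0 := by
  obtain ⟨q, rfl⟩ := mem_sphereIdeal.mp hp
  rw [restrictPoly_apply, map_mul, map_sub, polyCont_normSqPoly, map_one, sub_self, mul_zero,
    map_zero]

lemma inner_sphHarm {k m : ℕ} (hkm : k ≠ m) {u v : L2 n} (hu : u ∈ sphHarm n k)
    (hv : v ∈ sphHarm n m) : inner ℝ u v = 0 := by
  obtain ⟨p, hp, rfl⟩ := hu
  obtain ⟨q, hq, rfl⟩ := hv
  rw [inner_restrictPoly]
  exact integral_mul_harmonic_eq_zero hkm hp hq

lemma restrictPoly_mem_sphHarm {k : ℕ} {p : MvPolynomial (Fin (n + 1)) ℝ}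
    (hp : p ∈ harmonicPoly n k) : restrictPoly n p ∈ sphHarm n k := ⟨p, hp, rfl⟩

lemma proj_restrictPoly_self {k : ℕ} {p : MvPolynomial (Fin (n + 1)) ℝ}
    (hp : p ∈ harmonicPoly n k) : proj n k (restrictPoly n p) = restrictPoly n p :=
  Submodule.starProjection_eq_self_iff.mpr (restrictPoly_mem_sphHarm hp)

lemma proj_restrictPoly_of_ne {k m : ℕ} (hkm : m ≠ k) {p : MvPolynomial (Fin (n + 1)) ℝ}
    (hp : p ∈ harmonicPoly n k) : proj n m (restrictPoly n p) = 0 := by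
  refine (Submodule.starProjection_apply_eq_zero_iff _).mpr ?_
  exact (Submodule.mem_orthogonal _ _).mpr fun u hu =>
    inner_sphHarm hkm hu (restrictPoly_mem_sphHarm hp)

lemma norm_proj_le (ℓ : ℕ) (u : L2 n) : ‖proj n ℓ u‖ ≤ ‖u‖ :=
  (sphHarm n ℓ).norm_starProjection_apply_le u

lemma proj_mem (ℓ : ℕ) (u : L2 n) : proj n ℓ u ∈ sphHarm n ℓ :=
  (sphHarm n ℓ).starProjection_apply_mem u

/-- The `L²` pairing against a spherical harmonic only sees the corresponding component. -/
lemma inner_proj_left {ℓ : ℕ} {u v : L2 n} (hv : v ∈ sphHarm n ℓ) :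
    inner ℝ (proj n ℓ u) v = inner ℝ u v := by
  rw [proj, Submodule.inner_starProjection_left_eq_right,
    Submodule.starProjection_eq_self_iff.mpr hv]

lemma proj_eq_zero_of_mem_harmUpTo {k ℓ : ℕ} (h : k < ℓ) {p : MvPolynomial (Fin (n + 1)) ℝ}
    (hp : p ∈ harmUpTo n k) : proj n ℓ (restrictPoly n p) = 0 := by
  have : harmUpTo n k ≤ LinearMap.ker ((proj n ℓ).toLinearMap ∘ₗ restrictPoly n) := by
    refine harmUpTo_le (fun m hm p hp => ?_) (fun p hp => ?_)
    · exact proj_restrictPoly_of_ne (by omega) hp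
    · change proj n ℓ (restrictPoly n p) = 0
      rw [restrictPoly_eq_zero hp, map_zero]
  exact this hp

/-- Pythagoras: the components of a function have square-summable norms. -/
lemma sum_norm_proj_sq_le (S : Finset ℕ) (u : L2 n) : ∑ ℓ ∈ S, ‖proj n ℓ u‖ ^ 2 ≤ ‖u‖ ^ 2 := by
  have h1 : ‖∑ ℓ ∈ S, proj n ℓ u‖ ^ 2 = ∑ ℓ ∈ S, ‖proj n ℓ u‖ ^ 2 := by
    rw [← real_inner_self_eq_norm_sq, sum_inner]
    refine Finset.sum_congr rfl fun ℓ hℓ => ?_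
    rw [inner_sum, Finset.sum_eq_single ℓ, real_inner_self_eq_norm_sq]
    · intro m _ hm
      exact inner_sphHarm hm.symm (proj_mem ℓ u) (proj_mem m u)
    · exact fun h => absurd hℓ h
  have h2 : inner ℝ u (∑ ℓ ∈ S, proj n ℓ u) = ∑ ℓ ∈ S, ‖proj n ℓ u‖ ^ 2 := by
    rw [inner_sum]
    refine Finset.sum_congr rfl fun ℓ _ => ?_
    rw [← inner_proj_left (proj_mem ℓ u), real_inner_self_eq_norm_sq]
  have h3 := norm_sub_sq_real u (∑ ℓ ∈ S, proj n ℓ u)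
  nlinarith [sq_nonneg ‖u - ∑ ℓ ∈ S, proj n ℓ u‖]

end RestrictPoly

/-! ### The Sobolev space -/

section Sobolev

variable {n : ℕ} {s : ℝ}

lemma Sob.toL2_injective : Function.Injective (Sob.toL2 (n := n) (s := s)) :=
  Subtype.coe_injective

lemma Sob.norm_toL2_le (u : Sob n s) : ‖u.toL2‖ ≤ ‖u‖ := by
  have h := Sob.norm_sq_eq u
  have : 0 ≤ ∑' ℓ, lapEig n ℓ ^ s * ‖proj n ℓ u.toL2‖ ^ 2 :=
    tsum_nonneg fun ℓ => mul_nonneg (Real.rpow_nonneg (lapEig_nonneg n ℓ) s) (sq_nonneg _)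
  exact (sq_le_sq₀ (norm_nonneg _) (norm_nonneg _)).mp (by linarith)

/-- The inclusion of `H^s` in `L²` is continuous. -/
def Sob.toL2CLM (n : ℕ) (s : ℝ) : Sob n s →L[ℝ] L2 n :=
  Sob.toL2.mkContinuous 1 fun u => by simpa using Sob.norm_toL2_le u

lemma Sob.mem_iff {u : L2 n} : u ∈ sobolevSubmodule n s ↔ Memℓp (fracCoeff n s u) 2 := Iff.rfl

lemma Sob.summable_lapEig (u : Sob n s) :
    Summable fun ℓ => lapEig n ℓ ^ s * ‖proj n ℓ u.toL2‖ ^ 2 := by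
  have h : Memℓp (fracCoeff n s u.toL2) 2 := u.2
  have h2 := h.summable (by norm_num)
  refine h2.congr fun ℓ => ?_
  rw [fracCoeff, norm_smul, ENNReal.toReal_ofNat, Real.rpow_two, mul_pow, Real.norm_eq_abs, sq_abs,
    ← Real.rpow_two, ← Real.rpow_mul (lapEig_nonneg n ℓ)]
  norm_num

lemma Sob.isometry_graph : Isometry (Sob.graph (n := n) (s := s)) :=
  AddMonoidHomClass.isometry_of_norm Sob.graph fun _ => rfl

/-- The range of the graph embedding is closed, being cut out by one continuous equation for each
degree. Completeness is needed for power series and for the implicit function theorem. -/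
instance (n : ℕ) (s : ℝ) : CompleteSpace (Sob n s) := by
  have hclosed : IsClosed (Set.range (Sob.graph (n := n) (s := s))) := by
    have : Set.range (Sob.graph (n := n) (s := s)) =
        ⋂ ℓ : ℕ, {x : WithLp 2 (L2 n × lp (fun _ : ℕ => L2 n) 2) |
          (x.snd : ∀ _ : ℕ, L2 n) ℓ = (lapEig n ℓ ^ (s / 2)) • proj n ℓ x.fst} := by
      ext x
      simp only [Set.mem_range, Set.mem_iInter]
      constructor
      · rintro ⟨u, rfl⟩ ℓ
        rfl
      · intro hx
        have hfun : fracCoeff n s x.fst = (x.snd : ∀ _ : ℕ, L2 n) := by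
          funext ℓ; exact (hx ℓ).symm
        have hmem : x.fst ∈ sobolevSubmodule n s := by
          rw [Sob.mem_iff, hfun]; exact lp.memℓp x.snd
        refine ⟨⟨x.fst, hmem⟩, ?_⟩
        refine (WithLp.equiv 2 _).injective (Prod.ext rfl (lp.ext ?_))
        exact hfun
    rw [this]
    refine isClosed_iInter fun ℓ => isClosed_eq ?_ ?_
    · exact (lp.evalCLM ℝ (fun _ : ℕ => L2 n) 2 ℓ).continuous.comp
        (WithLp.continuous_snd 2 (L2 n) (lp (fun _ : ℕ => L2 n) 2))
    · exact ((proj n ℓ).continuous.comp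
        (WithLp.continuous_fst 2 (L2 n) (lp (fun _ : ℕ => L2 n) 2))).const_smul (lapEig n ℓ ^ (s / 2))
  exact (completeSpace_iff_isComplete_range Sob.isometry_graph.isUniformInducing).mpr
    hclosed.isComplete

lemma lapEig_mono {ℓ k : ℕ} (h : ℓ ≤ k) (hn : 1 ≤ n) : lapEig n ℓ ≤ lapEig n k := by
  have h1 : (ℓ : ℝ) ≤ k := by exact_mod_cast h
  have h2 : (1 : ℝ) ≤ n := by exact_mod_cast hn
  have h3 : (0 : ℝ) ≤ ℓ := ℓ.cast_nonneg
  unfold lapEig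
  gcongr
  linarith

lemma restrictPoly_mem_sobolevSubmodule (hn : 1 ≤ n) (s : ℝ) (p : MvPolynomial (Fin (n + 1)) ℝ) :
    restrictPoly n p ∈ sobolevSubmodule n s := by
  obtain ⟨k, hk⟩ := exists_mem_harmUpTo hn p
  rw [Sob.mem_iff]
  refine memℓp_gen (summable_of_ne_finset_zero (s := Finset.range (k + 1)) fun ℓ hℓ => ?_)
  rw [Finset.mem_range, not_lt] at hℓ
  rw [fracCoeff, proj_eq_zero_of_mem_harmUpTo (by omega) hk]
  simp

/-- Restriction of polynomials to the sphere, with values in `H^s`. -/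
def polySob (hn : 1 ≤ n) (s : ℝ) : MvPolynomial (Fin (n + 1)) ℝ →ₗ[ℝ] Sob n s :=
  (restrictPoly n).codRestrict (sobolevSubmodule n s) (restrictPoly_mem_sobolevSubmodule hn s)

lemma toL2_polySob (hn : 1 ≤ n) (p : MvPolynomial (Fin (n + 1)) ℝ) :
    (polySob hn s p).toL2 = restrictPoly n p := rfl

lemma polySob_eq_zero (hn : 1 ≤ n) {p : MvPolynomial (Fin (n + 1)) ℝ} (hp : p ∈ sphereIdeal n) :
    polySob hn s p = 0 :=
  Sob.toL2_injective (by rw [toL2_polySob, restrictPoly_eq_zero hp, map_zero])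

/-- A Bernstein-type inequality: no component has degree above k, and the eigenvalues increase with
the degree. -/
lemma norm_sq_polySob_le (hn : 1 ≤ n) (hs : 0 ≤ s) {k : ℕ} {p : MvPolynomial (Fin (n + 1)) ℝ}
    (hp : p ∈ harmUpTo n k) :
    ‖polySob hn s p‖ ^ 2 ≤ (1 + lapEig n k ^ s) * ‖restrictPoly n p‖ ^ 2 := by
  rw [Sob.norm_sq_eq, toL2_polySob, add_mul, one_mul]
  gcongr
  rw [tsum_eq_sum (s := Finset.range (k + 1))]
  · calc _ ≤ ∑ ℓ ∈ Finset.range (k + 1), lapEig n k ^ s * ‖proj n ℓ (restrictPoly n p)‖ ^ 2 := by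
          refine Finset.sum_le_sum fun ℓ hℓ => ?_
          have : ℓ ≤ k := by simpa [Nat.lt_succ_iff] using hℓ
          exact mul_le_mul_of_nonneg_right
            (Real.rpow_le_rpow (lapEig_nonneg n ℓ) (lapEig_mono this hn) hs) (sq_nonneg _)
      _ = lapEig n k ^ s * ∑ ℓ ∈ Finset.range (k + 1), ‖proj n ℓ (restrictPoly n p)‖ ^ 2 := by
          rw [Finset.mul_sum]
      _ ≤ _ := mul_le_mul_of_nonneg_left (sum_norm_proj_sq_le _ _)
          (Real.rpow_nonneg (lapEig_nonneg n k) s)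
  · intro ℓ hℓ
    rw [Finset.mem_range, not_lt] at hℓ
    rw [proj_eq_zero_of_mem_harmUpTo (by omega) hp]
    simp

end Sobolev

/-! ### The bilinear form -/

section Form

variable {n : ℕ} {s : ℝ}

lemma aForm_comm (u v : Sob n s) : aForm u v = aForm v u := by
  unfold aForm
  exact tsum_congr fun ℓ => by rw [real_inner_comm]

/-- In degree ℓ ≥ 1 the weight λ_ℓ^s dominates `alpha`. The constant mode has eigenvalue 0 and is
paid for by the L² norm. -/
lemma exists_alpha_sum_le (hn : 1 ≤ n)
    (hs : s - (n : ℝ) / 2 ∈ Set.Ioo (0 : ℝ) 1 ∪ Set.Ioo (1 : ℝ) 2) :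
    ∃ C : ℝ, 0 ≤ C ∧ ∀ u : Sob n s, (Summable fun ℓ => |alpha n s ℓ| * ‖proj n ℓ u.toL2‖ ^ 2) ∧
      ∑' ℓ, |alpha n s ℓ| * ‖proj n ℓ u.toL2‖ ^ 2 ≤ C * ‖u‖ ^ 2 := by
  obtain ⟨C, hC0, hC⟩ := exists_alpha_le hn hs
  refine ⟨C + |alpha n s 0|, by positivity, fun u => ?_⟩
  have hsum1 : Summable fun ℓ => C * (lapEig n ℓ ^ s * ‖proj n ℓ u.toL2‖ ^ 2) :=
    (Sob.summable_lapEig u).mul_left C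
  have hsum2 : HasSum (fun ℓ : ℕ => if ℓ = 0 then |alpha n s 0| * ‖u.toL2‖ ^ 2 else 0)
      (|alpha n s 0| * ‖u.toL2‖ ^ 2) := hasSum_ite_eq 0 _
  have hle : ∀ ℓ, |alpha n s ℓ| * ‖proj n ℓ u.toL2‖ ^ 2 ≤
      C * (lapEig n ℓ ^ s * ‖proj n ℓ u.toL2‖ ^ 2) +
        (if ℓ = 0 then |alpha n s 0| * ‖u.toL2‖ ^ 2 else 0) := by
    intro ℓ
    have hnn : 0 ≤ lapEig n ℓ ^ s := Real.rpow_nonneg (lapEig_nonneg n ℓ) s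
    rcases Nat.eq_zero_or_pos ℓ with rfl | hℓ
    · simp only [if_true]
      have : |alpha n s 0| * ‖proj n 0 u.toL2‖ ^ 2 ≤ |alpha n s 0| * ‖u.toL2‖ ^ 2 := by
        gcongr; exact norm_proj_le 0 _
      have : 0 ≤ C * (lapEig n 0 ^ s * ‖proj n 0 u.toL2‖ ^ 2) := by positivity
      linarith
    · rw [if_neg hℓ.ne', add_zero, ← mul_assoc]
      exact mul_le_mul_of_nonneg_right (hC ℓ hℓ) (sq_nonneg _)
  have hsum := Summable.of_nonneg_of_le (fun ℓ => by positivity) hle (hsum1.add hsum2.summable)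
  refine ⟨hsum, (hsum.tsum_le_tsum hle (hsum1.add hsum2.summable)).trans ?_⟩
  rw [hsum1.tsum_add hsum2.summable, hsum2.tsum_eq, tsum_mul_left]
  have h := Sob.norm_sq_eq u
  have h1 : ∑' ℓ, lapEig n ℓ ^ s * ‖proj n ℓ u.toL2‖ ^ 2 ≤ ‖u‖ ^ 2 := by
    have := sq_nonneg ‖u.toL2‖
    linarith
  have h2 : ‖u.toL2‖ ^ 2 ≤ ‖u‖ ^ 2 := by gcongr; exact Sob.norm_toL2_le u
  rw [add_mul]
  gcongr

lemma summable_aForm (hn : 1 ≤ n)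
    (hs : s - (n : ℝ) / 2 ∈ Set.Ioo (0 : ℝ) 1 ∪ Set.Ioo (1 : ℝ) 2) (u v : Sob n s) :
    Summable fun ℓ => alpha n s ℓ * inner ℝ (proj n ℓ u.toL2) (proj n ℓ v.toL2) := by
  obtain ⟨C, _, hC⟩ := exists_alpha_sum_le hn hs
  refine Summable.of_norm_bounded ((hC u).1.add (hC v).1) fun ℓ => ?_
  have h1 := abs_real_inner_le_norm (proj n ℓ u.toL2) (proj n ℓ v.toL2)
  rw [norm_mul, Real.norm_eq_abs, Real.norm_eq_abs, ← mul_add]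
  gcongr
  nlinarith [sq_nonneg (‖proj n ℓ u.toL2‖ - ‖proj n ℓ v.toL2‖), sq_nonneg ‖proj n ℓ u.toL2‖,
    sq_nonneg ‖proj n ℓ v.toL2‖]

lemma exists_abs_aForm_le (hn : 1 ≤ n)
    (hs : s - (n : ℝ) / 2 ∈ Set.Ioo (0 : ℝ) 1 ∪ Set.Ioo (1 : ℝ) 2) :
    ∃ C : ℝ, 0 ≤ C ∧ ∀ u v : Sob n s, |aForm u v| ≤ C * (‖u‖ ^ 2 + ‖v‖ ^ 2) := by
  obtain ⟨C, hC0, hC⟩ := exists_alpha_sum_le hn hs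
  refine ⟨C, hC0, fun u v => ?_⟩
  have h := tsum_of_norm_bounded
    (f := fun ℓ => alpha n s ℓ * inner ℝ (proj n ℓ u.toL2) (proj n ℓ v.toL2))
    ((hC u).1.add (hC v).1).hasSum (fun ℓ => by
      have h1 := abs_real_inner_le_norm (proj n ℓ u.toL2) (proj n ℓ v.toL2)
      rw [norm_mul, Real.norm_eq_abs, Real.norm_eq_abs, ← mul_add]
      gcongr
      nlinarith [sq_nonneg (‖proj n ℓ u.toL2‖ - ‖proj n ℓ v.toL2‖), sq_nonneg ‖proj n ℓ u.toL2‖,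
        sq_nonneg ‖proj n ℓ v.toL2‖])
  rw [(hC u).1.tsum_add (hC v).1, Real.norm_eq_abs] at h
  have := (hC u).2
  have := (hC v).2
  unfold aForm
  linarith

/-- `a_{2s}` as a bounded bilinear form. -/
lemma exists_aBil (hn : 1 ≤ n)
    (hs : s - (n : ℝ) / 2 ∈ Set.Ioo (0 : ℝ) 1 ∪ Set.Ioo (1 : ℝ) 2) :
    ∃ A : Sob n s →L[ℝ] Sob n s →L[ℝ] ℝ, ∀ u v, A u v = aForm u v := by
  obtain ⟨C, hC0, hC⟩ := exists_abs_aForm_le hn hs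
  have hsum := summable_aForm hn hs
  have hadd : ∀ u u' v : Sob n s, aForm (u + u') v = aForm u v + aForm u' v := fun u u' v => by
    unfold aForm
    rw [← (hsum u v).tsum_add (hsum u' v)]
    exact tsum_congr fun ℓ => by rw [map_add, map_add, inner_add_left, mul_add]
  have hsmul : ∀ (c : ℝ) (u v : Sob n s), aForm (c • u) v = c * aForm u v := fun c u v => by
    unfold aForm
    rw [← tsum_mul_left]
    exact tsum_congr fun ℓ => by
      rw [map_smul, map_smul, real_inner_smul_left]; ring
  let B : Sob n s →ₗ[ℝ] Sob n s →ₗ[ℝ] ℝ := LinearMap.mk₂ ℝ aForm hadd hsmul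
    (fun u v v' => by rw [aForm_comm, hadd, aForm_comm v u, aForm_comm v' u])
    (fun c u v => by rw [aForm_comm, hsmul, aForm_comm v u]; rfl)
  refine ⟨B.mkContinuous₂ (2 * C) fun u v => ?_, fun u v => rfl⟩
  change |aForm u v| ≤ _
  rcases eq_or_ne u 0 with rfl | hu
  · have : aForm (0 : Sob n s) v = 0 := by simpa using hsmul 0 0 v
    simp [this]
  rcases eq_or_ne v 0 with rfl | hv
  · have : aForm u (0 : Sob n s) = 0 := by rw [aForm_comm]; simpa using hsmul 0 0 u
    simp [this]
  have hu' : 0 < ‖u‖ := norm_pos_iff.mpr hu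
  have hv' : 0 < ‖v‖ := norm_pos_iff.mpr hv
  -- Applying the bound by a sum of squares to unit vectors turns it into a bound by 2C‖u‖‖v‖.
  have h := hC (‖u‖⁻¹ • u) (‖v‖⁻¹ • v)
  rw [hsmul, aForm_comm, hsmul, aForm_comm v u, norm_smul, norm_smul, norm_inv, norm_inv,
    norm_norm, norm_norm, inv_mul_cancel₀ hu'.ne', inv_mul_cancel₀ hv'.ne', abs_mul, abs_mul,
    abs_of_pos (inv_pos.mpr hu'), abs_of_pos (inv_pos.mpr hv'), ← mul_assoc, ← mul_inv,
    inv_mul_le_iff₀ (by positivity)] at h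
  nlinarith

/-- `a_{2s}` as a bounded bilinear form. -/
def aBil (hn : 1 ≤ n) (hs : s - (n : ℝ) / 2 ∈ Set.Ioo (0 : ℝ) 1 ∪ Set.Ioo (1 : ℝ) 2) :
    Sob n s →L[ℝ] Sob n s →L[ℝ] ℝ := (exists_aBil hn hs).choose

lemma aBil_apply (hn : 1 ≤ n) (hs : s - (n : ℝ) / 2 ∈ Set.Ioo (0 : ℝ) 1 ∪ Set.Ioo (1 : ℝ) 2)
    (u v : Sob n s) : aBil hn hs u v = aForm u v := (exists_aBil hn hs).choose_spec u v

lemma aBil_comm (hn : 1 ≤ n) (hs : s - (n : ℝ) / 2 ∈ Set.Ioo (0 : ℝ) 1 ∪ Set.Ioo (1 : ℝ) 2)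
    (u v : Sob n s) : aBil hn hs u v = aBil hn hs v u := by
  rw [aBil_apply, aBil_apply, aForm_comm]

lemma aBil_polySob (hn : 1 ≤ n) (hs : s - (n : ℝ) / 2 ∈ Set.Ioo (0 : ℝ) 1 ∪ Set.Ioo (1 : ℝ) 2)
    (u : Sob n s) {k : ℕ} {p : MvPolynomial (Fin (n + 1)) ℝ} (hp : p ∈ harmonicPoly n k) :
    aBil hn hs u (polySob hn s p) = alpha n s k * inner ℝ u.toL2 (restrictPoly n p) := by
  rw [aBil_apply, aForm, tsum_eq_single k, toL2_polySob, proj_restrictPoly_self hp,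
    inner_proj_left (restrictPoly_mem_sphHarm hp)]
  intro ℓ hℓ
  rw [toL2_polySob, proj_restrictPoly_of_ne hℓ hp, inner_zero_right, mul_zero]

/-- Gårding's inequality: up to an `L²` term, `a_{2s}` controls the `H^s` norm. -/
lemma exists_norm_sq_le (hn : 1 ≤ n)
    (hs : s - (n : ℝ) / 2 ∈ Set.Ioo (0 : ℝ) 1 ∪ Set.Ioo (1 : ℝ) 2) :
    ∃ C D : ℝ, 0 < C ∧ 0 < D ∧ ∀ u : Sob n s, ‖u‖ ^ 2 ≤ C * aBil hn hs u u + D * ‖u.toL2‖ ^ 2 := by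
  obtain ⟨C, hC0, hC⟩ := exists_lapEig_le hn hs
  -- For the modes 0 and 1, where `alpha` may be negative, `c` pays both for the Sobolev weight and
  -- for the possible loss in the form.
  set c : ℕ → ℝ := fun ℓ => lapEig n ℓ ^ s + C * |alpha n s ℓ| with hc
  have hcnn : ∀ ℓ, 0 ≤ c ℓ := fun ℓ =>
    add_nonneg (Real.rpow_nonneg (lapEig_nonneg n ℓ) s) (by positivity)
  refine ⟨C, 1 + (c 0 + c 1), hC0, by have := hcnn 0; have := hcnn 1; positivity, fun u => ?_⟩
  have hA := (summable_aForm hn hs u u).mul_left C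
  have hF : HasSum (fun ℓ : ℕ => if ℓ ∈ Finset.range 2 then c ℓ * ‖u.toL2‖ ^ 2 else 0)
      ((c 0 + c 1) * ‖u.toL2‖ ^ 2) := by
    have := hasSum_sum_of_ne_finset_zero (L := SummationFilter.unconditional ℕ)
      (s := Finset.range 2)
      (f := fun ℓ : ℕ => if ℓ ∈ Finset.range 2 then c ℓ * ‖u.toL2‖ ^ 2 else 0)
      (fun ℓ hℓ => if_neg hℓ)
    convert this using 1
    simp [Finset.sum_range_succ, add_mul]
  have hle : ∀ ℓ, lapEig n ℓ ^ s * ‖proj n ℓ u.toL2‖ ^ 2 ≤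
      C * (alpha n s ℓ * inner ℝ (proj n ℓ u.toL2) (proj n ℓ u.toL2)) +
        if ℓ ∈ Finset.range 2 then c ℓ * ‖u.toL2‖ ^ 2 else 0 := by
    intro ℓ
    rw [real_inner_self_eq_norm_sq]
    have hp : ‖proj n ℓ u.toL2‖ ^ 2 ≤ ‖u.toL2‖ ^ 2 := by gcongr; exact norm_proj_le ℓ _
    split_ifs with h
    · have h1 : c ℓ * ‖proj n ℓ u.toL2‖ ^ 2 ≤ c ℓ * ‖u.toL2‖ ^ 2 :=
        mul_le_mul_of_nonneg_left hp (hcnn ℓ)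
      have h2 : -(C * |alpha n s ℓ| * ‖proj n ℓ u.toL2‖ ^ 2) ≤
          C * (alpha n s ℓ * ‖proj n ℓ u.toL2‖ ^ 2) := by
        have := neg_abs_le (alpha n s ℓ)
        have h3 : 0 ≤ C * ‖proj n ℓ u.toL2‖ ^ 2 := by positivity
        nlinarith
      simp only [hc, add_mul] at h1
      simp only [hc, add_mul]
      linarith
    · have : 2 ≤ ℓ := not_lt.mp (fun hlt => h (Finset.mem_range.mpr hlt))
      rw [add_zero, ← mul_assoc]
      exact mul_le_mul_of_nonneg_right (hC ℓ this) (sq_nonneg _)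
  have h := (Sob.summable_lapEig u).tsum_le_tsum hle (hA.add hF.summable)
  rw [hA.tsum_add hF.summable, hF.tsum_eq, tsum_mul_left] at h
  rw [Sob.norm_sq_eq, aBil_apply, aForm]
  linarith

end Form

/-! ### Infinitesimal conformal invariance of the form -/

section LieInvariance

variable {n : ℕ} {s : ℝ}

lemma restrictPoly_linForm_mul (e : Amb n) (ℓ : ℕ) (p : MvPolynomial (Fin (n + 1)) ℝ) :
    restrictPoly n (linForm n e * p) =
      restrictPoly n (raise e ℓ p) + restrictPoly n (lower e ℓ p) := by
  have heq : linForm n e * p =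
      raise e ℓ p + lower e ℓ p + lower e ℓ p * (normSqPoly n - 1) := by
    rw [linForm_mul_eq e ℓ]; ring
  rw [heq, map_add, map_add, restrictPoly_eq_zero (mem_sphereIdeal.mpr ⟨_, rfl⟩), add_zero]

lemma inner_raise_of_ne (hn : 1 ≤ n) (e : Amb n) {k m : ℕ} (hkm : m ≠ k + 1)
    {p q : MvPolynomial (Fin (n + 1)) ℝ} (hp : p ∈ harmonicPoly n k) (hq : q ∈ harmonicPoly n m) :
    inner ℝ (restrictPoly n (raise e k p)) (restrictPoly n q) = 0 :=
  inner_sphHarm hkm.symm (restrictPoly_mem_sphHarm (raise_mem hn e hp))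
    (restrictPoly_mem_sphHarm hq)

lemma inner_lower_of_ne (e : Amb n) {k m : ℕ} (hkm : k ≠ m + 1)
    {p q : MvPolynomial (Fin (n + 1)) ℝ} (hp : p ∈ harmonicPoly n k) (hq : q ∈ harmonicPoly n m) :
    inner ℝ (restrictPoly n (lower e k p)) (restrictPoly n q) = 0 := by
  rcases k with _ | k
  · rw [lower_of_mem_zero e _ hp, map_zero, inner_zero_left]
  · exact inner_sphHarm (by omega) (restrictPoly_mem_sphHarm (lower_mem e hp))
      (restrictPoly_mem_sphHarm hq)

lemma inner_linForm_mul_comm (e : Amb n) (p q : MvPolynomial (Fin (n + 1)) ℝ) :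
    inner ℝ (restrictPoly n (linForm n e * p)) (restrictPoly n q) =
      inner ℝ (restrictPoly n (linForm n e * q)) (restrictPoly n p) := by
  rw [inner_restrictPoly, inner_restrictPoly]
  congr 2; ring_nf

lemma restrictPoly_lieOp (hn : 1 ≤ n) (e : Amb n) (σ : ℝ) {k : ℕ}
    {p : MvPolynomial (Fin (n + 1)) ℝ} (hp : p ∈ harmonicPoly n k) :
    restrictPoly n (lieOp e σ p) = (σ - k) • restrictPoly n (raise e k p) +
      (k + n - 1 + σ) • restrictPoly n (lower e k p) := by
  rw [lieOp_of_mem_harmonicPoly hn e σ hp, map_add, map_add,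
    restrictPoly_eq_zero (mem_sphereIdeal.mpr ⟨_, rfl⟩), add_zero, map_smul, map_smul]

lemma inner_lieOp_succ (hn : 1 ≤ n) (e : Amb n) (σ : ℝ) {k : ℕ}
    {p q : MvPolynomial (Fin (n + 1)) ℝ} (hp : p ∈ harmonicPoly n k)
    (hq : q ∈ harmonicPoly n (k + 1)) :
    inner ℝ (restrictPoly n (lieOp e σ p)) (restrictPoly n q) =
      (σ - k) * inner ℝ (restrictPoly n (linForm n e * p)) (restrictPoly n q) := by
  rw [restrictPoly_lieOp hn e σ hp, restrictPoly_linForm_mul e k, inner_add_left, inner_add_left,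
    real_inner_smul_left, real_inner_smul_left, inner_lower_of_ne e (by omega) hp hq]
  ring

lemma inner_lieOp_pred (hn : 1 ≤ n) (e : Amb n) (σ : ℝ) {k : ℕ}
    {p q : MvPolynomial (Fin (n + 1)) ℝ} (hp : p ∈ harmonicPoly n k)
    (hq : q ∈ harmonicPoly n (k + 1)) :
    inner ℝ (restrictPoly n (lieOp e σ q)) (restrictPoly n p) =
      (k + n + σ) * inner ℝ (restrictPoly n (linForm n e * p)) (restrictPoly n q) := by
  rw [inner_linForm_mul_comm e p q, restrictPoly_lieOp hn e σ hq,
    restrictPoly_linForm_mul e (k + 1), inner_add_left, inner_add_left,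
    real_inner_smul_left, real_inner_smul_left, inner_raise_of_ne hn e (by omega) hq hp]
  push_cast
  ring

/-- With σ = s − n/2, both terms are multiples of ⟨(e·x)p, q⟩, with coefficients α(k + 1)(σ − k) and
α(k)(k + n + σ). Their sum is zero by `alpha_succ`. -/
lemma aBil_lieOp_succ (hn : 1 ≤ n)
    (hs : s - (n : ℝ) / 2 ∈ Set.Ioo (0 : ℝ) 1 ∪ Set.Ioo (1 : ℝ) 2) (e : Amb n) {k : ℕ}
    {p q : MvPolynomial (Fin (n + 1)) ℝ} (hp : p ∈ harmonicPoly n k)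
    (hq : q ∈ harmonicPoly n (k + 1)) :
    aBil hn hs (polySob hn s (lieOp e (s - n / 2) p)) (polySob hn s q) +
      aBil hn hs (polySob hn s (lieOp e (s - n / 2) q)) (polySob hn s p) = 0 := by
  rw [aBil_polySob hn hs _ hq, aBil_polySob hn hs _ hp, toL2_polySob, toL2_polySob,
    inner_lieOp_succ hn e _ hp hq, inner_lieOp_pred hn e _ hp hq]
  linear_combination (-inner ℝ (restrictPoly n (linForm n e * p)) (restrictPoly n q)) *
    alpha_succ hs k

lemma aBil_lieOp_of_harmonic (hn : 1 ≤ n)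
    (hs : s - (n : ℝ) / 2 ∈ Set.Ioo (0 : ℝ) 1 ∪ Set.Ioo (1 : ℝ) 2) (e : Amb n) {k m : ℕ}
    {p q : MvPolynomial (Fin (n + 1)) ℝ} (hp : p ∈ harmonicPoly n k) (hq : q ∈ harmonicPoly n m) :
    aBil hn hs (polySob hn s (lieOp e (s - n / 2) p)) (polySob hn s q) +
      aBil hn hs (polySob hn s (lieOp e (s - n / 2) q)) (polySob hn s p) = 0 := by
  by_cases h1 : m = k + 1
  · subst h1; exact aBil_lieOp_succ hn hs e hp hq
  by_cases h2 : k = m + 1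
  · subst h2; rw [add_comm]; exact aBil_lieOp_succ hn hs e hq hp
  rw [aBil_polySob hn hs _ hq, aBil_polySob hn hs _ hp, toL2_polySob, toL2_polySob,
    restrictPoly_lieOp hn e _ hp, restrictPoly_lieOp hn e _ hq]
  simp only [inner_add_left, real_inner_smul_left, inner_raise_of_ne hn e h1 hp hq,
    inner_raise_of_ne hn e h2 hq hp, inner_lower_of_ne e h2 hp hq, inner_lower_of_ne e h1 hq hp]
  ring

/-- `a_{2s}` is invariant under infinitesimal conformal transformations. -/
lemma aBil_lieOp (hn : 1 ≤ n)
    (hs : s - (n : ℝ) / 2 ∈ Set.Ioo (0 : ℝ) 1 ∪ Set.Ioo (1 : ℝ) 2) (e : Amb n)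
    (p q : MvPolynomial (Fin (n + 1)) ℝ) :
    aBil hn hs (polySob hn s (lieOp e (s - n / 2) p)) (polySob hn s q) +
      aBil hn hs (polySob hn s (lieOp e (s - n / 2) q)) (polySob hn s p) = 0 := by
  -- `S q` consists of the p satisfying the identity with q. Its symmetry in p and q allows each
  -- variable in turn to be reduced to harmonics.
  let S : MvPolynomial (Fin (n + 1)) ℝ → Submodule ℝ (MvPolynomial (Fin (n + 1)) ℝ) := fun q =>
    LinearMap.ker (((aBil hn hs).flip (polySob hn s q)).toLinearMap ∘ₗ polySob hn s ∘ₗ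
      lieOp e (s - n / 2) +
      (aBil hn hs (polySob hn s (lieOp e (s - n / 2) q))).toLinearMap ∘ₗ polySob hn s)
  have hS : ∀ p q, p ∈ S q ↔
      aBil hn hs (polySob hn s (lieOp e (s - n / 2) p)) (polySob hn s q) +
      aBil hn hs (polySob hn s (lieOp e (s - n / 2) q)) (polySob hn s p) = 0 := fun _ _ => Iff.rfl
  have hsymm : ∀ p q, p ∈ S q → q ∈ S p := fun p q h => by
    rw [hS] at h ⊢; rw [add_comm]; exact h
  have hideal : ∀ q, ∀ p ∈ sphereIdeal n, p ∈ S q := fun q p hp => by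
    rw [hS, polySob_eq_zero hn hp, polySob_eq_zero hn (lieOp_mem_sphereIdeal e _ hp)]
    simp
  have hharm : ∀ m, ∀ q ∈ harmonicPoly n m, ∀ p, p ∈ S q := fun m q hq p => by
    obtain ⟨k, hk⟩ := exists_mem_harmUpTo hn p
    exact harmUpTo_le (fun ℓ _ p hp => (hS p q).mpr (aBil_lieOp_of_harmonic hn hs e hp hq))
      (hideal q) hk
  obtain ⟨k, hk⟩ := exists_mem_harmUpTo hn p
  exact (hS p q).mp (harmUpTo_le (fun ℓ _ p hp => hsymm _ _ (hharm ℓ p hp q)) (hideal q) hk)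

/-- The closure of the graph of the infinitesimal conformal transformation. -/
def lieGraph (hn : 1 ≤ n) (s : ℝ) (e : Amb n) : Submodule ℝ (Sob n s × Sob n s) :=
  (LinearMap.range ((polySob hn s).prod (polySob hn s ∘ₗ lieOp e (s - n / 2)))).topologicalClosure

lemma isClosed_lieGraph (hn : 1 ≤ n) (s : ℝ) (e : Amb n) :
    IsClosed (lieGraph hn s e : Set (Sob n s × Sob n s)) :=
  Submodule.isClosed_topologicalClosure _

lemma polySob_mem_lieGraph (hn : 1 ≤ n) (s : ℝ) (e : Amb n) (p : MvPolynomial (Fin (n + 1)) ℝ) :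
    (polySob hn s p, polySob hn s (lieOp e (s - n / 2) p)) ∈ lieGraph hn s e :=
  Submodule.le_topologicalClosure _ ⟨p, rfl⟩

/-- The first-order operator `lieOp` loses a derivative, but the identity is continuous in the pairs
(p, Lp), so it passes to the closure of the graph, one pair at a time. -/
lemma aBil_of_mem_lieGraph (hn : 1 ≤ n)
    (hs : s - (n : ℝ) / 2 ∈ Set.Ioo (0 : ℝ) 1 ∪ Set.Ioo (1 : ℝ) 2) {e : Amb n}
    {x y : Sob n s × Sob n s} (hx : x ∈ lieGraph hn s e) (hy : y ∈ lieGraph hn s e) :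
    aBil hn hs x.2 y.1 + aBil hn hs y.2 x.1 = 0 := by
  have key : ∀ x ∈ lieGraph hn s e, ∀ q : MvPolynomial (Fin (n + 1)) ℝ,
      aBil hn hs x.2 (polySob hn s q) +
        aBil hn hs (polySob hn s (lieOp e (s - n / 2) q)) x.1 = 0 := by
    intro x hx q
    have hcl : IsClosed {x : Sob n s × Sob n s | aBil hn hs x.2 (polySob hn s q) +
        aBil hn hs (polySob hn s (lieOp e (s - n / 2) q)) x.1 = 0} :=
      isClosed_eq (by fun_prop) continuous_const
    refine closure_minimal ?_ hcl hx
    rintro _ ⟨p, rfl⟩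
    exact aBil_lieOp hn hs e p q
  have hcl : IsClosed {y : Sob n s × Sob n s | aBil hn hs x.2 y.1 + aBil hn hs y.2 x.1 = 0} :=
    isClosed_eq (by fun_prop) continuous_const
  refine closure_minimal ?_ hcl hy
  rintro _ ⟨q, rfl⟩
  exact key x hx q

lemma aBil_self_of_mem_lieGraph (hn : 1 ≤ n)
    (hs : s - (n : ℝ) / 2 ∈ Set.Ioo (0 : ℝ) 1 ∪ Set.Ioo (1 : ℝ) 2) {e : Amb n}
    {x : Sob n s × Sob n s} (hx : x ∈ lieGraph hn s e) : aBil hn hs x.1 x.2 = 0 := by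
  have := aBil_of_mem_lieGraph hn hs hx hx
  rw [aBil_comm hn hs x.2 x.1] at this
  linarith

end LieInvariance

/-! ### The optimizers as a power series -/

section Coefficients

/-- The Taylor coefficients of `t ↦ (1 - t) ^ σ`. -/
def binCoeff (σ : ℝ) (k : ℕ) : ℝ := (-1) ^ k * Ring.choose σ k

lemma choose_succ_mul (σ : ℝ) (k : ℕ) :
    ((k : ℝ) + 1) * Ring.choose σ (k + 1) = (σ - k) * Ring.choose σ k := by
  rw [Ring.choose_eq_smul, Ring.choose_eq_smul, descPochhammer_succ_right, Polynomial.smeval_mul,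
    Nat.factorial_succ]
  have h : (Polynomial.X - (k : Polynomial ℤ)).smeval σ = σ - k := by
    simp [Polynomial.smeval_sub, Polynomial.smeval_natCast]
  rw [h]
  have : (k.factorial : ℝ) ≠ 0 := by positivity
  simp only [smul_eq_mul]
  push_cast
  field_simp

lemma binCoeff_zero (σ : ℝ) : binCoeff σ 0 = 1 := by simp [binCoeff]

lemma binCoeff_succ (σ : ℝ) (k : ℕ) :
    ((k : ℝ) + 1) * binCoeff σ (k + 1) = (k - σ) * binCoeff σ k := by
  have := choose_succ_mul σ k
  unfold binCoeff
  rw [pow_succ]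
  linear_combination (-(-1) ^ k) * this

/-- Successive ratios are |k − σ|/(k + 1), at most 1 for k ≥ 1; only the first, σ < 2, can exceed 1.
-/
lemma abs_binCoeff_le {σ : ℝ} (h0 : 0 < σ) (h2 : σ < 2) (k : ℕ) : |binCoeff σ k| ≤ 2 := by
  have hstep : ∀ k : ℕ, |binCoeff σ (k + 1)| = |(k : ℝ) - σ| / (k + 1) * |binCoeff σ k| := by
    intro k
    have hk : (0 : ℝ) < k + 1 := by positivity
    have := congrArg abs (binCoeff_succ σ k)
    rw [abs_mul, abs_mul, abs_of_pos hk] at this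
    field_simp
    linarith
  rcases k with _ | k
  · simp [binCoeff_zero]
  induction k with
  | zero =>
    rw [hstep 0]
    simp [binCoeff_zero, abs_of_pos h0, h2.le]
  | succ k ih =>
    rw [hstep (k + 1)]
    have hk : (0 : ℝ) ≤ k := k.cast_nonneg
    have h1 : |((k + 1 : ℕ) : ℝ) - σ| / ((k + 1 : ℕ) + 1) ≤ 1 := by
      rw [div_le_one (by positivity), abs_le]
      push_cast
      constructor <;> linarith
    calc _ ≤ 1 * |binCoeff σ (k + 1)| := by gcongr
      _ ≤ 2 := by linarith

lemma hasSum_binCoeff (σ : ℝ) {t : ℝ} (ht : |t| < 1) :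
    HasSum (fun k => binCoeff σ k * t ^ k) ((1 - t) ^ σ) := by
  have h := (Real.one_add_rpow_hasFPowerSeriesOnBall_zero (a := σ)).hasSum_sub (y := -t)
    (by simpa [edist_eq_enorm_sub, enorm_eq_nnnorm, ← NNReal.coe_lt_coe] using ht)
  simp only [sub_zero, binomialSeries_apply, List.ofFn_const, List.prod_replicate,
    smul_eq_mul] at h
  rw [sub_eq_add_neg]
  refine h.congr_fun fun k => ?_
  rw [binCoeff, neg_pow t k]; ring

end Coefficients

/-! ### The optimizers as an analytic map into H^s -/

section Series

variable {n : ℕ} {s : ℝ}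

instance (n : ℕ) : Nonempty (Sph n) := ⟨⟨EuclideanSpace.single 0 1, by simp⟩⟩

/-- Growth of the `H^s` norm of products of `k` linear forms. -/
def polyGrowth (n : ℕ) (s : ℝ) (k : ℕ) : ℝ :=
  (1 + lapEig n k ^ s) * ‖(ContinuousMap.toLp 2 (surf n) ℝ : C(Sph n, ℝ) →L[ℝ] L2 n)‖

lemma polyGrowth_nonneg (n : ℕ) (s : ℝ) (k : ℕ) : 0 ≤ polyGrowth n s k :=
  mul_nonneg (add_nonneg zero_le_one (Real.rpow_nonneg (lapEig_nonneg n k) s))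
    (ContinuousLinearMap.opNorm_nonneg _)

lemma summable_polyGrowth (hn : 1 ≤ n) (hs : 0 < s) {r : ℝ} (h0 : 0 < r) (h1 : r < 1) :
    Summable fun k : ℕ => ((k : ℝ) + 1) * polyGrowth n s k * r ^ k := by
  -- The eigenvalue grows quadratically in k, so its power s is bounded by a multiple of (k + 1)^M.
  set M := ⌈2 * s⌉₊ with hM
  set T := ‖(ContinuousMap.toLp 2 (surf n) ℝ : C(Sph n, ℝ) →L[ℝ] L2 n)‖ with hT
  have hn1 : (1 : ℝ) ≤ n := by exact_mod_cast hn
  have hbound : ∀ k : ℕ, 1 + lapEig n k ^ s ≤ 2 * (n : ℝ) ^ M * ((k : ℝ) + 1) ^ M := by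
    intro k
    have hk : (0 : ℝ) ≤ k := k.cast_nonneg
    have hb : (1 : ℝ) ≤ n * (k + 1) := by nlinarith
    have h2 : lapEig n k ≤ ((n : ℝ) * (k + 1)) ^ (2 : ℝ) := by
      rw [Real.rpow_two]
      unfold lapEig
      have e1 : (k : ℝ) ≤ n * (k + 1) := by nlinarith
      have e2 : (k : ℝ) + n - 1 ≤ n * (k + 1) := by nlinarith
      have e3 : 0 ≤ (k : ℝ) + n - 1 := by linarith
      nlinarith
    have h3 : lapEig n k ^ s ≤ ((n : ℝ) * (k + 1)) ^ M := by
      calc lapEig n k ^ s ≤ (((n : ℝ) * (k + 1)) ^ (2 : ℝ)) ^ s :=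
            Real.rpow_le_rpow (lapEig_nonneg n k) h2 hs.le
        _ = ((n : ℝ) * (k + 1)) ^ (2 * s) := by rw [← Real.rpow_mul (by linarith)]
        _ ≤ ((n : ℝ) * (k + 1)) ^ (M : ℝ) :=
            Real.rpow_le_rpow_of_exponent_le hb (Nat.le_ceil _)
        _ = _ := Real.rpow_natCast _ _
    have h4 : (1 : ℝ) ≤ ((n : ℝ) * (k + 1)) ^ M := one_le_pow₀ hb
    rw [mul_pow] at h3 h4
    linarith
  have hgeo : Summable fun k : ℕ => ((k : ℝ) + 1) ^ (M + 1) * r ^ k := by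
    have h := summable_pow_mul_geometric_of_norm_lt_one (M + 1) (r := r)
      (by rwa [Real.norm_of_nonneg h0.le])
    have h' := ((summable_nat_add_iff 1).mpr h).mul_left r⁻¹
    refine h'.congr fun k => ?_
    push_cast
    rw [pow_succ r k]
    field_simp
  refine Summable.of_nonneg_of_le
    (fun k => mul_nonneg (mul_nonneg (by positivity) (polyGrowth_nonneg n s k)) (by positivity))
    (fun k => ?_) (hgeo.mul_left (2 * (n : ℝ) ^ M * T))
  have := hbound k
  have hk : (0 : ℝ) ≤ k := k.cast_nonneg
  have hT0 : 0 ≤ T := ContinuousLinearMap.opNorm_nonneg _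
  calc ((k : ℝ) + 1) * polyGrowth n s k * r ^ k
      = ((k : ℝ) + 1) * T * r ^ k * (1 + lapEig n k ^ s) := by rw [polyGrowth]; ring
    _ ≤ ((k : ℝ) + 1) * T * r ^ k * (2 * (n : ℝ) ^ M * ((k : ℝ) + 1) ^ M) := by gcongr
    _ = _ := by ring

lemma norm_polyCont_linForm_le (ζ : Amb n) : ‖polyCont n (linForm n ζ)‖ ≤ ‖ζ‖ := by
  refine (ContinuousMap.norm_le _ (norm_nonneg _)).mpr fun ω => ?_
  rw [polyCont_linForm]
  simpa using norm_inner_le_norm (𝕜 := ℝ) ζ (ω : Amb n)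

lemma norm_polySob_prod_le (hn : 1 ≤ n) (hs : 0 < s) {k : ℕ} (v : Fin k → Amb n) :
    ‖polySob hn s (∏ i, linForm n (v i))‖ ≤ polyGrowth n s k * ∏ i, ‖v i‖ := by
  have h := norm_sq_polySob_le hn hs.le (prod_linForm_mem_harmUpTo hn v)
  set T := ‖(ContinuousMap.toLp 2 (surf n) ℝ : C(Sph n, ℝ) →L[ℝ] L2 n)‖ with hT
  have h2 : ‖restrictPoly n (∏ i, linForm n (v i))‖ ≤ T * ∏ i, ‖v i‖ := by
    rw [restrictPoly_apply]
    refine (ContinuousLinearMap.le_opNorm _ _).trans ?_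
    gcongr
    rw [map_prod]
    refine (Finset.norm_prod_le _ _).trans ?_
    exact Finset.prod_le_prod (fun i _ => norm_nonneg _) fun i _ => norm_polyCont_linForm_le _
  have hl : 0 ≤ lapEig n k ^ s := Real.rpow_nonneg (lapEig_nonneg n k) s
  rw [polyGrowth, mul_assoc]
  refine (sq_le_sq₀ (norm_nonneg _) (by positivity)).mp (h.trans ?_)
  rw [mul_pow]
  -- This crude bound avoids a square root and keeps the growth polynomial in k.
  have e1 : 1 + lapEig n k ^ s ≤ (1 + lapEig n k ^ s) ^ 2 := by nlinarith
  gcongr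

/-- The multilinear map `(v₁, …, v_k) ↦ (v₁ · x) ⋯ (v_k · x)` with values in `H^s`. -/
def polyMulti (hn : 1 ≤ n) (hs : 0 < s) (k : ℕ) :
    ContinuousMultilinearMap ℝ (fun _ : Fin k => Amb n) (Sob n s) :=
  ((polySob hn s).compMultilinearMap ((MultilinearMap.mkPiAlgebra ℝ (Fin k)
    (MvPolynomial (Fin (n + 1)) ℝ)).compLinearMap fun _ => linForm n)).mkContinuous
      (polyGrowth n s k) fun v => by simpa using norm_polySob_prod_le hn hs v

lemma polyMulti_apply (hn : 1 ≤ n) (hs : 0 < s) (k : ℕ) (v : Fin k → Amb n) :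
    polyMulti hn hs k v = polySob hn s (∏ i, linForm n (v i)) := by
  simp [polyMulti]

/-- The Taylor series at `0` of `ζ ↦ (1 - ζ · ω) ^ (s - n / 2)`, with values in `H^s`. -/
def bubbleSeries (hn : 1 ≤ n) (hs : 0 < s) : FormalMultilinearSeries ℝ (Amb n) (Sob n s) :=
  fun k => binCoeff (s - n / 2) k • polyMulti hn hs k

/-- The function `ω ↦ (1 - ζ · ω) ^ (s - n / 2)` as an element of `H^s`. -/
def bubble (hn : 1 ≤ n) (hs : 0 < s) (ζ : Amb n) : Sob n s := (bubbleSeries hn hs).sum ζ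

/-- Bounded binomial coefficients meet norms of polynomial growth in k, so every radius r < 1 is
admissible. -/
lemma one_le_radius_bubbleSeries (hn : 1 ≤ n)
    (hs : s - (n : ℝ) / 2 ∈ Set.Ioo (0 : ℝ) 1 ∪ Set.Ioo (1 : ℝ) 2) :
    1 ≤ (bubbleSeries hn (s_pos hs)).radius := by
  refine ENNReal.le_of_forall_nnreal_lt fun r hr => ?_
  have hr1 : (r : ℝ) < 1 := by exact_mod_cast hr
  rcases eq_or_ne r 0 with rfl | hr0
  · simp
  have hr0' : (0 : ℝ) < r := by positivity
  refine FormalMultilinearSeries.le_radius_of_summable_norm _ ?_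
  refine Summable.of_nonneg_of_le (fun k => by positivity) (fun k => ?_)
    ((summable_polyGrowth hn (s_pos hs) hr0' hr1).mul_left 2)
  have h1 : ‖bubbleSeries hn (s_pos hs) k‖ ≤ 2 * polyGrowth n s k := by
    rw [bubbleSeries, norm_smul]
    exact mul_le_mul (abs_binCoeff_le (order_pos hs) (order_lt_two hs) k)
      (MultilinearMap.mkContinuous_norm_le _ (polyGrowth_nonneg n s k) _) (norm_nonneg _)
      (by norm_num)
  have h2 := polyGrowth_nonneg n s k
  have hk : (0 : ℝ) ≤ k := k.cast_nonneg
  calc ‖bubbleSeries hn (s_pos hs) k‖ * (r : ℝ) ^ k ≤ 2 * polyGrowth n s k * (r : ℝ) ^ k := by gcongr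
    _ ≤ 2 * ((k + 1) * polyGrowth n s k) * (r : ℝ) ^ k := by
      gcongr
      nlinarith
    _ = _ := by ring

lemma hasFPowerSeriesOnBall_bubble (hn : 1 ≤ n)
    (hs : s - (n : ℝ) / 2 ∈ Set.Ioo (0 : ℝ) 1 ∪ Set.Ioo (1 : ℝ) 2) :
    HasFPowerSeriesOnBall (bubble hn (s_pos hs)) (bubbleSeries hn (s_pos hs)) 0 1 :=
  ((bubbleSeries hn (s_pos hs)).hasFPowerSeriesOnBall
    (zero_lt_one.trans_le (one_le_radius_bubbleSeries hn hs))).mono zero_lt_one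
    (one_le_radius_bubbleSeries hn hs)

lemma eball_zero_one_eq : Metric.eball (0 : Amb n) 1 = Metric.ball 0 1 := by
  have := Metric.eball_ofReal (x := (0 : Amb n)) (ε := 1)
  simpa using this

lemma analyticAt_bubble (hn : 1 ≤ n)
    (hs : s - (n : ℝ) / 2 ∈ Set.Ioo (0 : ℝ) 1 ∪ Set.Ioo (1 : ℝ) 2) {ζ : Amb n} (hζ : ‖ζ‖ < 1) :
    AnalyticAt ℝ (bubble hn (s_pos hs)) ζ :=
  (hasFPowerSeriesOnBall_bubble hn hs).analyticOnNhd ζ (by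
    rw [eball_zero_one_eq]; simpa using hζ)

lemma hasSum_bubble (hn : 1 ≤ n)
    (hs : s - (n : ℝ) / 2 ∈ Set.Ioo (0 : ℝ) 1 ∪ Set.Ioo (1 : ℝ) 2) {ζ : Amb n} (hζ : ‖ζ‖ < 1) :
    HasSum (fun k => binCoeff (s - n / 2) k • polySob hn s (linForm n ζ ^ k))
      (bubble hn (s_pos hs) ζ) := by
  have h := (hasFPowerSeriesOnBall_bubble hn hs).hasSum_sub (y := ζ)
    (by rw [eball_zero_one_eq]; simpa using hζ)
  simpa [bubbleSeries, polyMulti_apply] using h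

/-- The continuous function `ω ↦ (1 - ζ · ω) ^ σ`. -/
def bubbleCont {σ : ℝ} (hσ : 0 < σ) (ζ : Amb n) : C(Sph n, ℝ) where
  toFun ω := (1 - inner ℝ ζ (ω : Amb n)) ^ σ
  continuous_toFun := by
    refine Continuous.rpow_const (by fun_prop) fun _ => Or.inr hσ.le

lemma hasSum_bubbleCont {σ : ℝ} (h0 : 0 < σ) (h2 : σ < 2) {ζ : Amb n} (hζ : ‖ζ‖ < 1) :
    HasSum (fun k => binCoeff σ k • polyCont n (linForm n ζ ^ k)) (bubbleCont h0 ζ) := by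
  have hsum : Summable fun k => binCoeff σ k • polyCont n (linForm n ζ ^ k) := by
    refine Summable.of_norm_bounded
      ((summable_geometric_of_lt_one (norm_nonneg ζ) hζ).mul_left 2) fun k => ?_
    rw [norm_smul, map_pow]
    refine mul_le_mul (abs_binCoeff_le h0 h2 k) ?_ (norm_nonneg _) (by norm_num)
    exact (norm_pow_le _ k).trans (pow_le_pow_left₀ (norm_nonneg _) (norm_polyCont_linForm_le ζ) k)
  obtain ⟨f, hf⟩ := hsum
  convert hf
  ext ω
  have h1 := (ContinuousMap.evalCLM ℝ ω).hasSum hf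
  have hlt : |inner ℝ ζ (ω : Amb n)| < 1 := by
    refine (norm_inner_le_norm (𝕜 := ℝ) ζ (ω : Amb n)).trans_lt ?_
    simpa using hζ
  have h2 := hasSum_binCoeff σ hlt
  refine h2.unique ?_
  simpa [Function.comp_def, polyCont_linForm] using h1

/-- The same series converges in H^s and uniformly; its two sums have the same image in L². -/
lemma toL2_bubble (hn : 1 ≤ n)
    (hs : s - (n : ℝ) / 2 ∈ Set.Ioo (0 : ℝ) 1 ∪ Set.Ioo (1 : ℝ) 2) {ζ : Amb n} (hζ : ‖ζ‖ < 1) :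
    (bubble hn (s_pos hs) ζ).toL2 =
      ContinuousMap.toLp 2 (surf n) ℝ (bubbleCont (order_pos hs) ζ) := by
  have h1 := (Sob.toL2CLM n s).hasSum (hasSum_bubble hn hs hζ)
  have h2 := (ContinuousMap.toLp 2 (surf n) ℝ : C(Sph n, ℝ) →L[ℝ] L2 n).hasSum
    (hasSum_bubbleCont (order_pos hs) (order_lt_two hs) hζ)
  refine h1.unique (h2.congr_fun fun k => ?_)
  simp only [map_smul]
  rfl

end Series

/-! ### The optimizers along a ray -/

section PowerSeries

variable {F : Type*} [NormedAddCommGroup F] [NormedSpace ℝ F]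

/-- Used both in H^s and in the continuous functions, so that the abstract radial derivative in H^s
can be recognized as an explicit function. -/
lemma hasDerivAt_powerSeries [CompleteSpace F] {v : ℕ → F}
    (hv : ∀ ρ : ℝ, 0 < ρ → ρ < 1 → Summable fun k : ℕ => ((k : ℝ) + 1) * ‖v k‖ * ρ ^ k)
    {r : ℝ} (hr : |r| < 1) :
    HasDerivAt (fun r : ℝ => ∑' k : ℕ, r ^ k • v k) (∑' k : ℕ, ((k : ℝ) * r ^ (k - 1)) • v k) r ∧
      Summable fun k : ℕ => ((k : ℝ) * r ^ (k - 1)) • v k := by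
  obtain ⟨ρ, h1, h2⟩ := exists_between hr
  have hρ : 0 < ρ := (abs_nonneg r).trans_lt h1
  have hu : Summable fun k : ℕ => ρ⁻¹ * (((k : ℝ) + 1) * ‖v k‖ * ρ ^ k) :=
    (hv ρ hρ h2).mul_left _
  have hbd : ∀ (k : ℕ) (y : ℝ), y ∈ Set.Ioo (-ρ) ρ →
      ‖((k : ℝ) * y ^ (k - 1)) • v k‖ ≤ ρ⁻¹ * (((k : ℝ) + 1) * ‖v k‖ * ρ ^ k) := by
    intro k y hy
    have hy' : |y| ≤ ρ := abs_le.mpr ⟨hy.1.le, hy.2.le⟩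
    rcases k with _ | k
    · simp; positivity
    · rw [norm_smul, norm_mul, Real.norm_natCast, Real.norm_eq_abs, abs_pow, Nat.add_sub_cancel]
      calc ((k + 1 : ℕ) : ℝ) * |y| ^ k * ‖v (k + 1)‖
          ≤ (((k + 1 : ℕ) : ℝ) + 1) * ρ ^ k * ‖v (k + 1)‖ := by gcongr; linarith
        _ = _ := by rw [pow_succ]; field_simp
  have hr1 : r ∈ Set.Ioo (-ρ) ρ := abs_lt.mp h1
  refine ⟨hasDerivAt_tsum_of_isPreconnected (t := Set.Ioo (-ρ) ρ) (y₀ := 0)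
    (g := fun k y => y ^ k • v k) (g' := fun k y => ((k : ℝ) * y ^ (k - 1)) • v k)
    hu isOpen_Ioo isPreconnected_Ioo (fun k y _ => (hasDerivAt_pow k y).smul_const (v k)) hbd
    ⟨by linarith, hρ⟩ ?_ hr1, ?_⟩
  · refine summable_of_ne_finset_zero (s := {0}) fun k hk => ?_
    have : k ≠ 0 := by simpa using hk
    simp [this]
  · exact Summable.of_norm_bounded hu fun k => hbd k r hr1

/-- Velocities of curves in a closed subspace belong to it. -/
lemma mem_of_hasDerivAt {S : Submodule ℝ F} (hS : IsClosed (S : Set F)) {f : ℝ → F} {f' : F}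
    {r : ℝ} (hf : HasDerivAt f f' r) (hmem : ∀ᶠ t in 𝓝 r, f t ∈ S) : f' ∈ S := by
  have h := hasDerivAt_iff_tendsto_slope.mp hf
  refine hS.mem_of_tendsto h ?_
  filter_upwards [nhdsWithin_le_nhds hmem] with t ht
  rw [slope_def_module]
  exact S.smul_mem _ (S.sub_mem ht hmem.self_of_nhds)

end PowerSeries

/-! ### Radial derivatives of the optimizers and their conformal images -/

section Ray

variable {n : ℕ} {s : ℝ}

lemma linForm_smul_pow (e : Amb n) (r : ℝ) (k : ℕ) :
    linForm n (r • e) ^ k = r ^ k • linForm n e ^ k := by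
  rw [map_smul, smul_pow]

lemma norm_smul_lt_one {e : Amb n} (he : ‖e‖ = 1) {r : ℝ} (hr : |r| < 1) : ‖r • e‖ < 1 := by
  rwa [norm_smul, he, mul_one, Real.norm_eq_abs]

lemma norm_polySob_pow_le (hn : 1 ≤ n) (hs : 0 < s) {e : Amb n} (he : ‖e‖ = 1) (k : ℕ) :
    ‖polySob hn s (linForm n e ^ k)‖ ≤ polyGrowth n s k := by
  have := norm_polySob_prod_le hn hs (fun _ : Fin k => e)
  simpa [he] using this

/-- The radial derivative of the optimizers. -/
def bubbleDeriv (hn : 1 ≤ n) (hs : 0 < s) (e : Amb n) (r : ℝ) : Sob n s :=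
  fderiv ℝ (bubble hn hs) (r • e) e

lemma hasDerivAt_bubble (hn : 1 ≤ n)
    (hs : s - (n : ℝ) / 2 ∈ Set.Ioo (0 : ℝ) 1 ∪ Set.Ioo (1 : ℝ) 2) {e : Amb n} (he : ‖e‖ = 1)
    {r : ℝ} (hr : |r| < 1) :
    HasDerivAt (fun r : ℝ => bubble hn (s_pos hs) (r • e)) (bubbleDeriv hn (s_pos hs) e r) r := by
  have h1 := (analyticAt_bubble hn hs (norm_smul_lt_one he hr)).differentiableAt.hasFDerivAt
  have h2 : HasDerivAt (fun r : ℝ => r • e) e r := by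
    simpa using (hasDerivAt_id r).smul_const e
  exact h1.comp_hasDerivAt r h2

lemma differentiableAt_bubbleDeriv (hn : 1 ≤ n)
    (hs : s - (n : ℝ) / 2 ∈ Set.Ioo (0 : ℝ) 1 ∪ Set.Ioo (1 : ℝ) 2) {e : Amb n} (he : ‖e‖ = 1)
    {r : ℝ} (hr : |r| < 1) : DifferentiableAt ℝ (bubbleDeriv hn (s_pos hs) e) r := by
  have h1 := (analyticAt_bubble hn hs (norm_smul_lt_one he hr)).fderiv.differentiableAt
  have h2 : DifferentiableAt ℝ (fun r : ℝ => r • e) r := by fun_prop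
  have h3 : DifferentiableAt ℝ (fun r : ℝ => fderiv ℝ (bubble hn (s_pos hs)) (r • e)) r :=
    h1.comp r h2
  exact h3.clm_apply (differentiableAt_const e)

lemma hasSum_bubble_ray (hn : 1 ≤ n)
    (hs : s - (n : ℝ) / 2 ∈ Set.Ioo (0 : ℝ) 1 ∪ Set.Ioo (1 : ℝ) 2) {e : Amb n} (he : ‖e‖ = 1)
    {r : ℝ} (hr : |r| < 1) :
    HasSum (fun k : ℕ => r ^ k • binCoeff (s - n / 2) k • polySob hn s (linForm n e ^ k))
      (bubble hn (s_pos hs) (r • e)) := by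
  refine (hasSum_bubble hn hs (norm_smul_lt_one he hr)).congr_fun fun k => ?_
  rw [linForm_smul_pow, map_smul, smul_comm]

lemma hasSum_bubbleDeriv (hn : 1 ≤ n)
    (hs : s - (n : ℝ) / 2 ∈ Set.Ioo (0 : ℝ) 1 ∪ Set.Ioo (1 : ℝ) 2) {e : Amb n} (he : ‖e‖ = 1)
    {r : ℝ} (hr : |r| < 1) :
    HasSum (fun k : ℕ => ((k : ℝ) * r ^ (k - 1)) • binCoeff (s - n / 2) k •
      polySob hn s (linForm n e ^ k)) (bubbleDeriv hn (s_pos hs) e r) := by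
  obtain ⟨h1, h2⟩ := hasDerivAt_powerSeries
    (v := fun k => binCoeff (s - n / 2) k • polySob hn s (linForm n e ^ k)) (fun ρ h0 h1 => by
      refine Summable.of_nonneg_of_le (fun k => by positivity) (fun k => ?_)
        ((summable_polyGrowth hn (s_pos hs) h0 h1).mul_left 2)
      have hb := abs_binCoeff_le (order_pos hs) (order_lt_two hs) k
      have hp := norm_polySob_pow_le hn (s_pos hs) he k
      rw [norm_smul, Real.norm_eq_abs]
      calc _ ≤ ((k : ℝ) + 1) * (2 * polyGrowth n s k) * ρ ^ k := by gcongr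
        _ = _ := by ring) hr
  have h3 : HasDerivAt (fun r : ℝ => ∑' k : ℕ, r ^ k • binCoeff (s - n / 2) k •
      polySob hn s (linForm n e ^ k)) (bubbleDeriv hn (s_pos hs) e r) r := by
    refine (hasDerivAt_bubble hn hs he hr).congr_of_eventuallyEq ?_
    have : ∀ᶠ t : ℝ in 𝓝 r, |t| < 1 := continuous_abs.continuousAt.eventually_lt_const hr
    filter_upwards [this] with t ht
    exact (hasSum_bubble_ray hn hs he ht).tsum_eq
  rw [h3.unique h1]
  exact h2.hasSum

/-- The continuous function `ω ↦ -σ (e · ω) (1 - r e · ω) ^ (σ - 1)`. -/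
def bubbleDerivCont (σ : ℝ) (e : Amb n) (he : ‖e‖ = 1) {r : ℝ} (hr : |r| < 1) : C(Sph n, ℝ) where
  toFun ω := -σ * inner ℝ e (ω : Amb n) * (1 - r * inner ℝ e (ω : Amb n)) ^ (σ - 1)
  continuous_toFun := by
    refine Continuous.mul (by fun_prop) (Continuous.rpow_const (by fun_prop) fun ω => Or.inl ?_)
    have h : |inner ℝ e (ω : Amb n)| ≤ 1 := by
      simpa [he] using norm_inner_le_norm (𝕜 := ℝ) e (ω : Amb n)
    have h2 : |r * inner ℝ e (ω : Amb n)| < 1 := by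
      rw [abs_mul]; exact (mul_le_of_le_one_right (abs_nonneg r) h).trans_lt hr
    have := (abs_lt.mp h2).2
    exact (by linarith : (0 : ℝ) < 1 - r * inner ℝ e (ω : Amb n)).ne'

lemma abs_inner_sphere_le (ζ : Amb n) (ω : Sph n) : |inner ℝ ζ (ω : Amb n)| ≤ ‖ζ‖ := by
  simpa using norm_inner_le_norm (𝕜 := ℝ) ζ (ω : Amb n)

lemma hasSum_bubbleDerivCont {σ : ℝ} (h0 : 0 < σ) (h2 : σ < 2) {e : Amb n} (he : ‖e‖ = 1)
    {r : ℝ} (hr : |r| < 1) :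
    HasSum (fun k : ℕ => ((k : ℝ) * r ^ (k - 1)) • binCoeff σ k • polyCont n (linForm n e ^ k))
      (bubbleDerivCont σ e he hr) := by
  obtain ⟨h1, hs⟩ := hasDerivAt_powerSeries
    (v := fun k => binCoeff σ k • polyCont n (linForm n e ^ k)) (fun ρ hρ0 hρ1 => by
      have hgeo := (summable_pow_mul_geometric_of_norm_lt_one 1 (r := ρ)
        (by rwa [Real.norm_of_nonneg hρ0.le])).add
        (summable_geometric_of_lt_one hρ0.le hρ1)
      refine Summable.of_nonneg_of_le (fun k => by positivity) (fun k => ?_) (hgeo.mul_left 2)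
      have hb := abs_binCoeff_le h0 h2 k
      have hp : ‖polyCont n (linForm n e ^ k)‖ ≤ 1 := by
        rw [map_pow]
        refine (norm_pow_le _ k).trans (pow_le_one₀ (norm_nonneg _) ?_)
        exact (norm_polyCont_linForm_le e).trans he.le
      rw [norm_smul, Real.norm_eq_abs]
      calc _ ≤ ((k : ℝ) + 1) * (2 * 1) * ρ ^ k := by gcongr
        _ = _ := by ring) hr
  suffices h : bubbleDerivCont σ e he hr =
      ∑' k : ℕ, ((k : ℝ) * r ^ (k - 1)) • binCoeff σ k • polyCont n (linForm n e ^ k) by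
    rw [h]; exact hs.hasSum
  ext ω
  let L : C(Sph n, ℝ) →L[ℝ] ℝ := ContinuousMap.evalCLM ℝ ω
  have h3 := L.hasFDerivAt.comp_hasDerivAt r h1
  set t := inner ℝ e (ω : Amb n) with ht
  have habs : |t| ≤ 1 := by simpa [he] using abs_inner_sphere_le e ω
  have hlt : ∀ r : ℝ, |r| < 1 → |r * t| < 1 := fun r hr => by
    rw [abs_mul]; exact (mul_le_of_le_one_right (abs_nonneg r) habs).trans_lt hr
  have hpos : 0 < 1 - r * t := by have := (abs_lt.mp (hlt r hr)).2; linarith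
  have h4 : HasDerivAt (fun r : ℝ => (1 - r * t) ^ σ) (-t * σ * (1 - r * t) ^ (σ - 1)) r := by
    have := ((hasDerivAt_id r).mul_const t).const_sub 1
    simpa using this.rpow_const (p := σ) (Or.inl hpos.ne')
  have h5 : HasDerivAt (L ∘ fun r : ℝ =>
      ∑' k : ℕ, r ^ k • binCoeff σ k • polyCont n (linForm n e ^ k))
      (-t * σ * (1 - r * t) ^ (σ - 1)) r := by
    refine h4.congr_of_eventuallyEq ?_
    have : ∀ᶠ r' : ℝ in 𝓝 r, |r'| < 1 := continuous_abs.continuousAt.eventually_lt_const hr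
    filter_upwards [this] with r' hr'
    have h6 := hasSum_bubbleCont h0 h2 (norm_smul_lt_one he hr')
    have h7 : (∑' k : ℕ, r' ^ k • binCoeff σ k • polyCont n (linForm n e ^ k)) =
        bubbleCont h0 (r' • e) := by
      rw [← h6.tsum_eq]
      refine tsum_congr fun k => ?_
      rw [linForm_smul_pow, map_smul, smul_comm]
    rw [Function.comp_apply, h7]
    change (1 - inner ℝ (r' • e) (ω : Amb n)) ^ σ = _
    rw [real_inner_smul_left]
  have h8 := h5.unique h3
  change -σ * t * (1 - r * t) ^ (σ - 1) = _
  rw [show -σ * t * (1 - r * t) ^ (σ - 1) = -t * σ * (1 - r * t) ^ (σ - 1) by ring, h8]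
  rfl

lemma toL2_bubbleDeriv (hn : 1 ≤ n)
    (hs : s - (n : ℝ) / 2 ∈ Set.Ioo (0 : ℝ) 1 ∪ Set.Ioo (1 : ℝ) 2) {e : Amb n} (he : ‖e‖ = 1)
    {r : ℝ} (hr : |r| < 1) : (bubbleDeriv hn (s_pos hs) e r).toL2 =
      ContinuousMap.toLp 2 (surf n) ℝ (bubbleDerivCont (s - n / 2) e he hr) := by
  have h1 := (Sob.toL2CLM n s).hasSum (hasSum_bubbleDeriv hn hs he hr)
  have h2 := (ContinuousMap.toLp 2 (surf n) ℝ : C(Sph n, ℝ) →L[ℝ] L2 n).hasSum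
    (hasSum_bubbleDerivCont (order_pos hs) (order_lt_two hs) he hr)
  refine h1.unique (h2.congr_fun fun k => ?_)
  simp only [map_smul]
  rfl

/-- The image of an optimizer under the infinitesimal conformal transformation along the ray. -/
def bubbleLie (hn : 1 ≤ n) (hs : 0 < s) (e : Amb n) (r : ℝ) : Sob n s :=
  -((1 - r ^ 2) • bubbleDeriv hn hs e r) - (r * (s - n / 2)) • bubble hn hs (r • e)

/-- Termwise, L sends t^k to k t^(k−1) + (σ − k)t^(k+1), where t = e·ω. By the recursion for
`binCoeff` the lowering parts sum to r²φ′ − rσφ and the raising parts to −φ′. Partial sums lie in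
the graph and converge in both components. -/
lemma bubble_mem_lieGraph (hn : 1 ≤ n)
    (hs : s - (n : ℝ) / 2 ∈ Set.Ioo (0 : ℝ) 1 ∪ Set.Ioo (1 : ℝ) 2) {e : Amb n} (he : ‖e‖ = 1)
    {r : ℝ} (hr : |r| < 1) :
    (bubble hn (s_pos hs) (r • e), bubbleLie hn (s_pos hs) e r) ∈ lieGraph hn s e := by
  set σ := s - (n : ℝ) / 2 with hσ
  set b := binCoeff σ with hb
  set v : ℕ → Sob n s := fun k => polySob hn s (linForm n e ^ k) with hv
  have h0 : HasSum (fun k : ℕ => r ^ k • b k • v k) (bubble hn (s_pos hs) (r • e)) :=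
    hasSum_bubble_ray hn hs he hr
  have h1 : HasSum (fun k : ℕ => ((k : ℝ) * r ^ (k - 1)) • b k • v k)
    (bubbleDeriv hn (s_pos hs) e r) := hasSum_bubbleDeriv hn hs he hr
  have hlow : HasSum (fun k : ℕ => (r ^ k * b k * k) • v (k - 1))
      (r ^ 2 • bubbleDeriv hn (s_pos hs) e r - (r * σ) • bubble hn (s_pos hs) (r • e)) := by
    refine (hasSum_nat_add_iff' 1).mp ?_
    simp only [Finset.range_one, Finset.sum_singleton, Nat.cast_zero, mul_zero, zero_smul, sub_zero]
    refine ((h1.const_smul (r ^ 2)).sub (h0.const_smul (r * σ))).congr_fun fun k => ?_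
    simp only [smul_smul, ← sub_smul, Nat.add_sub_cancel]
    congr 1
    have := binCoeff_succ σ k
    -- The exponent k − 1 is truncated at k = 0.
    rcases k with _ | k
    · simp only [pow_zero]
      push_cast at this ⊢
      linear_combination r * this
    · rw [Nat.add_sub_cancel]
      push_cast at this ⊢
      linear_combination (r ^ (k + 2)) * this
  have hhigh : HasSum (fun k : ℕ => (r ^ k * b k * (σ - k)) • v (k + 1))
      (-bubbleDeriv hn (s_pos hs) e r) := by
    have h1' := (hasSum_nat_add_iff' 1).mpr h1
    simp only [Finset.range_one, Finset.sum_singleton, Nat.cast_zero, zero_mul, zero_smul,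
      sub_zero] at h1'
    refine h1'.neg.congr_fun fun k => ?_
    simp only [smul_smul, ← neg_smul, Nat.add_sub_cancel]
    congr 1
    have := binCoeff_succ σ k
    push_cast
    linear_combination (r ^ k) * this
  have hlie : HasSum (fun k : ℕ => r ^ k • b k • polySob hn s (lieOp e σ (linForm n e ^ k)))
      (bubbleLie hn (s_pos hs) e r) := by
    have : bubbleLie hn (s_pos hs) e r =
        (r ^ 2 • bubbleDeriv hn (s_pos hs) e r - (r * σ) • bubble hn (s_pos hs) (r • e)) +
          -bubbleDeriv hn (s_pos hs) e r := by
      rw [bubbleLie, sub_smul, one_smul]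
      abel
    rw [this]
    refine (hlow.add hhigh).congr_fun fun k => ?_
    rw [lieOp_linForm_pow he, map_add, map_smul, map_smul, smul_add, smul_add]
    simp only [smul_smul, hv]
    congr 2 <;> ring
  refine (isClosed_lieGraph hn s e).mem_of_tendsto (h0.prodMk hlie)
    (Eventually.of_forall fun S => ?_)
  refine Submodule.sum_mem _ fun k _ => ?_
  have := Submodule.smul_mem _ (r ^ k) (Submodule.smul_mem _ (b k)
    (polySob_mem_lieGraph hn s e (linForm n e ^ k)))
  exact this

end Ray

/-! ### Uniform bounds near the boundary of the ball -/

section UniformBound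

variable {n : ℕ} {s : ℝ}

lemma abs_sub_le_one_sub_mul {r t : ℝ} (hr : |r| ≤ 1) (ht : |t| ≤ 1) : |t - r| ≤ 1 - r * t := by
  obtain ⟨h1, h2⟩ := abs_le.mp hr
  obtain ⟨h3, h4⟩ := abs_le.mp ht
  rw [abs_le]
  constructor <;> nlinarith

/-- With t = e·ω the function is σ(1 − rt)^(σ−1)(t − r). Since |t − r| ≤ 1 − rt, the possible
singularity of the power is compensated and the modulus is at most σ2^σ. -/
lemma exists_norm_toL2_bubbleLie_le (hn : 1 ≤ n)
    (hs : s - (n : ℝ) / 2 ∈ Set.Ioo (0 : ℝ) 1 ∪ Set.Ioo (1 : ℝ) 2) :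
    ∃ C : ℝ, ∀ e : Amb n, ‖e‖ = 1 → ∀ r : ℝ, |r| < 1 →
      ‖(bubbleLie hn (s_pos hs) e r).toL2‖ ≤ C := by
  have hσ := order_pos hs
  set σ := s - (n : ℝ) / 2
  refine ⟨‖(ContinuousMap.toLp 2 (surf n) ℝ : C(Sph n, ℝ) →L[ℝ] L2 n)‖ * (σ * 2 ^ σ),
    fun e he r hr => ?_⟩
  have heq : (bubbleLie hn (s_pos hs) e r).toL2 = ContinuousMap.toLp 2 (surf n) ℝ
      (-((1 - r ^ 2) • bubbleDerivCont σ e he hr) - (r * σ) • bubbleCont hσ (r • e)) := by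
    rw [bubbleLie, map_sub, map_neg, map_smul, map_smul, toL2_bubbleDeriv hn hs he hr,
      toL2_bubble hn hs (norm_smul_lt_one he hr), map_sub, map_neg, map_smul, map_smul]
  rw [heq]
  refine (ContinuousLinearMap.le_opNorm _ _).trans ?_
  refine mul_le_mul_of_nonneg_left ?_ (ContinuousLinearMap.opNorm_nonneg _)
  refine (ContinuousMap.norm_le _ (by positivity)).mpr fun ω => ?_
  change ‖-((1 - r ^ 2) * (-σ * inner ℝ e (ω : Amb n) *
    (1 - r * inner ℝ e (ω : Amb n)) ^ (σ - 1))) -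
    (r * σ) * (1 - inner ℝ (r • e) (ω : Amb n)) ^ σ‖ ≤ _
  rw [real_inner_smul_left]
  have habs : |inner ℝ e (ω : Amb n)| ≤ 1 := by simpa [he] using abs_inner_sphere_le e ω
  set t := inner ℝ e (ω : Amb n)
  have hrt : |r * t| < 1 := by
    rw [abs_mul]; exact (mul_le_of_le_one_right (abs_nonneg r) habs).trans_lt hr
  have hpos : 0 < 1 - r * t := by have := (abs_lt.mp hrt).2; linarith
  have hle2 : 1 - r * t ≤ 2 := by have := (abs_lt.mp hrt).1; linarith
  have hpow : (1 - r * t) ^ σ = (1 - r * t) ^ (σ - 1) * (1 - r * t) := by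
    rw [← Real.rpow_add_one hpos.ne']; congr 1; ring
  have hval : -((1 - r ^ 2) * (-σ * t * (1 - r * t) ^ (σ - 1))) - (r * σ) * (1 - r * t) ^ σ =
      σ * ((1 - r * t) ^ (σ - 1) * (t - r)) := by
    rw [hpow]; ring
  have hnn : 0 ≤ (1 - r * t) ^ (σ - 1) := Real.rpow_nonneg hpos.le _
  rw [hval, Real.norm_eq_abs, abs_mul, abs_of_pos hσ, abs_mul, abs_of_nonneg hnn]
  gcongr
  calc (1 - r * t) ^ (σ - 1) * |t - r| ≤ (1 - r * t) ^ (σ - 1) * (1 - r * t) := by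
        gcongr; exact abs_sub_le_one_sub_mul hr.le habs
    _ = (1 - r * t) ^ σ := hpow.symm
    _ ≤ 2 ^ σ := Real.rpow_le_rpow hpos.le hle2 hσ.le

lemma differentiableAt_bubbleLie (hn : 1 ≤ n)
    (hs : s - (n : ℝ) / 2 ∈ Set.Ioo (0 : ℝ) 1 ∪ Set.Ioo (1 : ℝ) 2) {e : Amb n} (he : ‖e‖ = 1)
    {r : ℝ} (hr : |r| < 1) : DifferentiableAt ℝ (bubbleLie hn (s_pos hs) e) r := by
  have h1 := differentiableAt_bubbleDeriv hn hs he hr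
  have h2 := (hasDerivAt_bubble hn hs he hr).differentiableAt
  unfold bubbleLie
  have h3 : DifferentiableAt ℝ (fun r : ℝ => 1 - r ^ 2) r := by fun_prop
  have h4 : DifferentiableAt ℝ (fun r : ℝ => r * (s - n / 2)) r := by fun_prop
  exact ((h3.smul h1).neg).sub (h4.smul h2)

/-- Differentiating (φ, w) along the ray gives (φ′, w′), still in the closed graph. The combination
of the two pairs that has w in its first slot satisfies a[w, Lw] = 0. -/
lemma aBil_bubbleLie_deriv (hn : 1 ≤ n)
    (hs : s - (n : ℝ) / 2 ∈ Set.Ioo (0 : ℝ) 1 ∪ Set.Ioo (1 : ℝ) 2) {e : Amb n} (he : ‖e‖ = 1)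
    {r : ℝ} (hr : |r| < 1) :
    (1 - r ^ 2) * aBil hn hs (bubbleLie hn (s_pos hs) e r)
      (deriv (bubbleLie hn (s_pos hs) e) r) =
      -(r * (s - n / 2)) * aBil hn hs (bubbleLie hn (s_pos hs) e r)
        (bubbleLie hn (s_pos hs) e r) := by
  have h1 := hasDerivAt_bubble hn hs he hr
  have h2 := (differentiableAt_bubbleLie hn hs he hr).hasDerivAt
  have hnear : ∀ᶠ t : ℝ in 𝓝 r, |t| < 1 := continuous_abs.continuousAt.eventually_lt_const hr
  have hmem := bubble_mem_lieGraph hn hs he hr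
  have hmem' : (bubbleDeriv hn (s_pos hs) e r, deriv (bubbleLie hn (s_pos hs) e) r) ∈
      lieGraph hn s e :=
    mem_of_hasDerivAt (isClosed_lieGraph hn s e) (h1.prodMk h2)
      (hnear.mono fun t ht => bubble_mem_lieGraph hn hs he ht)
  have hcomb := Submodule.sub_mem _ (Submodule.neg_mem _ (Submodule.smul_mem _ (1 - r ^ 2) hmem'))
    (Submodule.smul_mem _ (r * (s - n / 2)) hmem)
  have h0 := aBil_self_of_mem_lieGraph hn hs hcomb
  change aBil hn hs (bubbleLie hn (s_pos hs) e r)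
    (-((1 - r ^ 2) • deriv (bubbleLie hn (s_pos hs) e) r) -
      (r * (s - n / 2)) • bubbleLie hn (s_pos hs) e r) = 0 at h0
  simp only [map_sub, map_neg, map_smul, smul_eq_mul] at h0
  linarith

/-- Thus (1 − r²) times the derivative of a[w, w] equals −2rσ a[w, w]. The sign of a[w, w] being
unknown, monotonicity is proved for its square. -/
lemma abs_aBil_bubbleLie_le (hn : 1 ≤ n)
    (hs : s - (n : ℝ) / 2 ∈ Set.Ioo (0 : ℝ) 1 ∪ Set.Ioo (1 : ℝ) 2) {e : Amb n} (he : ‖e‖ = 1)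
    {r : ℝ} (h0 : 0 ≤ r) (hr : r < 1) :
    |aBil hn hs (bubbleLie hn (s_pos hs) e r) (bubbleLie hn (s_pos hs) e r)| ≤
      |aBil hn hs (bubbleLie hn (s_pos hs) e 0) (bubbleLie hn (s_pos hs) e 0)| := by
  set w := bubbleLie hn (s_pos hs) e with hw
  set A := aBil hn hs
  have habs : ∀ t ∈ Set.Ico (0 : ℝ) 1, |t| < 1 := fun t ht => by
    rw [abs_of_nonneg ht.1]; exact ht.2
  have hder : ∀ t ∈ Set.Ico (0 : ℝ) 1,
      HasDerivAt (fun t => (A (w t) (w t)) ^ 2) (4 * A (w t) (w t) * A (w t) (deriv w t)) t := by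
    intro t ht
    have h1 := (differentiableAt_bubbleLie hn hs he (habs t ht)).hasDerivAt
    have h2 : HasDerivAt (fun t => A (w t) (w t)) (A (deriv w t) (w t) + A (w t) (deriv w t)) t :=
      (A.hasFDerivAt.comp_hasDerivAt t h1).clm_apply h1
    refine (h2.fun_pow 2).congr_deriv ?_
    rw [aBil_comm hn hs (deriv w t) (w t)]
    push_cast
    ring
  have hanti : AntitoneOn (fun t => (A (w t) (w t)) ^ 2) (Set.Ico 0 1) := by
    refine antitoneOn_of_deriv_nonpos (convex_Ico 0 1)
      (fun t ht => (hder t ht).continuousAt.continuousWithinAt)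
      (fun t ht => (hder t (interior_subset ht)).differentiableAt.differentiableWithinAt)
      fun t ht => ?_
    have ht' := interior_subset ht
    rw [(hder t ht').deriv]
    have hpos : 0 < 1 - t ^ 2 := by nlinarith [ht'.1, ht'.2]
    have hkey := aBil_bubbleLie_deriv hn hs he (habs t ht')
    have : (1 - t ^ 2) * (4 * A (w t) (w t) * A (w t) (deriv w t)) =
        -(4 * (t * (s - n / 2)) * (A (w t) (w t)) ^ 2) := by
      linear_combination (4 * A (w t) (w t)) * hkey
    have hnn : 0 ≤ 4 * (t * (s - n / 2)) * (A (w t) (w t)) ^ 2 := by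
      have := order_pos hs
      have := ht'.1
      positivity
    by_contra hcon
    push Not at hcon
    have := mul_pos hpos hcon
    linarith
  have := hanti ⟨le_rfl, zero_lt_one⟩ ⟨h0, hr⟩ h0
  exact sq_le_sq.mp this

/-- The infinitesimal conformal images of the optimizers are bounded in `H^s`. -/
lemma exists_norm_bubbleLie_le (hn : 1 ≤ n)
    (hs : s - (n : ℝ) / 2 ∈ Set.Ioo (0 : ℝ) 1 ∪ Set.Ioo (1 : ℝ) 2) :
    ∃ C : ℝ, 0 < C ∧ ∀ e : Amb n, ‖e‖ = 1 → ∀ r : ℝ, 0 ≤ r → r < 1 →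
      ‖bubbleLie hn (s_pos hs) e r‖ ≤ C := by
  obtain ⟨C, D, hC, hD, hCD⟩ := exists_norm_sq_le hn hs
  obtain ⟨T, hT⟩ := exists_norm_toL2_bubbleLie_le hn hs
  set N := ‖fderiv ℝ (bubble hn (s_pos hs)) 0‖ with hN
  -- The summand 1 gives K ≥ 1, so that ‖w‖² ≤ K yields ‖w‖ ≤ K.
  set K := C * (‖aBil hn hs‖ * N * N) + D * T ^ 2 + 1 with hK
  have hN0 : 0 ≤ N := ContinuousLinearMap.opNorm_nonneg _
  have hA0 : 0 ≤ ‖aBil hn hs‖ := ContinuousLinearMap.opNorm_nonneg _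
  refine ⟨K, by positivity, fun e he r h0 hr => ?_⟩
  have hr' : |r| < 1 := by rwa [abs_of_nonneg h0]
  -- Gårding's inequality turns the L² bound and the bound on the form into an H^s bound uniform in
  -- r < 1.
  have h1 := hCD (bubbleLie hn (s_pos hs) e r)
  have h2 := (le_abs_self _).trans (abs_aBil_bubbleLie_le hn hs he h0 hr)
  have h3 : ‖bubbleLie hn (s_pos hs) e 0‖ ≤ N := by
    have : bubbleLie hn (s_pos hs) e 0 = -fderiv ℝ (bubble hn (s_pos hs)) 0 e := by
      simp [bubbleLie, bubbleDeriv]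
    rw [this, norm_neg]
    have := (fderiv ℝ (bubble hn (s_pos hs)) 0).le_opNorm e
    rwa [he, mul_one] at this
  have h4 : |aBil hn hs (bubbleLie hn (s_pos hs) e 0) (bubbleLie hn (s_pos hs) e 0)| ≤
      ‖aBil hn hs‖ * N * N := by
    refine ((aBil hn hs).le_opNorm₂ _ _).trans ?_
    gcongr
  have h5 : ‖(bubbleLie hn (s_pos hs) e r).toL2‖ ^ 2 ≤ T ^ 2 := by
    gcongr; exact hT e he r hr'
  have h6 : ‖bubbleLie hn (s_pos hs) e r‖ ^ 2 ≤ K := by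
    have e1 := mul_le_mul_of_nonneg_left (h2.trans h4) hC.le
    have e2 := mul_le_mul_of_nonneg_left h5 hD.le
    linarith
  have hK1 : 1 ≤ K := by
    have : 0 ≤ C * (‖aBil hn hs‖ * N * N) + D * T ^ 2 := by positivity
    linarith
  nlinarith [norm_nonneg (bubbleLie hn (s_pos hs) e r)]

end UniformBound

/-! ### First moments of the optimizers -/

section Moment

variable {n : ℕ}

instance (n : ℕ) : (surf n).IsOpenPosMeasure := by unfold surf; infer_instance

/-- The moment of `(1 - ζ · ω) ^ σ` in direction `ζ`. -/
def moment (n : ℕ) (σ : ℝ) (ζ : Amb n) : ℝ :=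
  ∫ ω : Sph n, inner ℝ ζ (ω : Amb n) * (1 - inner ℝ ζ (ω : Amb n)) ^ σ ∂(surf n)

lemma continuous_moment {σ : ℝ} (hσ : 0 < σ) : Continuous (moment n σ) := by
  unfold moment
  have := continuous_parametric_integral_of_continuous (μ := surf n)
    (f := fun (ζ : Amb n) (ω : Sph n) => inner ℝ ζ (ω : Amb n) * (1 - inner ℝ ζ (ω : Amb n)) ^ σ)
    (by
      unfold Function.uncurry
      exact Continuous.mul (by fun_prop) (Continuous.rpow_const (by fun_prop)
        fun _ => Or.inr hσ.le)) (isCompact_univ)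
  simpa using this

lemma integral_inner_sphere (ζ : Amb n) :
    ∫ ω : Sph n, inner ℝ ζ (ω : Amb n) ∂(surf n) = 0 := by
  have h := integral_mul_harmonic_eq_zero (n := n) (k := 1) (m := 0) one_ne_zero
    (linForm_mem_harmonicPoly ζ) (C_mem_harmonicPoly 1)
  simpa [polyVal_linForm] using h

/-- As t = ζ·ω has mean zero, the negated moment is the integral of t(1 − (1 − t)^σ), which is
nonnegative and is positive at ω = ζ/|ζ|. -/
lemma moment_neg {σ : ℝ} (hσ : 0 < σ) {ζ : Amb n} (h0 : ζ ≠ 0) (h1 : ‖ζ‖ ≤ 1) :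
    moment n σ ζ < 0 := by
  have hc1 : Continuous fun ω : Sph n => inner ℝ ζ (ω : Amb n) := by fun_prop
  have hc2 : Continuous fun ω : Sph n =>
      inner ℝ ζ (ω : Amb n) * (1 - inner ℝ ζ (ω : Amb n)) ^ σ :=
    hc1.mul (Continuous.rpow_const (by fun_prop) fun _ => Or.inr hσ.le)
  have hint : ∀ f : Sph n → ℝ, Continuous f → Integrable f (surf n) := fun f hf =>
    hf.integrable_of_hasCompactSupport (HasCompactSupport.of_compactSpace f)
  have hpos : 0 < ∫ ω : Sph n, (inner ℝ ζ (ω : Amb n) -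
      inner ℝ ζ (ω : Amb n) * (1 - inner ℝ ζ (ω : Amb n)) ^ σ) ∂(surf n) := by
    have hζ : 0 < ‖ζ‖ := norm_pos_iff.mpr h0
    refine integral_pos_of_integrable_nonneg_nonzero
      (x := ⟨‖ζ‖⁻¹ • ζ, by simp [norm_smul, hζ.ne']⟩) (hc1.sub hc2) (hint _ (hc1.sub hc2)) ?_ ?_
    · intro ω
      have hle : |inner ℝ ζ (ω : Amb n)| ≤ 1 := (abs_inner_sphere_le ζ ω).trans h1
      obtain ⟨ha, hb⟩ := abs_le.mp hle
      set t := inner ℝ ζ (ω : Amb n)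
      change 0 ≤ t - t * (1 - t) ^ σ
      rcases le_total 0 t with ht | ht
      · have : (1 - t) ^ σ ≤ 1 := Real.rpow_le_one (by linarith) (by linarith) hσ.le
        nlinarith
      · have : 1 ≤ (1 - t) ^ σ := Real.one_le_rpow (by linarith) hσ.le
        nlinarith
    · have ht : inner ℝ ζ (‖ζ‖⁻¹ • ζ) = ‖ζ‖ := by
        rw [real_inner_smul_right, real_inner_self_eq_norm_sq]
        field_simp
      simp only [ht]
      have : (1 - ‖ζ‖) ^ σ < 1 := Real.rpow_lt_one (by linarith) (by linarith) hσ
      have : 0 < ‖ζ‖ * (1 - (1 - ‖ζ‖) ^ σ) := mul_pos hζ (by linarith)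
      intro h
      linarith
  rw [integral_sub (hint _ hc1) (hint _ hc2), integral_inner_sphere] at hpos
  unfold moment
  linarith

/-- Compactness of the closed shell. Including |ζ| = 1 is what prevents parameters from escaping to
the boundary of the ball. -/
lemma exists_moment_le {σ : ℝ} (hσ : 0 < σ) {δ : ℝ} (hδ : 0 < δ) :
    ∃ c > 0, ∀ ζ : Amb n, δ ≤ ‖ζ‖ → ‖ζ‖ ≤ 1 → c ≤ -moment n σ ζ := by
  have hK : IsCompact (Metric.closedBall (0 : Amb n) 1 ∩ {ζ | δ ≤ ‖ζ‖}) :=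
    (isCompact_closedBall 0 1).inter_right (isClosed_le continuous_const continuous_norm)
  rcases Set.eq_empty_or_nonempty (Metric.closedBall (0 : Amb n) 1 ∩ {ζ | δ ≤ ‖ζ‖}) with h | h
  · refine ⟨1, one_pos, fun ζ h1 h2 => absurd (show ζ ∈ (∅ : Set (Amb n)) from ?_) (by simp)⟩
    rw [← h]
    exact ⟨by simpa using h2, h1⟩
  · obtain ⟨ζ₀, ⟨h1, h2⟩, hmin⟩ := hK.exists_isMinOn h (continuous_moment hσ).neg.continuousOn
    refine ⟨-moment n σ ζ₀, ?_, fun ζ h3 h4 => hmin ⟨by simpa using h4, h3⟩⟩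
    have hne : ζ₀ ≠ 0 := norm_pos_iff.mp (hδ.trans_le h2)
    have := moment_neg hσ hne (by simpa using h1)
    linarith

variable {s : ℝ}

lemma inner_bubble_linForm (hn : 1 ≤ n)
    (hs : s - (n : ℝ) / 2 ∈ Set.Ioo (0 : ℝ) 1 ∪ Set.Ioo (1 : ℝ) 2) {ζ : Amb n} (hζ : ‖ζ‖ < 1) :
    inner ℝ (bubble hn (s_pos hs) ζ).toL2 (restrictPoly n (linForm n ζ)) =
      moment n (s - n / 2) ζ := by
  rw [toL2_bubble hn hs hζ, restrictPoly_apply, inner_toLp]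
  simp only [polyCont_linForm]
  exact integral_congr_ae (Eventually.of_forall fun ω => mul_comm _ _)

end Moment

/-! ### The manifold of optimizers -/

section Manifold

variable {n : ℕ} {s : ℝ}

/-- The constant function `1` in `H^s`. -/
def oneSob (hn : 1 ≤ n) (s : ℝ) : Sob n s := polySob hn s 1

/-- The parametrization `(c, ζ) ↦ c (1 - ζ · ω) ^ (s - n / 2)` of the optimizers. -/
def param (hn : 1 ≤ n) (hs : 0 < s) (p : ℝ × Amb n) : Sob n s := p.1 • bubble hn hs p.2

lemma one_mem_harmonicPoly : (1 : MvPolynomial (Fin (n + 1)) ℝ) ∈ harmonicPoly n 0 := by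
  simpa using C_mem_harmonicPoly (n := n) 1

lemma bubble_zero (hn : 1 ≤ n)
    (hs : s - (n : ℝ) / 2 ∈ Set.Ioo (0 : ℝ) 1 ∪ Set.Ioo (1 : ℝ) 2) :
    bubble hn (s_pos hs) 0 = oneSob hn s := by
  have h := hasSum_bubble hn hs (ζ := 0) (by simp)
  refine h.unique ?_
  have : ∀ k : ℕ, k ≠ 0 →
      binCoeff (s - n / 2) k • polySob hn s (linForm n (0 : Amb n) ^ k) = 0 := fun k hk => by
    simp [hk]
  simpa [binCoeff_zero, oneSob] using hasSum_single 0 this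

lemma param_one_zero (hn : 1 ≤ n)
    (hs : s - (n : ℝ) / 2 ∈ Set.Ioo (0 : ℝ) 1 ∪ Set.Ioo (1 : ℝ) 2) :
    param hn (s_pos hs) (1, 0) = oneSob hn s := by
  rw [param, bubble_zero hn hs, one_smul]

lemma mem_optimizers_iff (hn : 1 ≤ n)
    (hs : s - (n : ℝ) / 2 ∈ Set.Ioo (0 : ℝ) 1 ∪ Set.Ioo (1 : ℝ) 2) {h : Sob n s} :
    h ∈ optimizers n s ↔
      ∃ p : ℝ × Amb n, 0 < p.1 ∧ ‖p.2‖ < 1 ∧ h = param hn (s_pos hs) p := by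
  have hexp : (2 * s - n) / 2 = s - n / 2 := by ring
  have hae : ∀ (c : ℝ) (ζ : Amb n), ‖ζ‖ < 1 → ∀ᵐ ω ∂(surf n),
      (param hn (s_pos hs) (c, ζ)).toL2 ω =
        c * (1 - inner ℝ ζ (ω : Amb n)) ^ ((2 * s - n) / 2) := by
    intro c ζ hζ
    have h1 : (param hn (s_pos hs) (c, ζ)).toL2 =
        ContinuousMap.toLp 2 (surf n) ℝ (c • bubbleCont (order_pos hs) ζ) := by
      rw [param, map_smul, toL2_bubble hn hs hζ, map_smul]
    rw [h1]
    filter_upwards [ContinuousMap.coeFn_toLp (p := 2) (𝕜 := ℝ) (surf n)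
      (c • bubbleCont (order_pos hs) ζ)] with ω hω
    rw [hω, hexp]
    rfl
  constructor
  · rintro ⟨c, hc, ζ, hζ, h1⟩
    refine ⟨(c, ζ), hc, hζ, Sob.toL2_injective (Lp.ext ?_)⟩
    filter_upwards [h1, hae c ζ hζ] with ω e1 e2
    rw [e1, e2]
  · rintro ⟨⟨c, ζ⟩, hc, hζ, rfl⟩
    exact ⟨c, hc, ζ, hζ, hae c ζ hζ⟩

lemma analyticAt_param (hn : 1 ≤ n)
    (hs : s - (n : ℝ) / 2 ∈ Set.Ioo (0 : ℝ) 1 ∪ Set.Ioo (1 : ℝ) 2) {p : ℝ × Amb n}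
    (hp : ‖p.2‖ < 1) : AnalyticAt ℝ (param hn (s_pos hs)) p := by
  have h1 : AnalyticAt ℝ (fun p : ℝ × Amb n => bubble hn (s_pos hs) p.2) p :=
    (analyticAt_bubble hn hs hp).comp analyticAt_snd
  exact analyticAt_fst.smul h1

lemma fderiv_param (hn : 1 ≤ n)
    (hs : s - (n : ℝ) / 2 ∈ Set.Ioo (0 : ℝ) 1 ∪ Set.Ioo (1 : ℝ) 2) {p : ℝ × Amb n}
    (hp : ‖p.2‖ < 1) (q : ℝ × Amb n) :
    fderiv ℝ (param hn (s_pos hs)) p q =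
      q.1 • bubble hn (s_pos hs) p.2 + p.1 • fderiv ℝ (bubble hn (s_pos hs)) p.2 q.2 := by
  have h1 : HasFDerivAt (fun p : ℝ × Amb n => bubble hn (s_pos hs) p.2)
      ((fderiv ℝ (bubble hn (s_pos hs)) p.2).comp (ContinuousLinearMap.snd ℝ ℝ (Amb n))) p :=
    (analyticAt_bubble hn hs hp).differentiableAt.hasFDerivAt.comp p hasFDerivAt_snd
  have h2 := (hasFDerivAt_fst (𝕜 := ℝ) (p := p)).smul h1
  have h3 : HasFDerivAt (param hn (s_pos hs)) _ p := h2
  rw [h3.fderiv]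
  simp [add_comm]

lemma eventually_pos_and_norm_lt_one {p : ℝ × Amb n}
    (h0 : 0 < p.1) (hp : ‖p.2‖ < 1) : ∀ᶠ q in 𝓝 p, 0 < q.1 ∧ ‖q.2‖ < 1 :=
  (continuous_fst.continuousAt.eventually_const_lt h0).and
    (continuous_snd.norm.continuousAt.eventually_lt_const hp)

/-- The range of the derivative of the parametrization consists of tangent vectors. -/
lemma fderiv_param_mem_tangent (hn : 1 ≤ n)
    (hs : s - (n : ℝ) / 2 ∈ Set.Ioo (0 : ℝ) 1 ∪ Set.Ioo (1 : ℝ) 2) {p : ℝ × Amb n}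
    (h0 : 0 < p.1) (hp : ‖p.2‖ < 1) (q : ℝ × Amb n) :
    fderiv ℝ (param hn (s_pos hs)) p q ∈ tangent (param hn (s_pos hs) p) := by
  have hline : HasDerivAt (fun t : ℝ => p + t • q) q 0 := by
    simpa using ((hasDerivAt_id (0 : ℝ)).smul_const q).const_add p
  refine ⟨fun t => param hn (s_pos hs) (p + t • q), ?_, by simp, ?_⟩
  · have hc : Tendsto (fun t : ℝ => p + t • q) (𝓝 0) (𝓝 p) := by
      simpa using hline.continuousAt.tendsto
    filter_upwards [hc.eventually (eventually_pos_and_norm_lt_one h0 hp)] with t ht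
    exact (mem_optimizers_iff hn hs).mpr ⟨_, ht.1, ht.2, rfl⟩
  · have h1 : HasFDerivAt (param hn (s_pos hs)) (fderiv ℝ (param hn (s_pos hs)) p)
        (p + (0 : ℝ) • q) := by
      simpa using (analyticAt_param hn hs hp).differentiableAt.hasFDerivAt
    exact h1.comp_hasDerivAt 0 hline

lemma aBil_eq_zero_of_mem_tangentPerp (hn : 1 ≤ n)
    (hs : s - (n : ℝ) / 2 ∈ Set.Ioo (0 : ℝ) 1 ∪ Set.Ioo (1 : ℝ) 2) {p : ℝ × Amb n}
    (h0 : 0 < p.1) (hp : ‖p.2‖ < 1) {ρ : Sob n s} (hρ : ρ ∈ tangentPerp (param hn (s_pos hs) p))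
    (q : ℝ × Amb n) : aBil hn hs ρ (fderiv ℝ (param hn (s_pos hs)) p q) = 0 := by
  rw [aBil_apply]
  exact hρ _ (fderiv_param_mem_tangent hn hs h0 hp q)

lemma aBil_bubble_of_mem_tangentPerp (hn : 1 ≤ n)
    (hs : s - (n : ℝ) / 2 ∈ Set.Ioo (0 : ℝ) 1 ∪ Set.Ioo (1 : ℝ) 2) {p : ℝ × Amb n}
    (h0 : 0 < p.1) (hp : ‖p.2‖ < 1) {ρ : Sob n s} (hρ : ρ ∈ tangentPerp (param hn (s_pos hs) p)) :
    aBil hn hs ρ (bubble hn (s_pos hs) p.2) = 0 := by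
  simpa [fderiv_param hn hs hp] using aBil_eq_zero_of_mem_tangentPerp hn hs h0 hp hρ (1, 0)

lemma aBil_fderiv_bubble_of_mem_tangentPerp (hn : 1 ≤ n)
    (hs : s - (n : ℝ) / 2 ∈ Set.Ioo (0 : ℝ) 1 ∪ Set.Ioo (1 : ℝ) 2) {p : ℝ × Amb n}
    (h0 : 0 < p.1) (hp : ‖p.2‖ < 1) {ρ : Sob n s} (hρ : ρ ∈ tangentPerp (param hn (s_pos hs) p))
    (e : Amb n) : aBil hn hs ρ (fderiv ℝ (bubble hn (s_pos hs)) p.2 e) = 0 := by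
  simpa [fderiv_param hn hs hp, h0.ne'] using
    aBil_eq_zero_of_mem_tangentPerp hn hs h0 hp hρ (0, e)

end Manifold

/-! ### Orthogonal decompositions of functions near `1` -/

section Far

variable {n : ℕ} {s : ℝ}

/-- Antisymmetry moves L from the optimizer to 1, and L1 = σ(e·ω) is a harmonic of degree 1. -/
lemma aBil_oneSob_bubbleLie (hn : 1 ≤ n)
    (hs : s - (n : ℝ) / 2 ∈ Set.Ioo (0 : ℝ) 1 ∪ Set.Ioo (1 : ℝ) 2) {e : Amb n} (he : ‖e‖ = 1)
    {r : ℝ} (hr : |r| < 1) :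
    aBil hn hs (oneSob hn s) (bubbleLie hn (s_pos hs) e r) =
      -((s - n / 2) * alpha n s 1 *
        inner ℝ (bubble hn (s_pos hs) (r • e)).toL2 (restrictPoly n (linForm n e))) := by
  have h1 := polySob_mem_lieGraph hn s e 1
  have h2 := aBil_of_mem_lieGraph hn hs h1 (bubble_mem_lieGraph hn hs he hr)
  have h3 : lieOp e (s - n / 2) 1 = (s - n / 2) • linForm n e := by
    simpa using lieOp_linForm_pow he (s - n / 2) 0
  simp only [h3, map_smul, FunLike.coe_smul, Pi.smul_apply, smul_eq_mul] at h2
  rw [aBil_comm hn hs (polySob hn s (linForm n e)),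
    aBil_polySob hn hs _ (linForm_mem_harmonicPoly e)] at h2
  rw [aBil_comm, oneSob]
  linarith

/-- In an orthogonal decomposition `u = h + ρ` of a function `u` near `1`, the parameter of `h`
has small moment. -/
lemma exists_moment_le_norm_sub (hn : 1 ≤ n)
    (hs : s - (n : ℝ) / 2 ∈ Set.Ioo (0 : ℝ) 1 ∪ Set.Ioo (1 : ℝ) 2) :
    ∃ K : ℝ, ∀ (u : Sob n s) (p : ℝ × Amb n), 0 < p.1 → ‖p.2‖ < 1 →
      u - param hn (s_pos hs) p ∈ tangentPerp (param hn (s_pos hs) p) →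
      -moment n (s - n / 2) p.2 ≤ K * ‖u - oneSob hn s‖ := by
  obtain ⟨C, hC, hbound⟩ := exists_norm_bubbleLie_le hn hs
  have hσ := order_pos hs
  have hα : 0 < |alpha n s 1| := abs_pos.mpr (alpha_ne_zero hs 1)
  have hA0 : 0 ≤ ‖aBil hn hs‖ := ContinuousLinearMap.opNorm_nonneg _
  refine ⟨‖aBil hn hs‖ * C / ((s - n / 2) * |alpha n s 1|), fun u p h0 hp hρ => ?_⟩
  rcases eq_or_ne p.2 0 with hz | hz
  · rw [hz]
    have : moment n (s - n / 2) (0 : Amb n) = 0 := by simp [moment]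
    rw [this, neg_zero]
    positivity
  have hr0 : 0 < ‖p.2‖ := norm_pos_iff.mpr hz
  set r := ‖p.2‖ with hr
  obtain ⟨e, he, hre⟩ : ∃ e : Amb n, ‖e‖ = 1 ∧ r • e = p.2 :=
    ⟨r⁻¹ • p.2, by rw [norm_smul, norm_inv, norm_norm, ← hr, inv_mul_cancel₀ hr0.ne'],
      by rw [smul_smul, mul_inv_cancel₀ hr0.ne', one_smul]⟩
  have habs : |r| < 1 := by rwa [abs_of_pos hr0]
  set w := bubbleLie hn (s_pos hs) e r with hw
  set φ := bubble hn (s_pos hs) p.2 with hφ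
  -- `w` is a combination of the optimizer and its radial derivative, both tangent directions.
  have h1 : aBil hn hs (u - param hn (s_pos hs) p) w = 0 := by
    have e1 := aBil_bubble_of_mem_tangentPerp hn hs h0 hp hρ
    have e2 := aBil_fderiv_bubble_of_mem_tangentPerp hn hs h0 hp hρ e
    rw [hw, bubbleLie, bubbleDeriv, hre, map_sub, map_neg, map_smul, map_smul, e1, e2]
    simp
  -- Antisymmetry kills the contribution of the optimizer itself, whatever its amplitude.
  have h2 : aBil hn hs (param hn (s_pos hs) p) w = 0 := by
    have := aBil_self_of_mem_lieGraph hn hs (bubble_mem_lieGraph hn hs he habs)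
    simp only [hre] at this
    rw [param, map_smul, FunLike.coe_smul, Pi.smul_apply, this, smul_zero]
  have h3 : aBil hn hs u w = 0 := by
    have : aBil hn hs (u - param hn (s_pos hs) p) w =
        aBil hn hs u w - aBil hn hs (param hn (s_pos hs) p) w := by simp
    rw [this, h2, sub_zero] at h1
    exact h1
  have h4 : |aBil hn hs (oneSob hn s) w| ≤ ‖aBil hn hs‖ * ‖u - oneSob hn s‖ * C := by
    have e1 : aBil hn hs (oneSob hn s) w = -aBil hn hs (u - oneSob hn s) w := by
      simp [h3]
    rw [e1, abs_neg]
    refine ((aBil hn hs).le_opNorm₂ _ _).trans ?_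
    gcongr
    exact hbound e he r hr0.le hp
  have h5 : r * inner ℝ φ.toL2 (restrictPoly n (linForm n e)) = moment n (s - n / 2) p.2 := by
    rw [← inner_bubble_linForm hn hs hp, ← real_inner_smul_right, ← map_smul, ← map_smul, hre]
  rw [aBil_oneSob_bubbleLie hn hs he habs, hre, abs_neg, abs_mul, abs_mul, abs_of_pos hσ] at h4
  have h6 : -moment n (s - n / 2) p.2 ≤ |inner ℝ φ.toL2 (restrictPoly n (linForm n e))| := by
    refine (neg_le_abs _).trans ?_
    rw [← h5, abs_mul, abs_of_pos hr0]
    exact mul_le_of_le_one_left (abs_nonneg _) hp.le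
  rw [div_mul_eq_mul_div, le_div_iff₀ (by positivity)]
  calc _ ≤ |inner ℝ φ.toL2 (restrictPoly n (linForm n e))| * ((s - n / 2) * |alpha n s 1|) := by
        gcongr
    _ = (s - n / 2) * |alpha n s 1| * |inner ℝ φ.toL2 (restrictPoly n (linForm n e))| := by ring
    _ ≤ _ := h4
    _ = _ := by ring

/-- If the moments along a filter tend to `0`, so do the parameters. -/
lemma tendsto_zero_of_moment {ι : Type*} {l : Filter ι} {σ : ℝ} (hσ : 0 < σ) {f : ι → Amb n}
    {g : ι → ℝ} (hg : Tendsto g l (𝓝 0)) (hf : ∀ᶠ i in l, ‖f i‖ ≤ 1 ∧ -moment n σ (f i) ≤ g i) :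
    Tendsto f l (𝓝 0) := by
  rw [tendsto_zero_iff_norm_tendsto_zero, Metric.tendsto_nhds]
  intro δ hδ
  obtain ⟨c, hc, hcδ⟩ := exists_moment_le (n := n) hσ hδ
  filter_upwards [hf, hg.eventually_lt_const hc] with i h1 h2
  rw [dist_zero_right, norm_norm]
  by_contra hcon
  push Not at hcon
  have := hcδ (f i) hcon h1.1
  linarith [h1.2]

lemma inner_restrictPoly_one_pos :
    0 < inner ℝ (restrictPoly n 1) (restrictPoly n 1) := by
  rw [inner_restrictPoly]
  simp only [mul_one, polyVal, map_one, integral_const, smul_eq_mul, mul_one]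
  exact ENNReal.toReal_pos (IsOpen.measure_ne_zero (surf n) isOpen_univ Set.univ_nonempty)
    (measure_ne_top _ _)

lemma aBil_oneSob_ne_zero (hn : 1 ≤ n)
    (hs : s - (n : ℝ) / 2 ∈ Set.Ioo (0 : ℝ) 1 ∪ Set.Ioo (1 : ℝ) 2) :
    aBil hn hs (oneSob hn s) (oneSob hn s) ≠ 0 := by
  rw [oneSob, aBil_polySob hn hs _ one_mem_harmonicPoly]
  exact mul_ne_zero (alpha_ne_zero hs 0) inner_restrictPoly_one_pos.ne'

lemma aBil_sub_param (hn : 1 ≤ n)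
    (hs : s - (n : ℝ) / 2 ∈ Set.Ioo (0 : ℝ) 1 ∪ Set.Ioo (1 : ℝ) 2) (u φ : Sob n s)
    (p : ℝ × Amb n) :
    aBil hn hs (u - param hn (s_pos hs) p) φ =
      aBil hn hs u φ - p.1 * aBil hn hs (bubble hn (s_pos hs) p.2) φ := by
  rw [param, map_sub, map_smul]
  rfl

lemma tendsto_snd_of_decomposition {ι : Type*} {l : Filter ι} (hn : 1 ≤ n)
    (hs : s - (n : ℝ) / 2 ∈ Set.Ioo (0 : ℝ) 1 ∪ Set.Ioo (1 : ℝ) 2) {u : ι → Sob n s}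
    {p : ι → ℝ × Amb n} (hu : Tendsto u l (𝓝 (oneSob hn s)))
    (hp : ∀ᶠ i in l, 0 < (p i).1 ∧ ‖(p i).2‖ < 1 ∧
      u i - param hn (s_pos hs) (p i) ∈ tangentPerp (param hn (s_pos hs) (p i))) :
    Tendsto (fun i => (p i).2) l (𝓝 0) := by
  obtain ⟨K, hK⟩ := exists_moment_le_norm_sub hn hs
  refine tendsto_zero_of_moment (order_pos hs) (g := fun i => K * ‖u i - oneSob hn s‖) ?_ ?_
  · simpa using (hu.sub_const (oneSob hn s)).norm.const_mul K
  · filter_upwards [hp] with i hi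
    exact ⟨hi.2.1.le, hK _ _ hi.1 hi.2.1 hi.2.2⟩

lemma tendsto_aBil {ι : Type*} {l : Filter ι} (hn : 1 ≤ n)
    (hs : s - (n : ℝ) / 2 ∈ Set.Ioo (0 : ℝ) 1 ∪ Set.Ioo (1 : ℝ) 2) {u v : ι → Sob n s}
    {u₀ v₀ : Sob n s} (hu : Tendsto u l (𝓝 u₀)) (hv : Tendsto v l (𝓝 v₀)) :
    Tendsto (fun i => aBil hn hs (u i) (v i)) l (𝓝 (aBil hn hs u₀ v₀)) :=
  ((aBil hn hs).continuous₂.tendsto (u₀, v₀)).comp (hu.prodMk_nhds hv)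

/-- In orthogonal decompositions of functions tending to `1`, the parameters tend to `(1, 0)`. -/
lemma tendsto_of_decomposition {ι : Type*} {l : Filter ι} (hn : 1 ≤ n)
    (hs : s - (n : ℝ) / 2 ∈ Set.Ioo (0 : ℝ) 1 ∪ Set.Ioo (1 : ℝ) 2) {u : ι → Sob n s}
    {p : ι → ℝ × Amb n} (hu : Tendsto u l (𝓝 (oneSob hn s)))
    (hp : ∀ᶠ i in l, 0 < (p i).1 ∧ ‖(p i).2‖ < 1 ∧
      u i - param hn (s_pos hs) (p i) ∈ tangentPerp (param hn (s_pos hs) (p i))) :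
    Tendsto p l (𝓝 (1, 0)) := by
  have hζ := tendsto_snd_of_decomposition hn hs hu hp
  have hφ : Tendsto (fun i => bubble hn (s_pos hs) (p i).2) l (𝓝 (oneSob hn s)) := by
    rw [← bubble_zero hn hs]
    exact (analyticAt_bubble hn hs (by simp)).continuousAt.tendsto.comp hζ
  have hne := aBil_oneSob_ne_zero hn hs
  have h1 := tendsto_aBil hn hs hu hφ
  have h2 := tendsto_aBil hn hs hφ hφ
  have h3 := h1.div h2 hne
  rw [div_self hne] at h3
  -- Orthogonality to the optimizer determines the amplitude as a[u, φ]/a[φ, φ], which is meaningful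
  -- near 1 because a[1, 1] ≠ 0.
  have hc : Tendsto (fun i => (p i).1) l (𝓝 1) := by
    refine h3.congr' ?_
    filter_upwards [hp, h2.eventually_ne hne] with i hi hi2
    have := aBil_bubble_of_mem_tangentPerp hn hs hi.1 hi.2.1 hi.2.2
    rw [aBil_sub_param] at this
    rw [Pi.div_apply, div_eq_iff hi2]
    linarith
  exact hc.prodMk_nhds hζ

/-- All orthogonal decompositions of functions near `1` have parameters near `(1, 0)`. -/
lemma eventually_forall_param_mem (hn : 1 ≤ n)
    (hs : s - (n : ℝ) / 2 ∈ Set.Ioo (0 : ℝ) 1 ∪ Set.Ioo (1 : ℝ) 2) {N : Set (ℝ × Amb n)}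
    (hN : N ∈ 𝓝 ((1, 0) : ℝ × Amb n)) :
    ∀ᶠ u in 𝓝 (oneSob hn s), ∀ p : ℝ × Amb n, 0 < p.1 → ‖p.2‖ < 1 →
      u - param hn (s_pos hs) p ∈ tangentPerp (param hn (s_pos hs) p) → p ∈ N := by
  -- The filter of all orthogonal decompositions whose function tends to 1; convergence along it is
  -- uniformity over the parameters.
  let l : Filter (Sob n s × ℝ × Amb n) := comap Prod.fst (𝓝 (oneSob hn s)) ⊓
    𝓟 {x | 0 < x.2.1 ∧ ‖x.2.2‖ < 1 ∧
      x.1 - param hn (s_pos hs) x.2 ∈ tangentPerp (param hn (s_pos hs) x.2)}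
  have h1 : Tendsto Prod.fst l (𝓝 (oneSob hn s)) := tendsto_comap.mono_left inf_le_left
  have h2 := tendsto_of_decomposition hn hs h1 (mem_inf_of_right (mem_principal_self _))
  have h3 := h2.eventually_mem hN
  rw [eventually_inf_principal, eventually_comap] at h3
  filter_upwards [h3] with u hu p h0 hp hρ using hu (u, p) rfl ⟨h0, hp, hρ⟩

end Far

/-! ### Submanifolds of a space with a bilinear form -/

section Abstract

variable {X P : Type*} [NormedAddCommGroup X] [NormedSpace ℝ X]
  [NormedAddCommGroup P] [NormedSpace ℝ P]

/-- The pullback `q ↦ A (D q) (D ·)` of a bilinear form along a linear map. -/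
def pullback (A : X →L[ℝ] X →L[ℝ] ℝ) (D : P →L[ℝ] X) : X →L[ℝ] P →L[ℝ] ℝ :=
  ((ContinuousLinearMap.compL ℝ P X ℝ).flip D).comp A

variable [FiniteDimensional ℝ P]

/-- A nondegenerate bilinear form on a finite-dimensional space identifies it with its dual. -/
lemma isInvertible_of_injective {B : P →L[ℝ] P →L[ℝ] ℝ} (hB : Function.Injective B) :
    B.IsInvertible := by
  have hdim : Module.finrank ℝ P = Module.finrank ℝ (P →L[ℝ] ℝ) := by
    rw [← (LinearMap.toContinuousLinearMap (𝕜 := ℝ) (E := P) (F' := ℝ)).finrank_eq]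
    exact (Subspace.dual_finrank_eq (K := ℝ) (V := P)).symm
  refine ⟨(LinearMap.linearEquivOfInjective B.toLinearMap hB hdim).toContinuousLinearEquiv, ?_⟩
  ext q r
  rfl

/-- If the induced bilinear form on the parameter space is nondegenerate, and points of the
manifold near `Ψ p₀` have parameters near `p₀`, then velocities of curves in the manifold lie
in the range of the derivative of the parametrization. -/
lemma eventually_velocity_mem_range {A : X →L[ℝ] X →L[ℝ] ℝ} {Ψ : P → X} {p₀ : P}
    (hΨ : ContDiffAt ℝ 1 Ψ p₀)
    (hB : Function.Injective ((pullback A (fderiv ℝ Ψ p₀)).comp (fderiv ℝ Ψ p₀))) {S : Set P}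
    (hS : ∀ N ∈ 𝓝 p₀, ∀ᶠ u in 𝓝 (Ψ p₀), ∀ p ∈ S, Ψ p = u → p ∈ N) :
    ∀ᶠ p in 𝓝 p₀, ∀ (γ : ℝ → X) (η : X), (∀ᶠ t in 𝓝 0, γ t ∈ Ψ '' S) → γ 0 = Ψ p →
      HasDerivAt γ η 0 → ∃ q, fderiv ℝ Ψ p q = η := by
  have : CompleteSpace P := FiniteDimensional.complete ℝ P
  obtain ⟨B, hBe⟩ := isInvertible_of_injective hB
  -- L ∘ Ψ maps the parameters to their dual, and its derivative at p₀ is the induced form. Its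
  -- local inverse G recovers parameters from points.
  let L := pullback A (fderiv ℝ Ψ p₀)
  have hF : ContDiffAt ℝ 1 (fun p => L (Ψ p)) p₀ := L.contDiff.contDiffAt.comp p₀ hΨ
  have hF' : HasFDerivAt (fun p => L (Ψ p)) (B : P →L[ℝ] P →L[ℝ] ℝ) p₀ := by
    rw [hBe]
    exact L.hasFDerivAt.comp p₀ (hΨ.differentiableAt one_ne_zero).hasFDerivAt
  have hstrict := hF.hasStrictFDerivAt' hF' one_ne_zero
  let G := hF.localInverse hF' one_ne_zero
  have hleft : ∀ᶠ p in 𝓝 p₀, G (L (Ψ p)) = p := hstrict.eventually_left_inverse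
  have hG : ContDiffAt ℝ 1 G (L (Ψ p₀)) := hF.to_localInverse hF' one_ne_zero
  have hGd : ∀ᶠ p in 𝓝 p₀, DifferentiableAt ℝ G (L (Ψ p)) := by
    refine (hF.continuousAt.eventually (hG.eventually (by simp))).mono fun p hp => ?_
    exact hp.differentiableAt one_ne_zero
  have hΨd : ∀ᶠ p in 𝓝 p₀, DifferentiableAt ℝ Ψ p :=
    (hΨ.eventually (by simp)).mono fun p hp => hp.differentiableAt one_ne_zero
  filter_upwards [hleft, hGd, hΨd, hΨ.continuousAt.eventually (hS _ hleft).eventually_nhds]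
    with p h1 h2 h3 h4 γ η hγ hγ0 hη
  rw [← hγ0] at h4
  -- Parameters of γ t are close to p₀ by hypothesis, so G(L(γ t)) is a differentiable choice of
  -- them.
  have h5 : γ =ᶠ[𝓝 0] fun t => Ψ (G (L (γ t))) := by
    filter_upwards [hγ, hη.continuousAt.eventually h4] with t ht ht'
    obtain ⟨p', hp', e⟩ := ht
    have : G (L (Ψ p')) = p' := ht' p' hp' e
    rw [← e, this]
  have h6 : HasDerivAt (fun t => L (γ t)) (L η) 0 := L.hasFDerivAt.comp_hasDerivAt 0 hη
  have h2' : HasFDerivAt G (fderiv ℝ G (L (Ψ p))) (L (γ 0)) := by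
    rw [hγ0]
    exact h2.hasFDerivAt
  have h7 := h2'.comp_hasDerivAt 0 h6
  have h3' : HasFDerivAt Ψ (fderiv ℝ Ψ p) (G (L (γ 0))) := by
    rw [hγ0, h1]
    exact h3.hasFDerivAt
  have h8 := h3'.comp_hasDerivAt 0 h7
  exact ⟨_, (h8.congr_of_eventuallyEq h5).unique hη⟩

/-- Near `Ψ p₀`, orthogonal projection to the manifold parametrized by `Ψ` is given by a function
of the point. -/
lemma exists_projection [CompleteSpace X] {A : X →L[ℝ] X →L[ℝ] ℝ} {Ψ : P → X} {p₀ : P}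
    (hΨ : ContDiffAt ℝ 2 Ψ p₀)
    (hB : Function.Injective ((pullback A (fderiv ℝ Ψ p₀)).comp (fderiv ℝ Ψ p₀))) :
    ∃ ψ : X → P, Tendsto ψ (𝓝 (Ψ p₀)) (𝓝 p₀) ∧
      ∀ᶠ v in 𝓝 (Ψ p₀, p₀), (∀ q, A (v.1 - Ψ v.2) (fderiv ℝ Ψ v.2 q) = 0) ↔ ψ v.1 = v.2 := by
  have : CompleteSpace P := FiniteDimensional.complete ℝ P
  set D := fderiv ℝ Ψ p₀ with hD
  let f : X × P → P →L[ℝ] ℝ := fun v => (A (v.1 - Ψ v.2)).comp (fderiv ℝ Ψ v.2)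
  have h1 : HasStrictFDerivAt (fun v : X × P => A (v.1 - Ψ v.2))
      (A.comp (ContinuousLinearMap.fst ℝ X P - D.comp (ContinuousLinearMap.snd ℝ X P)))
      (Ψ p₀, p₀) := by
    have e : HasStrictFDerivAt Ψ D p₀ := hΨ.hasStrictFDerivAt two_ne_zero
    have e2 : HasStrictFDerivAt (fun v : X × P => Ψ v.2)
        (D.comp (ContinuousLinearMap.snd ℝ X P)) (Ψ p₀, p₀) :=
      e.comp (Ψ p₀, p₀) hasStrictFDerivAt_snd
    exact A.hasStrictFDerivAt.comp (Ψ p₀, p₀) (hasStrictFDerivAt_fst.sub e2)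
  have h2 : HasStrictFDerivAt (fun v : X × P => fderiv ℝ Ψ v.2)
      ((fderiv ℝ (fderiv ℝ Ψ) p₀).comp (ContinuousLinearMap.snd ℝ X P)) (Ψ p₀, p₀) := by
    have e : HasStrictFDerivAt (fderiv ℝ Ψ) (fderiv ℝ (fderiv ℝ Ψ) p₀) p₀ :=
      (hΨ.fderiv_right (m := 1) (by norm_num)).hasStrictFDerivAt one_ne_zero
    exact e.comp (Ψ p₀, p₀) hasStrictFDerivAt_snd
  -- At the base point u − Ψ p vanishes, so the second derivative of Ψ drops out and the partial
  -- derivative in p is minus the induced form.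
  obtain ⟨f', hf, hf'⟩ : ∃ f', HasStrictFDerivAt f f' (Ψ p₀, p₀) ∧
      ∀ q q', f' (0, q) q' = -A (D q) (D q') :=
    ⟨_, h1.clm_comp h2, fun q q' => by simp [hD]⟩
  have hinv : (f' ∘L .inr ℝ X P).IsInvertible := by
    refine isInvertible_of_injective ((injective_iff_map_eq_zero _).mpr fun q hq => ?_)
    refine (injective_iff_map_eq_zero _).mp hB q (ContinuousLinearMap.ext fun q' => ?_)
    have : f' (0, q) q' = 0 := DFunLike.congr_fun hq q'
    rw [hf', neg_eq_zero] at this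
    exact this
  refine ⟨hf.implicitFunctionOfProdDomain hinv,
    hf.tendsto_implicitFunctionOfProdDomain hinv, ?_⟩
  filter_upwards [hf.eventually_apply_eq_iff_implicitFunctionOfProdDomain hinv] with v hv
  rw [← hv, show f (Ψ p₀, p₀) = 0 by simp [f], ContinuousLinearMap.ext_iff]
  rfl

end Abstract

/-! ### Nondegeneracy at the constant function -/

section Nondegenerate

variable {n : ℕ} {s : ℝ}

lemma binCoeff_one (σ : ℝ) : binCoeff σ 1 = -σ := by simp [binCoeff]

lemma fderiv_bubble_zero (hn : 1 ≤ n)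
    (hs : s - (n : ℝ) / 2 ∈ Set.Ioo (0 : ℝ) 1 ∪ Set.Ioo (1 : ℝ) 2) (ζ : Amb n) :
    fderiv ℝ (bubble hn (s_pos hs)) 0 ζ = -(s - n / 2) • polySob hn s (linForm n ζ) := by
  rw [(hasFPowerSeriesOnBall_bubble hn hs).hasFPowerSeriesAt.hasFDerivAt.fderiv]
  simp [bubbleSeries, polyMulti_apply, binCoeff_one]

lemma inner_restrictPoly_linForm_pos {ζ : Amb n} (hζ : ζ ≠ 0) :
    0 < inner ℝ (restrictPoly n (linForm n ζ)) (restrictPoly n (linForm n ζ)) := by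
  have hc : Continuous fun ω : Sph n => inner ℝ ζ (ω : Amb n) * inner ℝ ζ (ω : Amb n) := by
    fun_prop
  have hζ' : 0 < ‖ζ‖ := norm_pos_iff.mpr hζ
  rw [restrictPoly_apply, inner_toLp]
  simp only [polyCont_linForm]
  refine integral_pos_of_integrable_nonneg_nonzero
    (x := ⟨‖ζ‖⁻¹ • ζ, by simp [norm_smul, hζ'.ne']⟩) hc
    (hc.integrable_of_hasCompactSupport (HasCompactSupport.of_compactSpace _))
    (fun ω => mul_self_nonneg _) ?_
  simp [real_inner_smul_right, hζ]

lemma inner_restrictPoly_one_linForm (ζ : Amb n) :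
    inner ℝ (restrictPoly n 1) (restrictPoly n (linForm n ζ)) = 0 :=
  inner_sphHarm zero_ne_one (restrictPoly_mem_sphHarm one_mem_harmonicPoly)
    (restrictPoly_mem_sphHarm (linForm_mem_harmonicPoly ζ))

lemma fderiv_param_one_zero (hn : 1 ≤ n)
    (hs : s - (n : ℝ) / 2 ∈ Set.Ioo (0 : ℝ) 1 ∪ Set.Ioo (1 : ℝ) 2) (q : ℝ × Amb n) :
    fderiv ℝ (param hn (s_pos hs)) (1, 0) q =
      q.1 • polySob hn s 1 + (-(s - n / 2)) • polySob hn s (linForm n q.2) := by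
  rw [fderiv_param hn hs (by simp), bubble_zero hn hs, fderiv_bubble_zero hn hs, one_smul, oneSob]

/-- The form is nondegenerate on the tangent space at the constant function `1`. -/
lemma injective_pullback_param (hn : 1 ≤ n)
    (hs : s - (n : ℝ) / 2 ∈ Set.Ioo (0 : ℝ) 1 ∪ Set.Ioo (1 : ℝ) 2) :
    Function.Injective ((pullback (aBil hn hs) (fderiv ℝ (param hn (s_pos hs)) (1, 0))).comp
      (fderiv ℝ (param hn (s_pos hs)) (1, 0))) := by
  refine (injective_iff_map_eq_zero _).mpr fun q hq => ?_
  set D := fderiv ℝ (param hn (s_pos hs)) (1, 0) with hD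
  have h : ∀ q', aBil hn hs (D q) (D q') = 0 := fun q' => DFunLike.congr_fun hq q'
  have hinner : ∀ p, inner ℝ (D q).toL2 p = q.1 * inner ℝ (restrictPoly n 1) p +
      -(s - n / 2) * inner ℝ (restrictPoly n (linForm n q.2)) p := fun p => by
    rw [hD, fderiv_param_one_zero hn hs, map_add, map_smul, map_smul, inner_add_left,
      real_inner_smul_left, real_inner_smul_left, toL2_polySob, toL2_polySob]
  -- Constants and linear forms have different degrees, so testing against each isolates one of the
  -- two parameters.
  have h1 := h (1, 0)
  have e1 : D (1, 0) = polySob hn s 1 := by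
    rw [hD, fderiv_param_one_zero hn hs]
    simp
  rw [e1, aBil_polySob hn hs _ one_mem_harmonicPoly, hinner,
    real_inner_comm _ (restrictPoly n (linForm n q.2)), inner_restrictPoly_one_linForm] at h1
  have hq1 : q.1 = 0 := by
    rw [mul_zero, add_zero] at h1
    exact (mul_eq_zero.mp ((mul_eq_zero.mp h1).resolve_left (alpha_ne_zero hs 0))).resolve_right
      inner_restrictPoly_one_pos.ne'
  have h2 := h (0, q.2)
  have e2 : D (0, q.2) = -(s - n / 2) • polySob hn s (linForm n q.2) := by
    rw [hD, fderiv_param_one_zero hn hs, zero_smul, zero_add]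
  rw [e2, map_smul, aBil_polySob hn hs _ (linForm_mem_harmonicPoly q.2), hinner, hq1, zero_mul,
    zero_add, smul_eq_mul] at h2
  have hq2 : q.2 = 0 := by
    by_contra hne
    have := (inner_restrictPoly_linForm_pos hne).ne'
    have hσ := neg_ne_zero.mpr (order_pos hs).ne'
    exact mul_ne_zero hσ (mul_ne_zero (alpha_ne_zero hs 1) (mul_ne_zero hσ this)) h2
  exact Prod.ext hq1 hq2

end Nondegenerate

/-! ### Local uniqueness of orthogonal decompositions -/

section Main

variable {n : ℕ} {s : ℝ}

lemma zero_mem_tangentPerp (hn : 1 ≤ n)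
    (hs : s - (n : ℝ) / 2 ∈ Set.Ioo (0 : ℝ) 1 ∪ Set.Ioo (1 : ℝ) 2) (h : Sob n s) :
    (0 : Sob n s) ∈ tangentPerp h := fun φ _ => by
  rw [← aBil_apply hn hs, map_zero, zero_apply]

/-- Near the constant function, tangent vectors lie in the range of the derivative of the
parametrization. -/
lemma eventually_tangent_subset_range (hn : 1 ≤ n)
    (hs : s - (n : ℝ) / 2 ∈ Set.Ioo (0 : ℝ) 1 ∪ Set.Ioo (1 : ℝ) 2) :
    ∀ᶠ p in 𝓝 ((1, 0) : ℝ × Amb n), ∀ η ∈ tangent (param hn (s_pos hs) p),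
      ∃ q, fderiv ℝ (param hn (s_pos hs)) p q = η := by
  have hΨ : ContDiffAt ℝ 1 (param hn (s_pos hs)) (1, 0) :=
    (analyticAt_param hn hs (by simp)).contDiffAt
  have hS : ∀ N ∈ 𝓝 ((1, 0) : ℝ × Amb n), ∀ᶠ u in 𝓝 (param hn (s_pos hs) (1, 0)),
      ∀ p ∈ {p : ℝ × Amb n | 0 < p.1 ∧ ‖p.2‖ < 1}, param hn (s_pos hs) p = u → p ∈ N := by
    intro N hN
    rw [param_one_zero hn hs]
    -- A point of the manifold is an orthogonal decomposition of itself with remainder 0, so the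
    -- localization of decompositions applies to it.
    filter_upwards [eventually_forall_param_mem hn hs hN] with u hu p hp hpu
    refine hu p hp.1 hp.2 ?_
    rw [hpu, sub_self]
    exact zero_mem_tangentPerp hn hs u
  filter_upwards [eventually_velocity_mem_range hΨ (injective_pullback_param hn hs) hS]
    with p hp η hη
  obtain ⟨γ, hγ, h0, hd⟩ := hη
  refine hp γ η (hγ.mono fun t ht => ?_) h0 hd
  obtain ⟨p', h1, h2, h3⟩ := (mem_optimizers_iff hn hs).mp ht
  exact ⟨p', ⟨h1, h2⟩, h3.symm⟩

/-- Near the constant function, the orthogonal complement of the tangent space is characterized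
by the derivative of the parametrization. -/
lemma eventually_mem_tangentPerp_iff (hn : 1 ≤ n)
    (hs : s - (n : ℝ) / 2 ∈ Set.Ioo (0 : ℝ) 1 ∪ Set.Ioo (1 : ℝ) 2) :
    ∀ᶠ p in 𝓝 ((1, 0) : ℝ × Amb n), ∀ ρ, ρ ∈ tangentPerp (param hn (s_pos hs) p) ↔
      ∀ q, aBil hn hs ρ (fderiv ℝ (param hn (s_pos hs)) p q) = 0 := by
  filter_upwards [eventually_tangent_subset_range hn hs,
    eventually_pos_and_norm_lt_one (p := ((1, 0) : ℝ × Amb n)) one_pos (by simp)] with p h1 h2 ρ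
  refine ⟨fun h q => aBil_eq_zero_of_mem_tangentPerp hn hs h2.1 h2.2 h q, fun h φ hφ => ?_⟩
  obtain ⟨q, rfl⟩ := h1 φ hφ
  rw [← aBil_apply hn hs]
  exact h q

/-- Functions near `1` have exactly one orthogonal decomposition. -/
lemma exists_decomposition (hn : 1 ≤ n)
    (hs : s - (n : ℝ) / 2 ∈ Set.Ioo (0 : ℝ) 1 ∪ Set.Ioo (1 : ℝ) 2) {V : Set (Sob n s)}
    (hV : V ∈ 𝓝 (oneSob hn s)) :
    ∀ᶠ u in 𝓝 (oneSob hn s), ∃ h ∈ V ∩ optimizers n s, u - h ∈ tangentPerp h ∧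
      ∀ h' ∈ optimizers n s, u - h' ∈ tangentPerp h' → h' = h := by
  have hana := analyticAt_param hn hs (p := (1, 0)) (by simp)
  obtain ⟨ψ, hψ, hiff⟩ := exists_projection hana.contDiffAt (injective_pullback_param hn hs)
  rw [param_one_zero hn hs] at hψ hiff
  rw [nhds_prod_eq] at hiff
  obtain ⟨P₁, hP₁, P₂, hP₂, hiff⟩ := eventually_prod_iff.mp hiff
  have hvalid := eventually_pos_and_norm_lt_one (p := ((1, 0) : ℝ × Amb n)) one_pos (by simp)
  have hperp := eventually_mem_tangentPerp_iff hn hs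
  have hVp : ∀ᶠ p in 𝓝 ((1, 0) : ℝ × Amb n), param hn (s_pos hs) p ∈ V := by
    refine hana.continuousAt.eventually_mem ?_
    rwa [param_one_zero hn hs]
  -- The last event forces the parameters of every competing decomposition into the region where the
  -- implicit function theorem decides orthogonality.
  filter_upwards [hP₁, hψ.eventually hP₂, hψ.eventually hvalid, hψ.eventually hperp,
    hψ.eventually hVp, eventually_forall_param_mem hn hs (hP₂.and hperp)]
    with u h1 h2 h3 h4 h5 h6
  refine ⟨param hn (s_pos hs) (ψ u),
    ⟨h5, (mem_optimizers_iff hn hs).mpr ⟨ψ u, h3.1, h3.2, rfl⟩⟩, ?_, ?_⟩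
  · exact (h4 _).mpr ((hiff h1 h2).mpr rfl)
  · intro h' hh' hρ
    obtain ⟨p, hp1, hp2, rfl⟩ := (mem_optimizers_iff hn hs).mp hh'
    obtain ⟨h7, h8⟩ := h6 p hp1 hp2 hρ
    rw [(hiff h1 h7).mp ((h8 _).mp hρ)]

lemma oneSob_ae_eq (hn : 1 ≤ n) : ∀ᵐ ω ∂(surf n), (oneSob hn s).toL2 ω = 1 := by
  have h1 : (oneSob hn s).toL2 = ContinuousMap.toLp 2 (surf n) ℝ (1 : C(Sph n, ℝ)) := by
    rw [oneSob, toL2_polySob, restrictPoly_apply, map_one]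
  rw [h1]
  exact ContinuousMap.coeFn_toLp (p := 2) (𝕜 := ℝ) (surf n) 1

/-- Uniqueness among all optimizers, not only nearby ones, reduces the infimum to a single value. -/
lemma modDist_eq_of_unique {u h : Sob n s} (hh : h ∈ optimizers n s)
    (hρ : u - h ∈ tangentPerp h)
    (huniq : ∀ h' ∈ optimizers n s, u - h' ∈ tangentPerp h' → h' = h) :
    modDist u = ((aQuad (u - h) : ℝ) : EReal) := by
  have : {x : EReal | ∃ h ∈ optimizers n s, ∃ ρ ∈ tangentPerp h,
      u = h + ρ ∧ x = ((aQuad ρ : ℝ) : EReal)} = {((aQuad (u - h) : ℝ) : EReal)} := by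
    refine Set.eq_singleton_iff_unique_mem.mpr ⟨⟨h, hh, u - h, hρ, by abel, rfl⟩, ?_⟩
    rintro x ⟨h', hh', ρ, hρ', rfl, rfl⟩
    have e : h' = h := huniq h' hh' (by simpa using hρ')
    subst e
    simp
  rw [modDist, this, sInf_singleton]

end Main

end ReverseSobolev

end

open ReverseSobolev
theorem mainTheorem5 (n : ℕ) (hn : 1 ≤ n) (s : ℝ)
    (hs : s - (n : ℝ) / 2 ∈ Set.Ioo (0 : ℝ) 1 ∪ Set.Ioo (1 : ℝ) 2) :
    ∃ one : Sob n s, (∀ᵐ ω ∂(surf n), one.toL2 ω = 1) ∧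
      ∃ U ∈ 𝓝 one, ∃ V ∈ 𝓝 one, ∀ u ∈ U,
        ∃ h ∈ V ∩ optimizers n s, u - h ∈ tangentPerp h ∧
          (∀ h' ∈ V ∩ optimizers n s, u - h' ∈ tangentPerp h' → h' = h) ∧
          modDist u = ((aQuad (u - h) : ℝ) : EReal) := by
  -- Any neighborhood can serve as V, since uniqueness holds among all optimizers; the unit ball is
  -- taken. U is the set of u for which the decomposition property holds.
  refine ⟨oneSob hn s, oneSob_ae_eq hn, _,
    exists_decomposition hn hs (Metric.ball_mem_nhds _ one_pos), _,
    Metric.ball_mem_nhds _ one_pos, fun u hu => ?_⟩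
  obtain ⟨h, hh, hρ, huniq⟩ := hu
  exact ⟨h, hh, hρ, fun h' hh' => huniq h' hh'.2, modDist_eq_of_unique hh.2 hρ huniq⟩
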